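/- **Setting.** There are $N$ channels, $N\in\{2,3\}$, whose states $S_1(t),\dots,S_N(t)\in\{0,1\}$, $t=1,2,\dots$, are independent Markov chains with the same $2\times 2$ transition matrix $\mathbf P=(p_{ab})$, $p_{ab}=\Pr[S_i(t+1)=b\mid S_i(t)=a]$, where $|p_{11}-p_{01}|<1$ (that is, $\mathbf P$ is neither the identity nor the swap of the two states). Initially $\Pr[S_i(1)=1]=\omega_i$, with arbitrary $\Omega(1)=(\omega_1,\dots,\omega_N)\in[0,1]^N$. In each slot $t$ the user senses one channel, chosen from its past observations (the channels sensed before and their observed states), observes the state of that channel only, and receives reward $1$ if it is $1$ and $0$ otherwise. The expected regret of a policy $\pi$ after $n$ slots is $$R(\mathbf P,\Omega(1),n)=\sup_{\pi'}E^{\pi'}\Big[\sum_{t=1}^nY(t)\Big]-E^{\pi}\Big[\sum_{t=1}^nY(t)\Big],$$ where $Y(t)$ is the reward of slot $t$ and $\pi'$ runs over all policies, which may depend on $\mathbf P$ and $\Omega(1)$. **The two policies.** $\pi_1$: stay on the current channel after observing $1$; after observing $0$, switch to the channel visited the longest ago. $\pi_2$: stay after observing $0$; after observing $1$, switch to the most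 recently visited channel among those whose last visit was an even number of slots before the slot in which the switch takes effect, or, if there is none, to the channel visited the longest ago. Channels never visited count as visited longer ago than all others, in an arbitrary fixed initial order; the first channel in that order is sensed in slot $1$. Visits are counted over the whole past, whichever policy made them. **The algorithm.** Let $K_1\le K_2\le\cdots$ be positive integers with $K_i\to\infty$. Time is divided into consecutive blocks, block $i$ having $K_i$ slots; one of $\pi_1,\pi_2$ is played throughout each block. Block $1$ plays $\pi_1$, block $2$ plays $\pi_2$. At the start of each later block, with $n$ the number of slots elapsed, $i_j$ the number of blocks in which $\pi_j$ was played so far and $\hat X_j$ the sum over these blocks of the sample mean of the rewards of the block, the block plays a $\pi_j$ that maximizes $$\frac{\hat X_j}{i_j}+\sqrt{\frac{3\ln n}{i_j}},$$ ties being broken arbitrarily (by a rule that may use all past observations). Let $$G(n)=\min\Big\{K_I: I\ge 1,\ \sum_{i=1}^IK_i\ge n\Big\}.$$ **Theorem.** For every such $\mathbf P$ there are constants $Z_1,Z_2$ depending only on $\mathbf P$, and for every such sequence $(K_i)$ there are constants $Z_3,Z_4$ depending only on $\mathbf P$ and $(K_i)$, such that for $N=2$ and $N=3$, all initial probabilities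 $\Omega(1)$, all initial orders, all tie-breaking rules and all $n\ge 1$, the expected regret of the algorithm satisfies $$R(\mathbf P,\Omega(1),n)\le Z_1\,G(n)\ln n+Z_2\ln n+Z_3\,G(n)+Z_4 .$$ -/

import Mathlib

open Finset

/-! The opportunistic spectrum access problem.  A channel state is an element of `Fin 2`
(`1` = available, `0` = busy); `P a b` is the probability of moving from state `a` to state `b`. -/

/-- What the user has seen so far, in chronological order: the sensed channel and its observed
state, slot by slot. -/
abbrev SensingHistory (N : ℕ) : Type := List (Fin N × Fin 2)

/-- A sensing policy chooses the next channel from the past observations. -/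
abbrev SensingPolicy (N : ℕ) : Type := SensingHistory N → Fin N

/-- The observations of the first `t` slots, when policy `π` is used and `S s i` is the state of
channel `i` in slot `s + 1`. -/
def observe {N : ℕ} (π : SensingPolicy N) (S : ℕ → Fin N → Fin 2) : ℕ → SensingHistory N
  | 0 => []
  | t + 1 => observe π S t ++ [(π (observe π S t), S t (π (observe π S t)))]

/-- The reward collected in the first `n` slots: one unit for each sensed channel in state `1`. -/
def totalReward {N : ℕ} (π : SensingPolicy N) (S : ℕ → Fin N → Fin 2) (n : ℕ) : ℝ :=
  ∑ t ∈ range n, if S t (π (observe π S t)) = 1 then 1 else 0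

/-- One factor of the law of one channel: the initial probability of its state (`w` is the
probability that it starts in state `1`), or the probability of the transition into slot `t + 1`. -/
def slotProb (P : Matrix (Fin 2) (Fin 2) ℝ) (w : ℝ) (x : ℕ → Fin 2) : ℕ → ℝ
  | 0 => if x 0 = 1 then w else 1 - w
  | t + 1 => P (x t) (x (t + 1))

/-- The probability that the states of the `N` independent Markov channels in the first `n` slots
are given by `S`, when channel `i` starts in state `1` with probability `ω i`. -/
def pathProb {N : ℕ} (P : Matrix (Fin 2) (Fin 2) ℝ) (ω : Fin N → ℝ) (n : ℕ)
    (S : ℕ → Fin N → Fin 2) : ℝ :=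
  ∏ i, ∏ t ∈ range n, slotProb P (ω i) (fun s => S s i) t

/-- A finite path, continued by zeros; the continuation plays no role. -/
def extendPath {N n : ℕ} (S : Fin n → Fin N → Fin 2) : ℕ → Fin N → Fin 2 :=
  fun t => if h : t < n then S ⟨t, h⟩ else fun _ => 0

/-- The expected reward of policy `π` in the first `n` slots. -/
def expectedReward {N : ℕ} (P : Matrix (Fin 2) (Fin 2) ℝ) (ω : Fin N → ℝ)
    (π : SensingPolicy N) (n : ℕ) : ℝ :=
  ∑ S : Fin n → Fin N → Fin 2, pathProb P ω n (extendPath S) * totalReward π (extendPath S) n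

/-- The largest expected reward in `n` slots that a policy can achieve; the policy may depend on
`P`, on `ω` and on `n`. -/
noncomputable def optimalReward {N : ℕ} (P : Matrix (Fin 2) (Fin 2) ℝ) (ω : Fin N → ℝ)
    (n : ℕ) : ℝ :=
  ⨆ π : SensingPolicy N, expectedReward P ω π n

/-- The supremum in `optimalReward` is over a bounded set. -/
theorem bddAbove_expectedReward {N : ℕ} (P : Matrix (Fin 2) (Fin 2) ℝ) (ω : Fin N → ℝ) (n : ℕ) :
    BddAbove (Set.range fun π : SensingPolicy N => expectedReward P ω π n) := by
  refine ⟨∑ S : Fin n → Fin N → Fin 2, |pathProb P ω n (extendPath S)| * n, ?_⟩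
  rintro _ ⟨π, rfl⟩
  refine Finset.sum_le_sum fun S _ => ?_
  have h0 : 0 ≤ totalReward π (extendPath S) n :=
    Finset.sum_nonneg fun t _ => by split_ifs <;> norm_num
  have h1 : totalReward π (extendPath S) n ≤ n := by
    calc totalReward π (extendPath S) n ≤ ∑ _t ∈ range n, (1 : ℝ) :=
          Finset.sum_le_sum fun t _ => by split_ifs <;> norm_num
      _ = n := by simp
  calc pathProb P ω n (extendPath S) * totalReward π (extendPath S) n
      ≤ |pathProb P ω n (extendPath S)| * totalReward π (extendPath S) n :=
        mul_le_mul_of_nonneg_right (le_abs_self _) h0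
    _ ≤ |pathProb P ω n (extendPath S)| * n :=
        mul_le_mul_of_nonneg_left h1 (abs_nonneg _)

/-- The expected regret of policy `π` after `n` slots. -/
noncomputable def regret {N : ℕ} (P : Matrix (Fin 2) (Fin 2) ℝ) (ω : Fin N → ℝ)
    (π : SensingPolicy N) (n : ℕ) : ℝ :=
  optimalReward P ω n - expectedReward P ω π n

/-! The two myopic policies. -/

/-- The channel `c` was sensed at least once. -/
def Visited {N : ℕ} (h : SensingHistory N) (c : Fin N) : Prop := ∃ o, (c, o) ∈ h

/-- How many slots before the slot to be decided the last visit to `c` took place (`1` for the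
channel sensed last).  A channel that was never visited counts as visited just before the first
slot, hence longer ago than every visited channel. -/
def visitAge {N : ℕ} (h : SensingHistory N) (c : Fin N) : ℕ :=
  h.reverse.findIdx (fun p => decide (p.1 = c)) + 1

/-- The channels, listed in the initial order `σ 0, σ 1, …`. -/
def channelList {N : ℕ} (σ : Equiv.Perm (Fin N)) : List (Fin N) := (List.finRange N).map σ

/-- The channel visited the longest ago; among channels never visited, the first one in the initial
order. -/
def longestAgo {N : ℕ} [NeZero N] (σ : Equiv.Perm (Fin N)) (h : SensingHistory N) : Fin N :=
  ((channelList σ).argmax (visitAge h)).getD (σ 0)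

open Classical in
/-- The channel most recently visited among those last visited an even number of slots before the
slot to be decided; if there is none, the channel visited the longest ago. -/
noncomputable def recentEven {N : ℕ} [NeZero N] (σ : Equiv.Perm (Fin N))
    (h : SensingHistory N) : Fin N :=
  (((channelList σ).filter fun c => decide (Visited h c ∧ Even (visitAge h c))).argmin
    (visitAge h)).getD (longestAgo σ h)

/-- Policy `π₁`: stay on a `1`, and on a `0` switch to the channel visited the longest ago. -/
def policyOne {N : ℕ} [NeZero N] (σ : Equiv.Perm (Fin N)) : SensingPolicy N := fun h =>
  match h.getLast? with
  | none => σ 0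
  | some (c, o) => if o = 1 then c else longestAgo σ h

/-- Policy `π₂`: stay on a `0`, and on a `1` switch to the channel `recentEven`. -/
noncomputable def policyTwo {N : ℕ} [NeZero N] (σ : Equiv.Perm (Fin N)) : SensingPolicy N :=
  fun h =>
    match h.getLast? with
    | none => σ 0
    | some (c, o) => if o = 1 then recentEven σ h else c

/-- The two arms of the meta-policy: arm `0` is `π₁`, arm `1` is `π₂`. -/
noncomputable def myopicPolicy {N : ℕ} [NeZero N] (σ : Equiv.Perm (Fin N)) (j : Fin 2) :
    SensingPolicy N :=
  if j = 0 then policyOne σ else policyTwo σ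

/-! The meta-policy.  Blocks are numbered from `1`; block `i` has length `K i`, and the value
`K 0` is never used. -/

/-- `K 1, K 2, …` is a non-decreasing divergent sequence of positive integers. -/
structure IsBlockSequence (K : ℕ → ℕ) : Prop where
  pos : ∀ i, 1 ≤ i → 1 ≤ K i
  mono : ∀ i j, 1 ≤ i → i ≤ j → K i ≤ K j
  diverges : Filter.Tendsto K Filter.atTop Filter.atTop

/-- The number of slots in the first `I` blocks. -/
def blockEnd (K : ℕ → ℕ) (I : ℕ) : ℕ := ∑ i ∈ Icc 1 I, K i

/-- The number of the block that is under way when `t` slots have elapsed. -/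
noncomputable def blockAt (K : ℕ → ℕ) (t : ℕ) : ℕ := sInf {I | t < blockEnd K I}

/-- `G(n) = min K_I` over the `I ≥ 1` with `K_1 + ⋯ + K_I ≥ n`. -/
noncomputable def blockLength (K : ℕ → ℕ) (n : ℕ) : ℕ :=
  sInf {k | ∃ I, 1 ≤ I ∧ n ≤ blockEnd K I ∧ k = K I}

/-- The reward received in slot `s + 1`, read off from the history. -/
def observedReward {N : ℕ} (h : SensingHistory N) (s : ℕ) : ℝ :=
  match h[s]? with
  | none => 0
  | some (_, o) => if o = 1 then 1 else 0

/-- The sample mean of the rewards of block `I`. -/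
noncomputable def blockMean {N : ℕ} (K : ℕ → ℕ) (h : SensingHistory N) (I : ℕ) : ℝ :=
  (∑ s ∈ Ico (blockEnd K (I - 1)) (blockEnd K I), observedReward h s) / K I

/-- The variables of the meta-policy: for each arm `j`, the number `i_j` of blocks in which it was
played and the sum `X̂_j` of the sample means of these blocks. -/
structure MetaState where
  count : Fin 2 → ℕ
  total : Fin 2 → ℝ

/-- The index `X̂_j / i_j + √(3 ln n / i_j)`. -/
noncomputable def MetaState.index (m : MetaState) (n : ℕ) (j : Fin 2) : ℝ :=
  m.total j / m.count j + Real.sqrt (3 * Real.log n / m.count j)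

/-- The arm with the larger index; `tie` is taken if the indices agree. -/
noncomputable def MetaState.best (m : MetaState) (n : ℕ) (tie : Fin 2) : Fin 2 :=
  if m.index n 1 < m.index n 0 then 0
  else if m.index n 0 < m.index n 1 then 1
  else tie

/-- The arm of block `I + 1`, where `m` holds the variables after `I` blocks: `π₁` in block `1`,
`π₂` in block `2`, then the arm with the larger index.  Ties are broken by an arbitrary
rule `tie`, which may look at all observations of the first `I` blocks. -/
noncomputable def nextArm {N : ℕ} (K : ℕ → ℕ) (tie : SensingHistory N → Fin 2)
    (h : SensingHistory N) (I : ℕ) (m : MetaState) : Fin 2 :=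
  if I = 0 then 0
  else if I = 1 then 1
  else m.best (blockEnd K I) (tie (h.take (blockEnd K I)))

/-- The variables of the meta-policy after the first `I` blocks, computed from the history. -/
noncomputable def metaState {N : ℕ} (K : ℕ → ℕ) (tie : SensingHistory N → Fin 2)
    (h : SensingHistory N) : ℕ → MetaState
  | 0 => ⟨fun _ => 0, fun _ => 0⟩
  | I + 1 =>
    let m := metaState K tie h I
    let j := nextArm K tie h I m
    ⟨Function.update m.count j (m.count j + 1),
      Function.update m.total j (m.total j + blockMean K h (I + 1))⟩

/-- The arm that is played in block `I ≥ 1`. -/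
noncomputable def blockArm {N : ℕ} (K : ℕ → ℕ) (tie : SensingHistory N → Fin 2)
    (h : SensingHistory N) (I : ℕ) : Fin 2 :=
  nextArm K tie h (I - 1) (metaState K tie h (I - 1))

/-- The sensing policy for unknown dynamic channels: in each slot, follow the arm of the block that
is under way, applied to the whole past. -/
noncomputable def metaPolicy {N : ℕ} [NeZero N] (K : ℕ → ℕ) (σ : Equiv.Perm (Fin N))
    (tie : SensingHistory N → Fin 2) : SensingPolicy N :=
  fun h => myopicPolicy σ (blockArm K tie h (blockAt K h.length)) h

/-! ### Beliefs and expectations along histories -/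

/-! Write p o for the probability of moving from state o to state 1, and δ = p 1 - p 0. Given the
observations, the channels stay independent, and their conditional law is described by the vector of
beliefs. The problem is therefore a finite-horizon decision process on beliefs
(`expectedReward_eq_policyValue`, `optVal`).

Myopic optimality. The value of a list rule is affine in every belief. Exchanging two neighbours in
the list therefore changes the value by the difference of their beliefs times a coefficient free of
both. For two or three channels the recursion for these coefficients keeps them in [0,1], and the
coefficient of the front pair is at least 1 - |δ|. Hence sensing the most promising channel is
optimal, and sensing another one costs at least (1 - |δ|) times the belief gap (`greedyOptimal`). Up
to the order of the initial list, π₁ realizes this rule for δ ≥ 0 and π₂ for δ ≤ 0, so one arm is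
optimal up to an additive constant from every history. The other arm loses linearly
(`exists_separatesArms`), except when δ = 0 or when a positively correlated chain has an absorbing
state. In those cases all policies agree up to a constant (`optVal_le_policyValue_of_degenerate`).

Bandit argument. Beliefs contract by |δ| per slot, so the optimal value is Lipschitz uniformly in
the horizon and equals nμ + O(1) from all beliefs (`exists_optimalRate`). Whatever the past, the
conditional mean of a block of length K is thus at least μ - C/K for the good arm and at most μ - Δ
+ C/K for the bad one. Exponential supermartingales (`pathExpect_exp_armExponent_le`) replace the
independence of the samples in the usual UCB analysis, and the biases C/K are absorbed because K_i →
∞. The bad arm is then played in O(ln n) blocks on average (`pathExpect_badBlocks_le`). Each of them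
has at most G(n) slots, and a slot off the good arm costs a bounded amount
(`policyValue_le_pathExpect_armSlots`). -/

/-- The probability of state `1` one slot later, when the probability is `x` now; `p o` is the
probability of a transition from `o` to `1`. -/
def nextBelief (p : Fin 2 → ℝ) (x : ℝ) : ℝ := x * p 1 + (1 - x) * p 0

/-- The beliefs for the next slot, after channel `i` was observed in state `o`. -/
def updateBelief {N : ℕ} (p : Fin 2 → ℝ) (b : Fin N → ℝ) (i : Fin N) (o : Fin 2) : Fin N → ℝ :=
  fun j => if j = i then p o else nextBelief p (b j)

/-- The conditional probabilities of state `1` in the next slot, given the history. -/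
def belief {N : ℕ} (p : Fin 2 → ℝ) (ω : Fin N → ℝ) (h : SensingHistory N) : Fin N → ℝ :=
  h.foldl (fun b q => updateBelief p b q.1 q.2) ω

/-- The conditional expectation, given the history `h`, of `F` evaluated at the history `n` slots
later, when policy `π` is used. -/
def pathExpect {N : ℕ} (p : Fin 2 → ℝ) (ω : Fin N → ℝ) (π : SensingPolicy N) :
    ℕ → (SensingHistory N → ℝ) → SensingHistory N → ℝ
  | 0, F, h => F h
  | n + 1, F, h =>
    belief p ω h (π h) * pathExpect p ω π n F (h ++ [(π h, 1)]) +
      (1 - belief p ω h (π h)) * pathExpect p ω π n F (h ++ [(π h, 0)])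

/-- The conditional expected reward of the next `n` slots. -/
def policyValue {N : ℕ} (p : Fin 2 → ℝ) (ω : Fin N → ℝ) (π : SensingPolicy N) :
    ℕ → SensingHistory N → ℝ
  | 0, _ => 0
  | n + 1, h =>
    belief p ω h (π h) * (1 + policyValue p ω π n (h ++ [(π h, 1)])) +
      (1 - belief p ω h (π h)) * policyValue p ω π n (h ++ [(π h, 0)])

/-- The reward collected along a history. -/
def historyReward {N : ℕ} (h : SensingHistory N) : ℝ :=
  (h.map fun q => if q.2 = 1 then (1 : ℝ) else 0).sum

/-- The probability of state `o` when the belief is `x`. -/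
def bernoulliWeight (x : ℝ) (o : Fin 2) : ℝ := if o = 1 then x else 1 - x

section
variable {N : ℕ} {p : Fin 2 → ℝ} {ω : Fin N → ℝ} {π : SensingPolicy N}

theorem nextBelief_mem (hp : ∀ o, p o ∈ Set.Icc (0 : ℝ) 1) {x : ℝ} (hx : x ∈ Set.Icc (0 : ℝ) 1) :
    nextBelief p x ∈ Set.Icc (0 : ℝ) 1 := by
  have h0 := hp 0
  have h1 := hp 1
  simp only [Set.mem_Icc, nextBelief] at *
  constructor <;> nlinarith

theorem updateBelief_mem (hp : ∀ o, p o ∈ Set.Icc (0 : ℝ) 1) {b : Fin N → ℝ}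
    (hb : ∀ i, b i ∈ Set.Icc (0 : ℝ) 1) (i : Fin N) (o : Fin 2) (j : Fin N) :
    updateBelief p b i o j ∈ Set.Icc (0 : ℝ) 1 := by
  unfold updateBelief
  split_ifs
  · exact hp o
  · exact nextBelief_mem hp (hb j)

theorem belief_append (h : SensingHistory N) (i : Fin N) (o : Fin 2) :
    belief p ω (h ++ [(i, o)]) = updateBelief p (belief p ω h) i o := by
  simp [belief]

theorem belief_mem (hp : ∀ o, p o ∈ Set.Icc (0 : ℝ) 1) (hω : ∀ i, ω i ∈ Set.Icc (0 : ℝ) 1)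
    (h : SensingHistory N) : ∀ j, belief p ω h j ∈ Set.Icc (0 : ℝ) 1 := by
  induction h using List.reverseRecOn with
  | nil => simpa [belief] using hω
  | append_singleton h q ih =>
    obtain ⟨i, o⟩ := q
    intro j
    rw [belief_append]
    exact updateBelief_mem hp ih i o j

theorem historyReward_append (h g : SensingHistory N) :
    historyReward (h ++ g) = historyReward h + historyReward g := by
  simp [historyReward]

theorem pathExpect_historyReward (n : ℕ) (h : SensingHistory N) :
    pathExpect p ω π n historyReward h = historyReward h + policyValue p ω π n h := by
  induction n generalizing h with
  | zero => simp [pathExpect, policyValue]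
  | succ n ih =>
    simp only [pathExpect, policyValue, ih, historyReward_append]
    simp only [historyReward, List.map_cons, List.map_nil, List.sum_cons, List.sum_nil]
    norm_num
    ring

theorem pathExpect_add (n : ℕ) (F G : SensingHistory N → ℝ) (h : SensingHistory N) :
    pathExpect p ω π n (fun h => F h + G h) h =
      pathExpect p ω π n F h + pathExpect p ω π n G h := by
  induction n generalizing h with
  | zero => rfl
  | succ n ih => simp only [pathExpect, ih]; ring

theorem pathExpect_const_mul (n : ℕ) (c : ℝ) (F : SensingHistory N → ℝ) (h : SensingHistory N) :
    pathExpect p ω π n (fun h => c * F h) h = c * pathExpect p ω π n F h := by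
  induction n generalizing h with
  | zero => rfl
  | succ n ih => simp only [pathExpect, ih]; ring

theorem pathExpect_const (n : ℕ) (c : ℝ) (h : SensingHistory N) :
    pathExpect p ω π n (fun _ => c) h = c := by
  induction n generalizing h with
  | zero => rfl
  | succ n ih => simp only [pathExpect, ih]; ring

theorem pathExpect_sum {ι : Type*} (s : Finset ι) (n : ℕ) (F : ι → SensingHistory N → ℝ)
    (h : SensingHistory N) :
    pathExpect p ω π n (fun h => ∑ i ∈ s, F i h) h = ∑ i ∈ s, pathExpect p ω π n (F i) h := by
  classical
  induction s using Finset.induction_on with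
  | empty => simpa using pathExpect_const n 0 h
  | insert a s ha ih =>
    simp only [Finset.sum_insert ha]
    rw [pathExpect_add, ih]

theorem pathExpect_comp (m n : ℕ) (F : SensingHistory N → ℝ) (h : SensingHistory N) :
    pathExpect p ω π (m + n) F h = pathExpect p ω π m (pathExpect p ω π n F) h := by
  induction m generalizing h with
  | zero => simp [pathExpect]
  | succ m ih => rw [Nat.succ_add]; simp only [pathExpect, ih]

theorem pathExpect_succ_last (n : ℕ) (F : SensingHistory N → ℝ) (h : SensingHistory N) :
    pathExpect p ω π (n + 1) F h = pathExpect p ω π n (fun h =>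
      belief p ω h (π h) * F (h ++ [(π h, 1)]) +
        (1 - belief p ω h (π h)) * F (h ++ [(π h, 0)])) h := by
  rw [pathExpect_comp]; rfl

theorem pathExpect_mono (hp : ∀ o, p o ∈ Set.Icc (0 : ℝ) 1) (hω : ∀ i, ω i ∈ Set.Icc (0 : ℝ) 1)
    (n : ℕ) {F G : SensingHistory N → ℝ} (h : SensingHistory N)
    (hFG : ∀ g : SensingHistory N, g.length = n → F (h ++ g) ≤ G (h ++ g)) :
    pathExpect p ω π n F h ≤ pathExpect p ω π n G h := by
  induction n generalizing h with
  | zero => simpa [pathExpect] using hFG [] rfl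
  | succ n ih =>
    simp only [pathExpect]
    have hb := belief_mem hp hω h (π h)
    have key : ∀ o, pathExpect p ω π n F (h ++ [(π h, o)]) ≤
        pathExpect p ω π n G (h ++ [(π h, o)]) := fun o => ih _ fun g hg => by
      simpa using hFG ((π h, o) :: g) (by simp [hg])
    exact add_le_add (mul_le_mul_of_nonneg_left (key 1) hb.1)
      (mul_le_mul_of_nonneg_left (key 0) (by linarith [hb.2]))

theorem pathExpect_congr (n : ℕ) {π' : SensingPolicy N} {F G : SensingHistory N → ℝ}
    (h : SensingHistory N) (hπ : ∀ g : SensingHistory N, g.length < n → π (h ++ g) = π' (h ++ g))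
    (hFG : ∀ g : SensingHistory N, g.length = n → F (h ++ g) = G (h ++ g)) :
    pathExpect p ω π n F h = pathExpect p ω π' n G h := by
  induction n generalizing h with
  | zero => simpa [pathExpect] using hFG [] rfl
  | succ n ih =>
    have h0 : π h = π' h := by simpa using hπ [] (by simp)
    have key : ∀ o, pathExpect p ω π n F (h ++ [(π' h, o)]) =
        pathExpect p ω π' n G (h ++ [(π' h, o)]) := fun o => ih _
      (fun g hg => by simpa using hπ ((π' h, o) :: g) (by simpa using hg))
      (fun g hg => by simpa using hFG ((π' h, o) :: g) (by simp [hg]))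
    simp only [pathExpect, h0, key]

/-- A functional of the first `m` observations has the same expectation at every later time. -/
theorem pathExpect_take {m n : ℕ} (hmn : m ≤ n) (F : SensingHistory N → ℝ) :
    pathExpect p ω π n (fun h => F (h.take m)) [] = pathExpect p ω π m F [] := by
  obtain ⟨k, rfl⟩ := Nat.exists_eq_add_of_le hmn
  rw [pathExpect_comp]
  refine pathExpect_congr m [] (fun _ _ => rfl) fun g hg => ?_
  rw [← pathExpect_const (p := p) (ω := ω) (π := π) k (F ([] ++ g)) ([] ++ g)]
  refine pathExpect_congr k _ (fun _ _ => rfl) fun g' _ => ?_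
  simp [← hg]

/-! ### The law of the observations -/

theorem observe_congr {S T : ℕ → Fin N → Fin 2} {n : ℕ} (h : ∀ t < n, S t = T t) :
    observe π S n = observe π T n := by
  induction n with
  | zero => rfl
  | succ n ih =>
    simp only [observe, ih fun t ht => h t (by omega), h n (by omega)]

theorem totalReward_eq (S : ℕ → Fin N → Fin 2) (n : ℕ) :
    totalReward π S n = historyReward (observe π S n) := by
  induction n with
  | zero => simp [totalReward, observe, historyReward]
  | succ n ih =>
    rw [observe, historyReward_append, ← ih]
    rw [totalReward, sum_range_succ, ← totalReward]
    simp [historyReward]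

theorem extendPath_snoc_lt {n : ℕ} (S : Fin n → Fin N → Fin 2) (s : Fin N → Fin 2) {t : ℕ}
    (ht : t < n) :
    extendPath (Fin.snoc (α := fun _ => Fin N → Fin 2) S s) t = extendPath S t := by
  have h1 : t < n + 1 := by omega
  simp [extendPath, ht, h1, Fin.snoc]

theorem extendPath_snoc_last {n : ℕ} (S : Fin n → Fin N → Fin 2) (s : Fin N → Fin 2) :
    extendPath (Fin.snoc (α := fun _ => Fin N → Fin 2) S s) n = s := by
  simp [extendPath, Fin.snoc]

theorem slotProb_congr {P : Matrix (Fin 2) (Fin 2) ℝ} {w : ℝ} {x y : ℕ → Fin 2} {t : ℕ}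
    (h : ∀ s ≤ t, x s = y s) : slotProb P w x t = slotProb P w y t := by
  cases t with
  | zero => simp [slotProb, h 0 le_rfl]
  | succ t => simp [slotProb, h t (by omega), h (t + 1) le_rfl]

theorem pathProb_snoc_zero {P : Matrix (Fin 2) (Fin 2) ℝ} (S : Fin 0 → Fin N → Fin 2)
    (s : Fin N → Fin 2) :
    pathProb P ω 1 (extendPath (Fin.snoc (α := fun _ => Fin N → Fin 2) S s)) =
      ∏ i, bernoulliWeight (ω i) (s i) := by
  simp [pathProb, slotProb, extendPath_snoc_last, bernoulliWeight]

theorem pathProb_snoc_succ {P : Matrix (Fin 2) (Fin 2) ℝ} {n : ℕ}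
    (S : Fin (n + 1) → Fin N → Fin 2) (s : Fin N → Fin 2) :
    pathProb P ω (n + 2) (extendPath (Fin.snoc (α := fun _ => Fin N → Fin 2) S s)) =
      pathProb P ω (n + 1) (extendPath S) * ∏ i, P (extendPath S n i) (s i) := by
  unfold pathProb
  rw [← prod_mul_distrib]
  refine prod_congr rfl fun i _ => ?_
  rw [prod_range_succ]
  congr 1
  · refine prod_congr rfl fun t ht => slotProb_congr fun u hu => ?_
    rw [extendPath_snoc_lt]
    have := mem_range.1 ht
    omega
  · simp only [slotProb]
    rw [extendPath_snoc_last, extendPath_snoc_lt _ _ (by omega)]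

theorem sum_path_succ {n : ℕ} (f : (Fin (n + 1) → Fin N → Fin 2) → ℝ) :
    ∑ S, f S = ∑ S : Fin n → Fin N → Fin 2, ∑ s : Fin N → Fin 2,
      f (Fin.snoc (α := fun _ => Fin N → Fin 2) S s) := by
  rw [← (Fin.snocEquiv fun _ : Fin (n + 1) => Fin N → Fin 2).sum_comp, Fintype.sum_prod_type,
    sum_comm]
  rfl

/-- One step of the filter: predicting the next state from the updated beliefs. -/
theorem sum_filter_step {P : Matrix (Fin 2) (Fin 2) ℝ} (hP : P ∈ Matrix.rowStochastic ℝ (Fin 2))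
    (b : Fin N → ℝ) (i : Fin N) (s' : Fin N → Fin 2) (G : Fin 2 → ℝ) :
    ∑ s : Fin N → Fin 2, (∏ j, bernoulliWeight (b j) (s j)) * ((∏ j, P (s j) (s' j)) * G (s i)) =
      b i * ((∏ j, bernoulliWeight (updateBelief (fun o => P o 1) b i 1 j) (s' j)) * G 1) +
      (1 - b i) *
        ((∏ j, bernoulliWeight (updateBelief (fun o => P o 1) b i 0 j) (s' j)) * G 0) := by
  have hrow : ∀ a, P a 0 = 1 - P a 1 := fun a => by
    have := Matrix.sum_row_of_mem_rowStochastic hP a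
    rw [Fin.sum_univ_two] at this
    linarith
  have hPw : ∀ a c, P a c = bernoulliWeight (P a 1) c := fun a c => by
    fin_cases c <;> simp [bernoulliWeight, hrow]
  let f : Fin N → Fin 2 → ℝ := fun j a =>
    bernoulliWeight (b j) a * P a (s' j) * (if j = i then G a else 1)
  have h1 : ∀ s : Fin N → Fin 2, (∏ j, bernoulliWeight (b j) (s j)) *
      ((∏ j, P (s j) (s' j)) * G (s i)) = ∏ j, f j (s j) := fun s => by
    simp only [f, prod_mul_distrib, prod_ite_eq', mem_univ, if_true]
    ring
  simp only [h1]
  -- The sum over state vectors factors over the channels, and only the factor of `i` feels the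
  -- observation.
  rw [← Fintype.prod_sum f, ← mul_prod_erase univ _ (mem_univ i)]
  have h2 : ∀ o, ∏ j, bernoulliWeight (updateBelief (fun o => P o 1) b i o j) (s' j) =
      P o (s' i) * ∏ j ∈ univ.erase i, ∑ a, f j a := fun o => by
    rw [← mul_prod_erase univ _ (mem_univ i)]
    congr 1
    · simp [updateBelief, ← hPw]
    · refine prod_congr rfl fun j hj => ?_
      have hji := ne_of_mem_erase hj
      simp only [updateBelief, hji, if_false, f, Fin.sum_univ_two, nextBelief, mul_one]
      generalize s' j = c
      fin_cases c <;> simp [bernoulliWeight, hrow] <;> ring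
  rw [h2, h2, Fin.sum_univ_two]
  simp [f, bernoulliWeight]
  ring

/-- Given the history, the current state vector is a product of Bernoulli variables with the beliefs
as parameters. `F` must also see the unobserved states, since the induction needs the whole vector
to make the next transition. -/
theorem sum_pathProb_eq_pathExpect {P : Matrix (Fin 2) (Fin 2) ℝ}
    (hP : P ∈ Matrix.rowStochastic ℝ (Fin 2)) (n : ℕ)
    (F : SensingHistory N → (Fin N → Fin 2) → ℝ) :
    ∑ S : Fin (n + 1) → Fin N → Fin 2, pathProb P ω (n + 1) (extendPath S) *
        F (observe π (extendPath S) n) (extendPath S n) =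
      pathExpect (fun o => P o 1) ω π n (fun h => ∑ s : Fin N → Fin 2,
        (∏ j, bernoulliWeight (belief (fun o => P o 1) ω h j) (s j)) * F h s) [] := by
  induction n generalizing F with
  | zero =>
    rw [sum_path_succ]
    rw [Fintype.sum_unique]
    simp only [Nat.zero_add, pathProb_snoc_zero, extendPath_snoc_last, observe, pathExpect, belief,
      List.foldl_nil]
  | succ n ih =>
    rw [sum_path_succ, pathExpect_succ_last]
    have h1 : ∀ (S : Fin (n + 1) → Fin N → Fin 2) (s : Fin N → Fin 2),
        observe π (extendPath (Fin.snoc (α := fun _ => Fin N → Fin 2) S s)) (n + 1) =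
          observe π (extendPath S) (n + 1) := fun S s =>
      observe_congr fun t ht => extendPath_snoc_lt S s ht
    simp only [pathProb_snoc_succ, extendPath_snoc_last, h1, mul_assoc, ← mul_sum]
    refine (ih fun h s' => ∑ s, (∏ j, P (s' j) (s j)) * F (h ++ [(π h, s' (π h))]) s).trans ?_
    refine pathExpect_congr n [] (fun _ _ => rfl) fun g _ => ?_
    simp only [mul_sum]
    rw [sum_comm, ← sum_add_distrib]
    refine sum_congr rfl fun s' _ => ?_
    rw [sum_filter_step hP _ (π ([] ++ g)) s' fun o => F ([] ++ g ++ [(π ([] ++ g), o)]) s']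
    simp only [belief_append]

theorem sum_bernoulliWeight (b : Fin N → ℝ) :
    ∑ s : Fin N → Fin 2, ∏ j, bernoulliWeight (b j) (s j) = 1 := by
  rw [← Fintype.prod_sum fun j => bernoulliWeight (b j)]
  exact prod_eq_one fun j _ => by simp [Fin.sum_univ_two, bernoulliWeight]

theorem expectedReward_eq_policyValue {P : Matrix (Fin 2) (Fin 2) ℝ}
    (hP : P ∈ Matrix.rowStochastic ℝ (Fin 2)) (n : ℕ) :
    expectedReward P ω π n = policyValue (fun o => P o 1) ω π n [] := by
  -- This law is stated for paths of n + 1 slots. Here the functional ignores the last state vector,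
  -- which is summed out below.
  have h1 := sum_pathProb_eq_pathExpect (ω := ω) (π := π) hP n fun h _ => historyReward h
  simp only [← sum_mul, sum_bernoulliWeight, one_mul] at h1
  rw [pathExpect_historyReward] at h1
  simp only [historyReward, List.map_nil, List.sum_nil, zero_add] at h1
  rw [← h1, sum_path_succ, expectedReward]
  refine sum_congr rfl fun S _ => ?_
  rw [totalReward_eq]
  have h2 : ∀ s : Fin N → Fin 2,
      observe π (extendPath (Fin.snoc (α := fun _ => Fin N → Fin 2) S s)) n =
        observe π (extendPath S) n := fun s => observe_congr fun t ht => extendPath_snoc_lt S s ht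
  simp only [h2, ← sum_mul]
  rw [historyReward]
  congr 1
  cases n with
  | zero =>
    simp only [Nat.zero_add, pathProb_snoc_zero, sum_bernoulliWeight]
    simp [pathProb]
  | succ n =>
    simp only [pathProb_snoc_succ, ← mul_sum]
    rw [← Fintype.prod_sum fun j => P (extendPath S n j)]
    simp [Matrix.sum_row_of_mem_rowStochastic hP]

end

/-! ### Dynamic programming -/

/-- The value of sensing channel `i` at beliefs `b`, when `V` is the value of the later slots. -/
def actionVal {N : ℕ} (p : Fin 2 → ℝ) (V : (Fin N → ℝ) → ℝ) (b : Fin N → ℝ) (i : Fin N) : ℝ :=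
  b i * (1 + V (updateBelief p b i 1)) + (1 - b i) * V (updateBelief p b i 0)

/-- The largest expected reward in `n` slots, as a function of the beliefs. -/
noncomputable def optVal {N : ℕ} (p : Fin 2 → ℝ) : ℕ → (Fin N → ℝ) → ℝ
  | 0, _ => 0
  | n + 1, b => ⨆ i, actionVal p (optVal p n) b i

section
variable {N : ℕ} {p : Fin 2 → ℝ} {ω : Fin N → ℝ} {π : SensingPolicy N}

theorem actionVal_le_optVal (n : ℕ) (b : Fin N → ℝ) (i : Fin N) :
    actionVal p (optVal p n) b i ≤ optVal p (n + 1) b :=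
  le_ciSup (f := fun i => actionVal p (optVal p n) b i) (Set.finite_range _).bddAbove i

theorem optVal_succ_le [NeZero N] {n : ℕ} {b : Fin N → ℝ} {c : ℝ}
    (h : ∀ i, actionVal p (optVal p n) b i ≤ c) : optVal p (n + 1) b ≤ c :=
  ciSup_le h

theorem actionVal_mono {V W : (Fin N → ℝ) → ℝ} {b : Fin N → ℝ}
    (hb : ∀ i, b i ∈ Set.Icc (0 : ℝ) 1) (i : Fin N)
    (h1 : ∀ o, V (updateBelief p b i o) ≤ W (updateBelief p b i o)) :
    actionVal p V b i ≤ actionVal p W b i := by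
  have h2 := hb i
  exact add_le_add (mul_le_mul_of_nonneg_left (by linarith [h1 1]) h2.1)
      (mul_le_mul_of_nonneg_left (h1 0) (by linarith [h2.2]))

theorem actionVal_add_const (V : (Fin N → ℝ) → ℝ) (b : Fin N → ℝ) (i : Fin N) (c : ℝ) :
    actionVal p (fun b => V b + c) b i = actionVal p V b i + c := by
  unfold actionVal; ring

/-- The recursion for the value of a policy, for bounds that depend on the last observation. -/
theorem policyValue_succ_le (hp : ∀ o, p o ∈ Set.Icc (0 : ℝ) 1)
    (hω : ∀ i, ω i ∈ Set.Icc (0 : ℝ) 1) {n : ℕ} {h : SensingHistory N}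
    {V : (Fin N → ℝ) → ℝ} {c : Fin 2 → ℝ}
    (hV : ∀ o, policyValue p ω π n (h ++ [(π h, o)]) ≤
      V (belief p ω (h ++ [(π h, o)])) + c o) :
    policyValue p ω π (n + 1) h ≤ actionVal p V (belief p ω h) (π h) +
      (belief p ω h (π h) * c 1 + (1 - belief p ω h (π h)) * c 0) := by
  simp only [belief_append] at hV
  have h2 := belief_mem hp hω h (π h)
  have h3 := mul_le_mul_of_nonneg_left (hV 1) h2.1
  have h4 := mul_le_mul_of_nonneg_left (hV 0) (sub_nonneg.2 h2.2)
  simp only [policyValue, actionVal]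
  linarith

theorem le_policyValue_succ (hp : ∀ o, p o ∈ Set.Icc (0 : ℝ) 1)
    (hω : ∀ i, ω i ∈ Set.Icc (0 : ℝ) 1) {n : ℕ} {h : SensingHistory N}
    {V : (Fin N → ℝ) → ℝ} {c : ℝ}
    (hV : ∀ o, V (belief p ω (h ++ [(π h, o)])) - c ≤
      policyValue p ω π n (h ++ [(π h, o)])) :
    actionVal p V (belief p ω h) (π h) - c ≤ policyValue p ω π (n + 1) h := by
  simp only [belief_append] at hV
  have h2 := belief_mem hp hω h (π h)
  have h3 := mul_le_mul_of_nonneg_left (hV 1) h2.1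
  have h4 := mul_le_mul_of_nonneg_left (hV 0) (sub_nonneg.2 h2.2)
  simp only [policyValue, actionVal]
  linarith

theorem policyValue_le_optVal (hp : ∀ o, p o ∈ Set.Icc (0 : ℝ) 1)
    (hω : ∀ i, ω i ∈ Set.Icc (0 : ℝ) 1) (n : ℕ) (h : SensingHistory N) :
    policyValue p ω π n h ≤ optVal p n (belief p ω h) := by
  induction n generalizing h with
  | zero => simp [policyValue, optVal]
  | succ n ih =>
    have h1 := policyValue_succ_le (V := optVal p n) (c := fun _ => 0) hp hω (π := π) (h := h)
      (n := n) fun o => by simpa using ih _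
    have h2 := actionVal_le_optVal (p := p) n (belief p ω h) (π h)
    linarith

theorem policyValue_nonneg (hp : ∀ o, p o ∈ Set.Icc (0 : ℝ) 1)
    (hω : ∀ i, ω i ∈ Set.Icc (0 : ℝ) 1) (n : ℕ) (h : SensingHistory N) :
    0 ≤ policyValue p ω π n h := by
  induction n generalizing h with
  | zero => simp [policyValue]
  | succ n ih =>
    have h2 := belief_mem hp hω h (π h)
    exact add_nonneg (mul_nonneg h2.1 (by linarith [ih (h ++ [(π h, 1)])]))
      (mul_nonneg (by linarith [h2.2]) (ih _))

/-! ### Dependence of the optimal value on the beliefs and on the horizon -/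

theorem nextBelief_sub (x y : ℝ) :
    nextBelief p x - nextBelief p y = (p 1 - p 0) * (x - y) := by
  unfold nextBelief; ring

/-- The constant D = 1/(1 - |δ|) is the fixed point of D = 1 + |δ|D. A change in the belief of the
sensed channel shifts probability between its two outcomes, which are worth at most 1 + |δ|D apart.
The other beliefs move closer by the factor |δ|. -/
theorem optVal_lipschitz [NeZero N] (hp : ∀ o, p o ∈ Set.Icc (0 : ℝ) 1) (hδ : |p 1 - p 0| < 1)
    (n : ℕ) {b b' : Fin N → ℝ} (hb : ∀ i, b i ∈ Set.Icc (0 : ℝ) 1)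
    (hb' : ∀ i, b' i ∈ Set.Icc (0 : ℝ) 1) :
    optVal p n b - optVal p n b' ≤ 1 / (1 - |p 1 - p 0|) * ∑ i, |b i - b' i| := by
  set D := 1 / (1 - |p 1 - p 0|) with hD
  have hd : 0 < 1 - |p 1 - p 0| := by linarith
  have hD0 : 0 < D := by positivity
  have hDeq : 1 + D * |p 1 - p 0| = D := by rw [hD]; field_simp; ring
  induction n generalizing b b' with
  | zero =>
    have : (0 : ℝ) ≤ ∑ i, |b i - b' i| := by positivity
    simp only [optVal, sub_zero]
    positivity
  | succ n ih =>
    rw [sub_le_iff_le_add]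
    refine optVal_succ_le fun i => ?_
    have h0 := actionVal_le_optVal (p := p) n b' i
    refine le_trans ?_ (add_le_add_right h0 _)
    have hu := fun o => updateBelief_mem hp hb i o
    have hu' := fun o => updateBelief_mem hp hb' i o
    have h1 : ∀ o, ∑ j, |updateBelief p b i o j - updateBelief p b' i o j| =
        |p 1 - p 0| * ∑ j ∈ univ.erase i, |b j - b' j| := fun o => by
      rw [← add_sum_erase univ _ (mem_univ i), mul_sum]
      simp only [updateBelief, if_true, sub_self, abs_zero, zero_add]
      refine sum_congr rfl fun j hj => ?_
      simp only [ne_of_mem_erase hj, if_false]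
      rw [nextBelief_sub, abs_mul]
    have h2 : ∀ o o', ∑ j, |updateBelief p b' i o j - updateBelief p b' i o' j| = |p o - p o'| :=
      fun o o' => by
      rw [← add_sum_erase univ _ (mem_univ i), sum_eq_zero]
      · simp [updateBelief]
      · intro j hj
        simp [updateBelief, ne_of_mem_erase hj]
    have k1 := ih (hu 1) (hu' 1)
    have k0 := ih (hu 0) (hu' 0)
    have k10 := ih (hu' 1) (hu' 0)
    have k01 := ih (hu' 0) (hu' 1)
    rw [h1] at k1 k0
    rw [h2] at k10 k01
    rw [abs_sub_comm (p 0)] at k01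
    have h3 : (b i - b' i) * (1 + (optVal p n (updateBelief p b' i 1) -
        optVal p n (updateBelief p b' i 0))) ≤ |b i - b' i| * D := by
      refine (le_abs_self _).trans ?_
      rw [abs_mul]
      refine mul_le_mul_of_nonneg_left ?_ (abs_nonneg _)
      rw [abs_le]
      constructor <;> linarith
    have h4 := mul_le_mul_of_nonneg_left k1 (hb i).1
    have h5 := mul_le_mul_of_nonneg_left k0 (sub_nonneg.2 (hb i).2)
    rw [← add_sum_erase univ _ (mem_univ i)]
    have h6 : D * (|p 1 - p 0| * ∑ j ∈ univ.erase i, |b j - b' j|) ≤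
        D * ∑ j ∈ univ.erase i, |b j - b' j| := by
      refine mul_le_mul_of_nonneg_left ?_ hD0.le
      refine mul_le_of_le_one_left (sum_nonneg fun _ _ => abs_nonneg _) hδ.le
    simp only [actionVal]
    nlinarith

theorem optVal_le_add [NeZero N] (hp : ∀ o, p o ∈ Set.Icc (0 : ℝ) 1) (hδ : |p 1 - p 0| < 1)
    (n : ℕ) {b b' : Fin N → ℝ} (hb : ∀ i, b i ∈ Set.Icc (0 : ℝ) 1)
    (hb' : ∀ i, b' i ∈ Set.Icc (0 : ℝ) 1) :
    optVal p n b ≤ optVal p n b' + N / (1 - |p 1 - p 0|) := by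
  have h1 := optVal_lipschitz hp hδ n hb hb'
  have h2 : ∑ i, |b i - b' i| ≤ (N : ℝ) := by
    calc ∑ i, |b i - b' i| ≤ ∑ _i : Fin N, (1 : ℝ) := sum_le_sum fun i _ => by
          have := hb i
          have := hb' i
          simp only [Set.mem_Icc] at *
          rw [abs_le]; constructor <;> linarith
      _ = N := by simp
  have h3 : 0 < 1 - |p 1 - p 0| := by linarith
  have h4 := mul_le_mul_of_nonneg_left h2 (one_div_pos.2 h3).le
  rw [one_div_mul_eq_div (1 - |p 1 - p 0|) (N : ℝ)] at h4
  linarith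

/-- The last `m` slots start from some beliefs, so a bound uniform in the beliefs can be carried
through the recursion as a terminal reward. -/
theorem optVal_add_le [NeZero N] (hp : ∀ o, p o ∈ Set.Icc (0 : ℝ) 1) {m : ℕ} {c : ℝ}
    (hc : ∀ b : Fin N → ℝ, (∀ i, b i ∈ Set.Icc (0 : ℝ) 1) → optVal p m b ≤ c) (n : ℕ)
    {b : Fin N → ℝ} (hb : ∀ i, b i ∈ Set.Icc (0 : ℝ) 1) :
    optVal p (n + m) b ≤ optVal p n b + c := by
  induction n generalizing b with
  | zero => simpa [optVal] using hc b hb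
  | succ n ih =>
    rw [Nat.succ_add]
    refine optVal_succ_le fun i => ?_
    have h1 := actionVal_mono (p := p) (V := optVal p (n + m)) (W := fun b => optVal p n b + c)
      hb i fun o => ih (updateBelief_mem hp hb i o)
    rw [actionVal_add_const] at h1
    linarith [actionVal_le_optVal (p := p) n b i]

theorem le_optVal_add [NeZero N] (hp : ∀ o, p o ∈ Set.Icc (0 : ℝ) 1) {m : ℕ} {c : ℝ}
    (hc : ∀ b : Fin N → ℝ, (∀ i, b i ∈ Set.Icc (0 : ℝ) 1) → c ≤ optVal p m b) (n : ℕ)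
    {b : Fin N → ℝ} (hb : ∀ i, b i ∈ Set.Icc (0 : ℝ) 1) :
    optVal p n b + c ≤ optVal p (n + m) b := by
  induction n generalizing b with
  | zero => simpa [optVal] using hc b hb
  | succ n ih =>
    rw [Nat.succ_add, ← le_sub_iff_add_le]
    refine optVal_succ_le fun i => ?_
    have h1 := actionVal_mono (p := p) (V := fun b => optVal p n b + c) (W := optVal p (n + m))
      hb i fun o => ih (updateBelief_mem hp hb i o)
    rw [actionVal_add_const] at h1
    linarith [actionVal_le_optVal (p := p) (n + m) b i]

theorem optVal_nonneg [NeZero N] (hp : ∀ o, p o ∈ Set.Icc (0 : ℝ) 1) (n : ℕ)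
    {b : Fin N → ℝ} (hb : ∀ i, b i ∈ Set.Icc (0 : ℝ) 1) : 0 ≤ optVal p n b := by
  have h1 := policyValue_nonneg (π := fun _ => (0 : Fin N)) hp hb n []
  have h2 := policyValue_le_optVal (π := fun _ => (0 : Fin N)) hp hb n []
  exact h1.trans h2

/-- The optimal reward of `n` slots is `n μ` up to a bounded error. -/
theorem exists_optimalRate (N : ℕ) [NeZero N] (hp : ∀ o, p o ∈ Set.Icc (0 : ℝ) 1)
    (hδ : |p 1 - p 0| < 1) :
    ∃ μ C : ℝ, ∀ n, ∀ b : Fin N → ℝ, (∀ i, b i ∈ Set.Icc (0 : ℝ) 1) →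
      |optVal p n b - n * μ| ≤ C := by
  set E : ℝ := N / (1 - |p 1 - p 0|) with hE
  have hE0 : 0 ≤ E := div_nonneg (Nat.cast_nonneg _) (by linarith)
  let b₀ : Fin N → ℝ := fun _ => 0
  have hb₀ : ∀ i, b₀ i ∈ Set.Icc (0 : ℝ) 1 := fun _ => by simp [b₀]
  let a : ℕ → ℝ := fun n => optVal p n b₀
  have ha0 : ∀ n, 0 ≤ a n := fun n => optVal_nonneg hp n hb₀
  -- The values from `b₀` are additive up to the error `E`, so Fekete's lemma applies to both a + E
  -- and E - a.
  have hu : Subadditive fun n => a n + E := fun m n => by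
    have := optVal_add_le hp (fun b hb => optVal_le_add hp hδ n hb hb₀) m hb₀
    simp only [a]
    linarith
  have hv : Subadditive fun n => E - a n := fun m n => by
    have := le_optVal_add hp (m := n) (c := a n - E)
      (fun b hb => by have := optVal_le_add hp hδ n hb₀ hb; simp only [a]; linarith) m hb₀
    simp only [a] at *
    linarith
  have hbu : BddBelow (Set.range fun n : ℕ => (a n + E) / n) := by
    refine ⟨0, ?_⟩
    rintro _ ⟨n, rfl⟩
    have := ha0 n
    positivity
  have han : ∀ n, a n ≤ n := fun n => by
    induction n with
    | zero => simp [a, optVal]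
    | succ n ih =>
      have := optVal_add_le hp (m := n) (c := n) (fun b hb => ?_) 1 hb₀
      · have h1 : optVal p 1 b₀ ≤ 1 := optVal_succ_le fun i => by
          simp [actionVal, optVal, b₀]
        simp only [a]
        rw [add_comm n 1]
        push_cast
        linarith
      · clear ih
        induction n generalizing b with
        | zero => simp [optVal]
        | succ n ih =>
          refine optVal_succ_le fun i => ?_
          have h1 := actionVal_mono (p := p) (V := optVal p n) (W := fun _ => (n : ℝ)) hb i
            fun o => ih _ (updateBelief_mem hp hb i o)
          have h2 := (hb i).2
          simp only [actionVal] at h1 ⊢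
          push_cast
          nlinarith
  have hbv : BddBelow (Set.range fun n : ℕ => (E - a n) / n) := by
    refine ⟨-1, ?_⟩
    rintro _ ⟨n, rfl⟩
    rcases Nat.eq_zero_or_pos n with rfl | hn
    · simp
    · have hn' : (0 : ℝ) < n := by exact_mod_cast hn
      simp only
      rw [le_div_iff₀ hn']
      linarith [han n]
  -- Since the two sequences add up to the constant 2E, their rates are opposite, and the one-sided
  -- Fekete bounds enclose `a n` within `E` of n times the limit.
  have hlim : hv.lim = -hu.lim := by
    have t1 := hu.tendsto_lim hbu
    have t2 := hv.tendsto_lim hbv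
    have t3 : Filter.Tendsto (fun n : ℕ => (2 * E) / (n : ℝ)) Filter.atTop (nhds 0) :=
      tendsto_const_div_atTop_nhds_zero_nat _
    have t4 := t1.add t2
    have h5 : (fun n : ℕ => (a n + E) / n + (E - a n) / n) = fun n : ℕ => (2 * E) / (n : ℝ) := by
      funext n; rw [← add_div]; congr 1; ring
    rw [h5] at t4
    have := tendsto_nhds_unique t4 t3
    linarith
  -- One `E` is the error in Fekete's bounds, the other pays for passing from `b` to `b₀`.
  refine ⟨hu.lim, 2 * E, fun n b hb => ?_⟩
  rcases Nat.eq_zero_or_pos n with rfl | hn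
  · simp [optVal, hE0]
  have hn' : (0 : ℝ) < n := by exact_mod_cast hn
  have h1 := hu.lim_le_div hbu hn.ne'
  have h2 := hv.lim_le_div hbv hn.ne'
  rw [le_div_iff₀ hn'] at h1 h2
  rw [hlim] at h2
  have h3 := optVal_le_add hp hδ n hb hb₀
  have h4 := optVal_le_add hp hδ n hb₀ hb
  rw [← hE] at h3 h4
  simp only [a] at h1 h2
  rw [abs_le]
  constructor <;> linarith

end

/-! ### Priority lists -/

/-- The value of the rule that keeps the channels in a list, senses the first one, leaves the list
as it is on a `1` and moves the first channel to the end on a `0`. -/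
def pairValPos (p : Fin 2 → ℝ) : ℕ → ℝ → ℝ → ℝ
  | 0, _, _ => 0
  | n + 1, x, y =>
    x * (1 + pairValPos p n (p 1) (nextBelief p y)) + (1 - x) * pairValPos p n (nextBelief p y) (p 0)

/-- The value of the rule that senses the first channel of a list, reverses the list on a `1`, and
reverses all of it but the first channel on a `0`. -/
def pairValNeg (p : Fin 2 → ℝ) : ℕ → ℝ → ℝ → ℝ
  | 0, _, _ => 0
  | n + 1, x, y =>
    x * (1 + pairValNeg p n (nextBelief p y) (p 1)) + (1 - x) * pairValNeg p n (p 0) (nextBelief p y)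

/-- The three-channel analogue of `pairValPos`. -/
def tripleValPos (p : Fin 2 → ℝ) : ℕ → ℝ → ℝ → ℝ → ℝ
  | 0, _, _, _ => 0
  | n + 1, x, y, z =>
    x * (1 + tripleValPos p n (p 1) (nextBelief p y) (nextBelief p z)) +
      (1 - x) * tripleValPos p n (nextBelief p y) (nextBelief p z) (p 0)

/-- The three-channel analogue of `pairValNeg`. -/
def tripleValNeg (p : Fin 2 → ℝ) : ℕ → ℝ → ℝ → ℝ → ℝ
  | 0, _, _, _ => 0
  | n + 1, x, y, z =>
    x * (1 + tripleValNeg p n (nextBelief p z) (nextBelief p y) (p 1)) +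
      (1 - x) * tripleValNeg p n (p 0) (nextBelief p z) (nextBelief p y)

/-- Exchanging neighbours in a list of two channels gains a multiple of the difference of the
beliefs. -/
structure PairSwap (c : ℝ) (W : ℕ → ℝ → ℝ → ℝ) : Prop where
  gain : ∀ n x y, x ∈ Set.Icc (0 : ℝ) 1 → y ∈ Set.Icc (0 : ℝ) 1 → y ≤ x →
    c * (x - y) ≤ W (n + 1) x y - W (n + 1) y x ∧ W (n + 1) x y - W (n + 1) y x ≤ 1

/-- Exchanging neighbours in a list of three channels gains a multiple of the difference of the
beliefs. -/
structure TripleSwap (c : ℝ) (W : ℕ → ℝ → ℝ → ℝ → ℝ) : Prop where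
  gain_fst : ∀ n x y z, x ∈ Set.Icc (0 : ℝ) 1 → y ∈ Set.Icc (0 : ℝ) 1 → z ∈ Set.Icc (0 : ℝ) 1 →
    y ≤ x → c * (x - y) ≤ W (n + 1) x y z - W (n + 1) y x z ∧
      W (n + 1) x y z - W (n + 1) y x z ≤ 1
  gain_snd : ∀ n x y z, x ∈ Set.Icc (0 : ℝ) 1 → y ∈ Set.Icc (0 : ℝ) 1 → z ∈ Set.Icc (0 : ℝ) 1 →
    z ≤ y → 0 ≤ W (n + 1) x y z - W (n + 1) x z y ∧ W (n + 1) x y z - W (n + 1) x z y ≤ 1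

/-- Three different channels. -/
def Distinct {N : ℕ} (i j k : Fin N) : Prop := i ≠ j ∧ j ≠ k ∧ i ≠ k

section
variable {p : Fin 2 → ℝ}

/-- A function affine in each variable is determined by its values at the four corners of the unit
square. Antisymmetrizing cancels the constant and the xy terms. -/
theorem biaffine_swap {f : ℝ → ℝ → ℝ} (h1 : ∀ t u v y, f (t * u + (1 - t) * v) y =
    t * f u y + (1 - t) * f v y) (h2 : ∀ t u v x, f x (t * u + (1 - t) * v) =
    t * f x u + (1 - t) * f x v) (x y : ℝ) :
    f x y - f y x = (x - y) * (f 1 0 - f 0 1) := by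
  have e1 : ∀ t y, f t y = t * f 1 y + (1 - t) * f 0 y := fun t y => by
    rw [← h1]; ring_nf
  have e2 : ∀ t x, f x t = t * f x 1 + (1 - t) * f x 0 := fun t x => by
    rw [← h2]; ring_nf
  rw [e1 x y, e1 y x, e2 y 1, e2 y 0, e2 x 1, e2 x 0]
  ring

theorem nextBelief_affine (t u v : ℝ) : nextBelief p (t * u + (1 - t) * v) =
    t * nextBelief p u + (1 - t) * nextBelief p v := by
  unfold nextBelief; ring

theorem nextBelief_zero : nextBelief p 0 = p 0 := by simp [nextBelief]

theorem nextBelief_one : nextBelief p 1 = p 1 := by simp [nextBelief]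

theorem nextBelief_sub_zero (x : ℝ) : nextBelief p x - p 0 = (p 1 - p 0) * x := by
  unfold nextBelief; ring

theorem nextBelief_sub_one (x : ℝ) : p 1 - nextBelief p x = (p 1 - p 0) * (1 - x) := by
  unfold nextBelief; ring

/-! Two channels. -/

theorem pairValPos_affine (n : ℕ) :
    (∀ t u v y, pairValPos p n (t * u + (1 - t) * v) y =
      t * pairValPos p n u y + (1 - t) * pairValPos p n v y) ∧
    (∀ t u v x, pairValPos p n x (t * u + (1 - t) * v) =
      t * pairValPos p n x u + (1 - t) * pairValPos p n x v) := by
  induction n with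
  | zero => simp [pairValPos]
  | succ n ih =>
    refine ⟨fun t u v y => ?_, fun t u v x => ?_⟩
    · simp only [pairValPos]; ring
    · simp only [pairValPos, nextBelief_affine, ih.1, ih.2]; ring

theorem pairValNeg_affine (n : ℕ) :
    (∀ t u v y, pairValNeg p n (t * u + (1 - t) * v) y =
      t * pairValNeg p n u y + (1 - t) * pairValNeg p n v y) ∧
    (∀ t u v x, pairValNeg p n x (t * u + (1 - t) * v) =
      t * pairValNeg p n x u + (1 - t) * pairValNeg p n x v) := by
  induction n with
  | zero => simp [pairValNeg]
  | succ n ih =>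
    refine ⟨fun t u v y => ?_, fun t u v x => ?_⟩
    · simp only [pairValNeg]; ring
    · simp only [pairValNeg, nextBelief_affine, ih.1, ih.2]; ring

theorem pairSwap_of_sub_eq {W : ℕ → ℝ → ℝ → ℝ} {c : ℝ} (hc : c ≤ 1)
    (hW : ∀ n x y, W (n + 1) x y - W (n + 1) y x = x - y) : PairSwap c W := by
  refine ⟨fun n x y hx hy hxy => ?_⟩
  rw [hW]
  have := hx.2
  have := hy.1
  exact ⟨mul_le_of_le_one_left (by linarith) hc, by linarith⟩

/-- Sensing a channel known to be in state 1, or first the one known to be in state 0, leaves the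
same list behind. Only the immediate reward differs, so the gain is exactly x - y. -/
theorem pairValPos_swap : PairSwap (1 - |p 1 - p 0|) (pairValPos p) := by
  refine pairSwap_of_sub_eq (by linarith [abs_nonneg (p 1 - p 0)]) fun n x y => ?_
  rw [biaffine_swap (pairValPos_affine (n + 1)).1 (pairValPos_affine (n + 1)).2]
  simp [pairValPos, nextBelief_zero, nextBelief_one]

theorem pairValNeg_swap : PairSwap (1 - |p 1 - p 0|) (pairValNeg p) := by
  refine pairSwap_of_sub_eq (by linarith [abs_nonneg (p 1 - p 0)]) fun n x y => ?_
  rw [biaffine_swap (pairValNeg_affine (n + 1)).1 (pairValNeg_affine (n + 1)).2]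
  simp [pairValNeg, nextBelief_zero, nextBelief_one]

/-! Three channels. -/

theorem tripleValPos_affine (n : ℕ) :
    (∀ t u v y z, tripleValPos p n (t * u + (1 - t) * v) y z =
      t * tripleValPos p n u y z + (1 - t) * tripleValPos p n v y z) ∧
    (∀ t u v x z, tripleValPos p n x (t * u + (1 - t) * v) z =
      t * tripleValPos p n x u z + (1 - t) * tripleValPos p n x v z) ∧
    (∀ t u v x y, tripleValPos p n x y (t * u + (1 - t) * v) =
      t * tripleValPos p n x y u + (1 - t) * tripleValPos p n x y v) := by
  induction n with
  | zero => simp [tripleValPos]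
  | succ n ih =>
    refine ⟨fun t u v y z => ?_, fun t u v x z => ?_, fun t u v x y => ?_⟩
    · simp only [tripleValPos]; ring
    · simp only [tripleValPos, nextBelief_affine, ih.1, ih.2.1]; ring
    · simp only [tripleValPos, nextBelief_affine, ih.2.2, ih.2.1]; ring

theorem tripleValNeg_affine (n : ℕ) :
    (∀ t u v y z, tripleValNeg p n (t * u + (1 - t) * v) y z =
      t * tripleValNeg p n u y z + (1 - t) * tripleValNeg p n v y z) ∧
    (∀ t u v x z, tripleValNeg p n x (t * u + (1 - t) * v) z =
      t * tripleValNeg p n x u z + (1 - t) * tripleValNeg p n x v z) ∧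
    (∀ t u v x y, tripleValNeg p n x y (t * u + (1 - t) * v) =
      t * tripleValNeg p n x y u + (1 - t) * tripleValNeg p n x y v) := by
  induction n with
  | zero => simp [tripleValNeg]
  | succ n ih =>
    refine ⟨fun t u v y z => ?_, fun t u v x z => ?_, fun t u v x y => ?_⟩
    · simp only [tripleValNeg]; ring
    · simp only [tripleValNeg, nextBelief_affine, ih.2.2, ih.2.1]; ring
    · simp only [tripleValNeg, nextBelief_affine, ih.1, ih.2.1]; ring

theorem tripleValPos_swap_fst (n : ℕ) (x y z : ℝ) :
    tripleValPos p n x y z - tripleValPos p n y x z =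
      (x - y) * (tripleValPos p n 1 0 z - tripleValPos p n 0 1 z) :=
  biaffine_swap (f := fun x y => tripleValPos p n x y z)
    (fun t u v y => (tripleValPos_affine n).1 t u v y z)
    (fun t u v x => (tripleValPos_affine n).2.1 t u v x z) x y

theorem tripleValPos_swap_snd (n : ℕ) (x y z : ℝ) :
    tripleValPos p n x y z - tripleValPos p n x z y =
      (y - z) * (tripleValPos p n x 1 0 - tripleValPos p n x 0 1) :=
  biaffine_swap (f := fun y z => tripleValPos p n x y z)
    (fun t u v z => (tripleValPos_affine n).2.1 t u v x z)
    (fun t u v y => (tripleValPos_affine n).2.2 t u v x y) y z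

theorem tripleValNeg_swap_fst (n : ℕ) (x y z : ℝ) :
    tripleValNeg p n x y z - tripleValNeg p n y x z =
      (x - y) * (tripleValNeg p n 1 0 z - tripleValNeg p n 0 1 z) :=
  biaffine_swap (f := fun x y => tripleValNeg p n x y z)
    (fun t u v y => (tripleValNeg_affine n).1 t u v y z)
    (fun t u v x => (tripleValNeg_affine n).2.1 t u v x z) x y

theorem tripleValNeg_swap_snd (n : ℕ) (x y z : ℝ) :
    tripleValNeg p n x y z - tripleValNeg p n x z y =
      (y - z) * (tripleValNeg p n x 1 0 - tripleValNeg p n x 0 1) :=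
  biaffine_swap (f := fun y z => tripleValNeg p n x y z)
    (fun t u v z => (tripleValNeg_affine n).2.1 t u v x z)
    (fun t u v y => (tripleValNeg_affine n).2.2 t u v x y) y z

/-- Both orders keep a channel of belief `p 1` in front. They differ by one unit of reward and by an
exchange of the two channels behind it. -/
theorem tripleValPos_fst_succ (n : ℕ) (z : ℝ) :
    tripleValPos p (n + 1) 1 0 z - tripleValPos p (n + 1) 0 1 z =
      1 - (p 1 - p 0) * z * (tripleValPos p n (p 1) 1 0 - tripleValPos p n (p 1) 0 1) := by
  rw [← nextBelief_sub_zero z, ← tripleValPos_swap_snd]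
  simp [tripleValPos, nextBelief_zero, nextBelief_one]
  ring

/-- On a 1 the exchanged pair stays in the last two places, on a 0 it moves to the front. Its belief
gap is multiplied by δ in either case. -/
theorem tripleValPos_snd_succ (n : ℕ) (x : ℝ) :
    tripleValPos p (n + 1) x 1 0 - tripleValPos p (n + 1) x 0 1 =
      x * (p 1 - p 0) * (tripleValPos p n (p 1) 1 0 - tripleValPos p n (p 1) 0 1) +
      (1 - x) * (p 1 - p 0) * (tripleValPos p n 1 0 (p 0) - tripleValPos p n 0 1 (p 0)) := by
  rw [mul_assoc x, mul_assoc (1 - x), ← tripleValPos_swap_snd, ← tripleValPos_swap_fst]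
  simp [tripleValPos, nextBelief_zero, nextBelief_one]
  ring

/-- Both orders put a channel of belief `p 1` last and differ afterwards by an exchange of the first
two. -/
theorem tripleValNeg_fst_succ (n : ℕ) (z : ℝ) :
    tripleValNeg p (n + 1) 1 0 z - tripleValNeg p (n + 1) 0 1 z =
      1 - (p 0 - p 1) * z * (tripleValNeg p n 1 0 (p 1) - tripleValNeg p n 0 1 (p 1)) := by
  have h : (p 0 - p 1) * z = p 0 - nextBelief p z := by unfold nextBelief; ring
  rw [h, ← tripleValNeg_swap_fst]
  simp [tripleValNeg, nextBelief_zero, nextBelief_one]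
  ring

theorem tripleValNeg_snd_succ (n : ℕ) (x : ℝ) :
    tripleValNeg p (n + 1) x 1 0 - tripleValNeg p (n + 1) x 0 1 =
      x * (p 0 - p 1) * (tripleValNeg p n 1 0 (p 1) - tripleValNeg p n 0 1 (p 1)) +
      (1 - x) * (p 0 - p 1) * (tripleValNeg p n (p 0) 1 0 - tripleValNeg p n (p 0) 0 1) := by
  rw [mul_assoc x, mul_assoc (1 - x), ← tripleValNeg_swap_snd, ← tripleValNeg_swap_fst]
  simp [tripleValNeg, nextBelief_zero, nextBelief_one]
  ring

theorem one_sub_mul_mem {d z a : ℝ} (hd : d ∈ Set.Icc (0 : ℝ) 1) (hz : z ∈ Set.Icc (0 : ℝ) 1)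
    (ha : a ∈ Set.Icc (0 : ℝ) 1) : 1 - d * z * a ∈ Set.Icc (1 - d) 1 := by
  have h1 : d * z * a ≤ d * 1 * 1 := by
    have := hd.1; have := hz.1; have := ha.1
    gcongr
    exacts [hz.2, ha.2]
  have h2 : 0 ≤ d * z * a := mul_nonneg (mul_nonneg hd.1 hz.1) ha.1
  constructor <;> linarith

theorem mul_add_mul_mem {d x a b : ℝ} (hd : d ∈ Set.Icc (0 : ℝ) 1) (hx : x ∈ Set.Icc (0 : ℝ) 1)
    (ha : a ∈ Set.Icc (0 : ℝ) 1) (hb : b ∈ Set.Icc (0 : ℝ) 1) :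
    x * d * a + (1 - x) * d * b ∈ Set.Icc (0 : ℝ) 1 := by
  have hx' : 0 ≤ 1 - x := by linarith [hx.2]
  have h1 : d * a ≤ 1 := mul_le_one₀ hd.2 ha.1 ha.2
  have h2 : d * b ≤ 1 := mul_le_one₀ hd.2 hb.1 hb.2
  have h3 := mul_nonneg hd.1 ha.1
  have h4 := mul_nonneg hd.1 hb.1
  have h5 := hx.1
  constructor <;> nlinarith

/-- The two coefficients feed into each other's recursion, so they are bounded together. At horizon
0 both vanish, which is why the sharper bound 1 - δ on the front coefficient is read off only at
positive horizons. -/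
theorem tripleValPos_bounds (hp : ∀ o, p o ∈ Set.Icc (0 : ℝ) 1) (hδ : 0 ≤ p 1 - p 0) (n : ℕ) :
    ∀ x ∈ Set.Icc (0 : ℝ) 1,
      tripleValPos p n 1 0 x - tripleValPos p n 0 1 x ∈ Set.Icc (0 : ℝ) 1 ∧
      tripleValPos p n x 1 0 - tripleValPos p n x 0 1 ∈ Set.Icc (0 : ℝ) 1 := by
  have hd : p 1 - p 0 ∈ Set.Icc (0 : ℝ) 1 := ⟨hδ, by linarith [(hp 1).2, (hp 0).1]⟩
  induction n with
  | zero => simp [tripleValPos]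
  | succ n ih =>
    intro x hx
    rw [tripleValPos_fst_succ, tripleValPos_snd_succ]
    exact ⟨Set.Icc_subset_Icc_left (by linarith [hd.2]) (one_sub_mul_mem hd hx (ih _ (hp 1)).2),
      mul_add_mul_mem hd hx (ih _ (hp 1)).2 (ih _ (hp 0)).1⟩

theorem tripleValNeg_bounds (hp : ∀ o, p o ∈ Set.Icc (0 : ℝ) 1) (hδ : 0 ≤ p 0 - p 1) (n : ℕ) :
    ∀ x ∈ Set.Icc (0 : ℝ) 1,
      tripleValNeg p n 1 0 x - tripleValNeg p n 0 1 x ∈ Set.Icc (0 : ℝ) 1 ∧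
      tripleValNeg p n x 1 0 - tripleValNeg p n x 0 1 ∈ Set.Icc (0 : ℝ) 1 := by
  have hd : p 0 - p 1 ∈ Set.Icc (0 : ℝ) 1 := ⟨hδ, by linarith [(hp 0).2, (hp 1).1]⟩
  induction n with
  | zero => simp [tripleValNeg]
  | succ n ih =>
    intro x hx
    rw [tripleValNeg_fst_succ, tripleValNeg_snd_succ]
    exact ⟨Set.Icc_subset_Icc_left (by linarith [hd.2]) (one_sub_mul_mem hd hx (ih _ (hp 1)).1),
      mul_add_mul_mem hd hx (ih _ (hp 1)).1 (ih _ (hp 0)).2⟩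

theorem mul_bounds_of_mem {x y c a : ℝ} (hx : x ∈ Set.Icc (0 : ℝ) 1) (hy : y ∈ Set.Icc (0 : ℝ) 1)
    (hxy : y ≤ x) (hc : c ≤ a) (ha : a ∈ Set.Icc (0 : ℝ) 1) :
    c * (x - y) ≤ (x - y) * a ∧ (x - y) * a ≤ 1 := by
  have h1 := hx.2
  have h2 := hy.1
  rw [mul_comm c]
  exact ⟨mul_le_mul_of_nonneg_left hc (by linarith), mul_le_one₀ (by linarith) ha.1 ha.2⟩

theorem tripleValPos_swap (hp : ∀ o, p o ∈ Set.Icc (0 : ℝ) 1) (hδ : 0 ≤ p 1 - p 0) :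
    TripleSwap (1 - |p 1 - p 0|) (tripleValPos p) := by
  have hd : p 1 - p 0 ∈ Set.Icc (0 : ℝ) 1 := ⟨hδ, by linarith [(hp 1).2, (hp 0).1]⟩
  refine ⟨fun n x y z hx hy hz hxy => ?_, fun n x y z hx hy hz hxy => ?_⟩
  · rw [tripleValPos_swap_fst]
    refine mul_bounds_of_mem hx hy hxy ?_ (tripleValPos_bounds hp hδ _ z hz).1
    rw [abs_of_nonneg hδ, tripleValPos_fst_succ]
    exact (one_sub_mul_mem hd hz (tripleValPos_bounds hp hδ n _ (hp 1)).2).1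
  · rw [tripleValPos_swap_snd]
    have h1 := (tripleValPos_bounds hp hδ (n + 1) x hx).2
    simpa using mul_bounds_of_mem hy hz hxy h1.1 h1

theorem tripleValNeg_swap (hp : ∀ o, p o ∈ Set.Icc (0 : ℝ) 1) (hδ : 0 ≤ p 0 - p 1) :
    TripleSwap (1 - |p 1 - p 0|) (tripleValNeg p) := by
  have hd : p 0 - p 1 ∈ Set.Icc (0 : ℝ) 1 := ⟨hδ, by linarith [(hp 0).2, (hp 1).1]⟩
  refine ⟨fun n x y z hx hy hz hxy => ?_, fun n x y z hx hy hz hxy => ?_⟩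
  · rw [tripleValNeg_swap_fst]
    refine mul_bounds_of_mem hx hy hxy ?_ (tripleValNeg_bounds hp hδ _ z hz).1
    rw [abs_sub_comm, abs_of_nonneg hδ, tripleValNeg_fst_succ]
    exact (one_sub_mul_mem hd hz (tripleValNeg_bounds hp hδ n _ (hp 1)).1).1
  · rw [tripleValNeg_swap_snd]
    have h1 := (tripleValNeg_bounds hp hδ (n + 1) x hx).2
    simpa using mul_bounds_of_mem hy hz hxy h1.1 h1

/-! ### Optimality of sensing the most promising channel -/

/-- Sensing channel `i` rather than `j` loses at least `c` times the difference of the beliefs. -/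
def GreedyOptimal (N : ℕ) (p : Fin 2 → ℝ) (c : ℝ) : Prop :=
  ∀ n, ∀ b : Fin N → ℝ, (∀ i, b i ∈ Set.Icc (0 : ℝ) 1) → ∀ i j,
    actionVal p (optVal p n) b i + c * (b j - b i) ≤ optVal p (n + 1) b

theorem exists_third {i j : Fin 3} (hij : i ≠ j) : ∃ k, Distinct i j k := by
  revert i j; unfold Distinct; decide

theorem eq_of_distinct {i j k : Fin 3} (h : Distinct i j k) (l : Fin 3) :
    l = i ∨ l = j ∨ l = k := by
  revert i j k l; unfold Distinct; decide

theorem exists_sorted_others (b : Fin 3 → ℝ) (i : Fin 3) :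
    ∃ j k, Distinct i j k ∧ b k ≤ b j := by
  obtain ⟨j, hj⟩ : ∃ j, i ≠ j := by revert i; decide
  obtain ⟨k, hk⟩ := exists_third hj
  rcases le_total (b k) (b j) with h | h
  · exact ⟨j, k, hk, h⟩
  · exact ⟨k, j, ⟨hk.2.2, hk.2.1.symm, hk.1⟩, h⟩

/-- The value `W n` of lists agrees with `V` on sorted lists. -/
def AgreesOnSorted (V : (Fin 3 → ℝ) → ℝ) (W : ℝ → ℝ → ℝ → ℝ) : Prop :=
  ∀ b : Fin 3 → ℝ, (∀ i, b i ∈ Set.Icc (0 : ℝ) 1) → ∀ i j k, Distinct i j k →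
    b j ≤ b i → b k ≤ b j → V b = W (b i) (b j) (b k)

/-- The list rule `W` performs the recursion of dynamic programming on sorted lists. -/
def TripleStep (p : Fin 2 → ℝ) (W : ℕ → ℝ → ℝ → ℝ → ℝ) : Prop :=
  (∀ x y z, W 0 x y z = 0) ∧ ∀ n V, AgreesOnSorted V (W n) →
    ∀ b : Fin 3 → ℝ, (∀ i, b i ∈ Set.Icc (0 : ℝ) 1) → ∀ i j k, Distinct i j k → b k ≤ b j →
      actionVal p V b i = W (n + 1) (b i) (b j) (b k)

/-- Once sensed, a channel has the extreme belief `p 1` or `p 0` and belongs at the front or at the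
end. The evolution of the other beliefs is monotone, so the new list is sorted. This holds for every
sensed `i`; only the other two need to be in order. -/
theorem tripleValPos_step (hp : ∀ o, p o ∈ Set.Icc (0 : ℝ) 1) (hδ : 0 ≤ p 1 - p 0) :
    TripleStep p (tripleValPos p) := by
  refine ⟨fun _ _ _ => rfl, fun n V hV b hb i j k hijk hjk => ?_⟩
  obtain ⟨hij, hjk', hik⟩ := hijk
  have hu := fun o => updateBelief_mem hp hb i o
  have e := fun o => (⟨by simp [updateBelief], by simp [updateBelief, hij.symm],
    by simp [updateBelief, hik.symm]⟩ : updateBelief p b i o i = p o ∧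
      updateBelief p b i o j = nextBelief p (b j) ∧ updateBelief p b i o k = nextBelief p (b k))
  have hkj : nextBelief p (b k) ≤ nextBelief p (b j) := by
    have := nextBelief_sub (p := p) (b j) (b k)
    nlinarith
  have h1 : nextBelief p (b j) ≤ p 1 := by
    have := nextBelief_sub_one (p := p) (b j)
    nlinarith [(hb j).2]
  have h0 : p 0 ≤ nextBelief p (b k) := by
    have := nextBelief_sub_zero (p := p) (b k)
    nlinarith [(hb k).1]
  unfold actionVal
  rw [hV _ (hu 1) i j k ⟨hij, hjk', hik⟩ (by rwa [(e 1).1, (e 1).2.1])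
      (by rwa [(e 1).2.2, (e 1).2.1]),
    hV _ (hu 0) j k i ⟨hjk', hik.symm, hij.symm⟩ (by rwa [(e 0).2.2, (e 0).2.1])
      (by rwa [(e 0).1, (e 0).2.2])]
  simp only [e, tripleValPos]

/-- Here the evolution of the beliefs reverses the order of the unobserved channels, and a 1
produces the smallest belief. The reversals in the list rule restore the sorting. -/
theorem tripleValNeg_step (hp : ∀ o, p o ∈ Set.Icc (0 : ℝ) 1) (hδ : 0 ≤ p 0 - p 1) :
    TripleStep p (tripleValNeg p) := by
  refine ⟨fun _ _ _ => rfl, fun n V hV b hb i j k hijk hjk => ?_⟩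
  obtain ⟨hij, hjk', hik⟩ := hijk
  have hu := fun o => updateBelief_mem hp hb i o
  have e := fun o => (⟨by simp [updateBelief], by simp [updateBelief, hij.symm],
    by simp [updateBelief, hik.symm]⟩ : updateBelief p b i o i = p o ∧
      updateBelief p b i o j = nextBelief p (b j) ∧ updateBelief p b i o k = nextBelief p (b k))
  have hkj : nextBelief p (b j) ≤ nextBelief p (b k) := by
    have := nextBelief_sub (p := p) (b j) (b k)
    nlinarith
  have h1 : p 1 ≤ nextBelief p (b j) := by
    have := nextBelief_sub_one (p := p) (b j)
    nlinarith [(hb j).2]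
  have h0 : nextBelief p (b k) ≤ p 0 := by
    have := nextBelief_sub_zero (p := p) (b k)
    nlinarith [(hb k).1]
  unfold actionVal
  rw [hV _ (hu 1) k j i ⟨hjk'.symm, hij.symm, hik.symm⟩ (by rwa [(e 1).2.2, (e 1).2.1])
      (by rwa [(e 1).1, (e 1).2.1]),
    hV _ (hu 0) i k j ⟨hik, hjk'.symm, hij⟩ (by rwa [(e 0).1, (e 0).2.2])
      (by rwa [(e 0).2.2, (e 0).2.1])]
  simp only [e, tripleValNeg]

section
variable {W : ℕ → ℝ → ℝ → ℝ → ℝ} {c : ℝ}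

/-- Sensing any channel first is worth the list value with that channel moved to the front.
Neighbour exchanges bring the list back to sorted order without a loss. -/
theorem optVal_agreesOnSorted (hc : 0 ≤ c) (hs : TripleSwap c W) (hW : TripleStep p W) (n : ℕ) :
    AgreesOnSorted (optVal p n) (W n) := by
  induction n with
  | zero => intro b hb i j k _ _ _; simp [optVal, hW.1]
  | succ n ih =>
    intro b hb i j k hd hji hkj
    have hQ := hW.2 n _ ih b hb
    refine le_antisymm (optVal_succ_le fun l => ?_) ?_
    · have g1 := (hs.gain_fst n _ _ _ (hb i) (hb j) (hb k) hji).1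
      have g2 := (hs.gain_snd n _ _ _ (hb i) (hb j) (hb k) hkj).1
      have g3 := (hs.gain_fst n _ _ _ (hb i) (hb k) (hb j) (hkj.trans hji)).1
      have g4 := mul_nonneg hc (sub_nonneg.2 hji)
      have g5 := mul_nonneg hc (sub_nonneg.2 (hkj.trans hji))
      rcases eq_of_distinct hd l with rfl | rfl | rfl
      · exact (hQ _ j k hd hkj).le
      · rw [hQ _ i k ⟨hd.1.symm, hd.2.2, hd.2.1⟩ (hkj.trans hji)]
        linarith
      · rw [hQ _ i j ⟨hd.2.2.symm, hd.1, hd.2.1.symm⟩ hji]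
        linarith
    · rw [← hQ i j k hd hkj]
      exact actionVal_le_optVal n b i

/-- At most two exchanges carry `i` to its sorted place, each gaining at most 1. The first exchange,
with `j`, already gains `c` times the belief gap. -/
theorem optVal_three_bounds (hc : 0 ≤ c) (hs : TripleSwap c W) (hW : TripleStep p W) (n : ℕ)
    {b : Fin 3 → ℝ} (hb : ∀ i, b i ∈ Set.Icc (0 : ℝ) 1) {i j k : Fin 3} (hd : Distinct i j k)
    (hkj : b k ≤ b j) :
    W (n + 1) (b i) (b j) (b k) + c * (b j - b i) ≤ optVal p (n + 1) b ∧
      optVal p (n + 1) b ≤ W (n + 1) (b i) (b j) (b k) + 2 := by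
  have ha := optVal_agreesOnSorted hc hs hW (n + 1) b hb
  rcases le_total (b j) (b i) with h | h
  · rw [ha i j k hd h hkj]
    have := mul_nonneg hc (sub_nonneg.2 h)
    constructor <;> linarith
  · have g1 := hs.gain_fst n _ _ _ (hb j) (hb i) (hb k) h
    rcases le_total (b k) (b i) with h' | h'
    · rw [ha j i k ⟨hd.1.symm, hd.2.2, hd.2.1⟩ h h']
      constructor <;> linarith
    · have g2 := hs.gain_snd n _ _ _ (hb j) (hb k) (hb i) h'
      rw [ha j k i ⟨hd.2.1, hd.2.2.symm, hd.1.symm⟩ hkj h']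
      constructor <;> linarith

/-- Three neighbour exchanges sort any list of three, and each gains at most 1. -/
theorem optVal_le_triple (hc : 0 ≤ c) (hs : TripleSwap c W) (hW : TripleStep p W) (n : ℕ)
    {b : Fin 3 → ℝ} (hb : ∀ i, b i ∈ Set.Icc (0 : ℝ) 1) {i j k : Fin 3} (hd : Distinct i j k) :
    optVal p n b ≤ W n (b i) (b j) (b k) + 3 := by
  cases n with
  | zero => simp [optVal, hW.1]
  | succ n =>
    rcases le_total (b k) (b j) with h | h
    · linarith [(optVal_three_bounds hc hs hW n hb hd h).2]
    · have h1 := (optVal_three_bounds hc hs hW n hb ⟨hd.2.2, hd.2.1.symm, hd.1⟩ h).2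
      have h2 := (hs.gain_snd n _ _ _ (hb i) (hb k) (hb j) h).2
      linarith

theorem greedyOptimal_three (hc : 0 ≤ c) (hs : TripleSwap c W) (hW : TripleStep p W) :
    GreedyOptimal 3 p c := by
  intro n b hb i l
  obtain ⟨j, k, hd, hkj⟩ := exists_sorted_others b i
  rw [hW.2 n _ (optVal_agreesOnSorted hc hs hW n) b hb i j k hd hkj]
  have h1 := (optVal_three_bounds hc hs hW n hb hd hkj).1
  rcases eq_of_distinct hd l with rfl | rfl | rfl
  · rw [sub_self, mul_zero, add_zero]
    rw [← hW.2 n _ (optVal_agreesOnSorted hc hs hW n) b hb l j k hd hkj]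
    exact actionVal_le_optVal n b l
  · exact h1
  · have := mul_le_mul_of_nonneg_left hkj hc
    linarith

end

/-- The two-channel analogue of `AgreesOnSorted`. -/
def AgreesOnSortedPair (V : (Fin 2 → ℝ) → ℝ) (W : ℝ → ℝ → ℝ) : Prop :=
  ∀ b : Fin 2 → ℝ, (∀ i, b i ∈ Set.Icc (0 : ℝ) 1) → ∀ i j, i ≠ j →
    b j ≤ b i → V b = W (b i) (b j)

/-- The two-channel analogue of `TripleStep`. -/
def PairStep (p : Fin 2 → ℝ) (W : ℕ → ℝ → ℝ → ℝ) : Prop :=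
  (∀ x y, W 0 x y = 0) ∧ ∀ n V, AgreesOnSortedPair V (W n) →
    ∀ b : Fin 2 → ℝ, (∀ i, b i ∈ Set.Icc (0 : ℝ) 1) → ∀ i j, i ≠ j →
      actionVal p V b i = W (n + 1) (b i) (b j)

theorem pairValPos_step (hp : ∀ o, p o ∈ Set.Icc (0 : ℝ) 1) (hδ : 0 ≤ p 1 - p 0) :
    PairStep p (pairValPos p) := by
  refine ⟨fun _ _ => rfl, fun n V hV b hb i j hij => ?_⟩
  have hu := fun o => updateBelief_mem hp hb i o
  have e := fun o => (⟨by simp [updateBelief], by simp [updateBelief, hij.symm]⟩ :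
      updateBelief p b i o i = p o ∧ updateBelief p b i o j = nextBelief p (b j))
  have h1 : nextBelief p (b j) ≤ p 1 := by
    have := nextBelief_sub_one (p := p) (b j)
    nlinarith [(hb j).2]
  have h0 : p 0 ≤ nextBelief p (b j) := by
    have := nextBelief_sub_zero (p := p) (b j)
    nlinarith [(hb j).1]
  unfold actionVal
  rw [hV _ (hu 1) i j hij (by rwa [(e 1).1, (e 1).2]),
    hV _ (hu 0) j i hij.symm (by rwa [(e 0).1, (e 0).2])]
  simp only [e, pairValPos]

theorem pairValNeg_step (hp : ∀ o, p o ∈ Set.Icc (0 : ℝ) 1) (hδ : 0 ≤ p 0 - p 1) :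
    PairStep p (pairValNeg p) := by
  refine ⟨fun _ _ => rfl, fun n V hV b hb i j hij => ?_⟩
  have hu := fun o => updateBelief_mem hp hb i o
  have e := fun o => (⟨by simp [updateBelief], by simp [updateBelief, hij.symm]⟩ :
      updateBelief p b i o i = p o ∧ updateBelief p b i o j = nextBelief p (b j))
  have h1 : p 1 ≤ nextBelief p (b j) := by
    have := nextBelief_sub_one (p := p) (b j)
    nlinarith [(hb j).2]
  have h0 : nextBelief p (b j) ≤ p 0 := by
    have := nextBelief_sub_zero (p := p) (b j)
    nlinarith [(hb j).1]
  unfold actionVal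
  rw [hV _ (hu 1) j i hij.symm (by rwa [(e 1).1, (e 1).2]),
    hV _ (hu 0) i j hij (by rwa [(e 0).1, (e 0).2])]
  simp only [e, pairValNeg]

section
variable {W : ℕ → ℝ → ℝ → ℝ} {c : ℝ}

theorem optVal_agreesOnSortedPair (hc : 0 ≤ c) (hs : PairSwap c W) (hW : PairStep p W) (n : ℕ) :
    AgreesOnSortedPair (optVal p n) (W n) := by
  induction n with
  | zero => intro b hb i j _ _; simp [optVal, hW.1]
  | succ n ih =>
    intro b hb i j hd hji
    have hQ := hW.2 n _ ih b hb
    refine le_antisymm (optVal_succ_le fun l => ?_) ?_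
    · have g1 := (hs.gain n _ _ (hb i) (hb j) hji).1
      have g4 := mul_nonneg hc (sub_nonneg.2 hji)
      rcases eq_or_ne l i with rfl | hl
      · exact (hQ _ j hd).le
      · rw [hQ l i hl, show l = j by omega]
        linarith
    · rw [← hQ i j hd]
      exact actionVal_le_optVal n b i

theorem optVal_two_bounds (hc : 0 ≤ c) (hs : PairSwap c W) (hW : PairStep p W) (n : ℕ)
    {b : Fin 2 → ℝ} (hb : ∀ i, b i ∈ Set.Icc (0 : ℝ) 1) {i j : Fin 2} (hd : i ≠ j) :
    W (n + 1) (b i) (b j) + c * (b j - b i) ≤ optVal p (n + 1) b ∧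
      optVal p (n + 1) b ≤ W (n + 1) (b i) (b j) + 1 := by
  have ha := optVal_agreesOnSortedPair hc hs hW (n + 1) b hb
  rcases le_total (b j) (b i) with h | h
  · rw [ha i j hd h]
    have := mul_nonneg hc (sub_nonneg.2 h)
    constructor <;> linarith
  · have g1 := hs.gain n _ _ (hb j) (hb i) h
    rw [ha j i hd.symm h]
    constructor <;> linarith

theorem optVal_le_pair (hc : 0 ≤ c) (hs : PairSwap c W) (hW : PairStep p W) (n : ℕ)
    {b : Fin 2 → ℝ} (hb : ∀ i, b i ∈ Set.Icc (0 : ℝ) 1) {i j : Fin 2} (hd : i ≠ j) :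
    optVal p n b ≤ W n (b i) (b j) + 1 := by
  cases n with
  | zero => simp [optVal, hW.1]
  | succ n => exact (optVal_two_bounds hc hs hW n hb hd).2

theorem greedyOptimal_two (hc : 0 ≤ c) (hs : PairSwap c W) (hW : PairStep p W) :
    GreedyOptimal 2 p c := by
  intro n b hb i l
  rcases eq_or_ne i l with rfl | hl
  · rw [sub_self, mul_zero, add_zero]
    exact actionVal_le_optVal n b i
  · rw [hW.2 n _ (optVal_agreesOnSortedPair hc hs hW n) b hb i l hl]
    exact (optVal_two_bounds hc hs hW n hb hl).1

end

end

theorem greedyOptimal {p : Fin 2 → ℝ} (hp : ∀ o, p o ∈ Set.Icc (0 : ℝ) 1) {N : ℕ}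
    (hN : N = 2 ∨ N = 3) : GreedyOptimal N p (1 - |p 1 - p 0|) := by
  have h0 := hp 0
  have h1 := hp 1
  simp only [Set.mem_Icc] at h0 h1
  have hc : 0 ≤ 1 - |p 1 - p 0| := by
    rw [sub_nonneg, abs_le]; constructor <;> linarith
  rcases le_total (p 0) (p 1) with h | h <;> rcases hN with rfl | rfl
  · exact greedyOptimal_two hc pairValPos_swap (pairValPos_step hp (sub_nonneg.2 h))
  · exact greedyOptimal_three hc (tripleValPos_swap hp (sub_nonneg.2 h))
      (tripleValPos_step hp (sub_nonneg.2 h))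
  · exact greedyOptimal_two hc pairValNeg_swap (pairValNeg_step hp (sub_nonneg.2 h))
  · exact greedyOptimal_three hc (tripleValNeg_swap hp (sub_nonneg.2 h))
      (tripleValNeg_step hp (sub_nonneg.2 h))

/-! ### The two myopic policies -/

section
variable {N : ℕ} {p : Fin 2 → ℝ} {ω : Fin N → ℝ}

theorem visitAge_append (h : SensingHistory N) (i : Fin N) (o : Fin 2) (c : Fin N) :
    visitAge (h ++ [(i, o)]) c = if c = i then 1 else visitAge h c + 1 := by
  by_cases hc : c = i
  · simp [visitAge, List.findIdx_cons, hc]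
  · simp [visitAge, List.findIdx_cons, hc, Ne.symm hc]

theorem visited_append (h : SensingHistory N) (i : Fin N) (o : Fin 2) (c : Fin N) :
    Visited (h ++ [(i, o)]) c ↔ c = i ∨ Visited h c := by
  unfold Visited
  constructor
  · rintro ⟨a, ha⟩
    rcases List.mem_append.1 ha with ha | ha
    · exact Or.inr ⟨a, ha⟩
    · simp only [List.mem_singleton, Prod.mk.injEq] at ha
      exact Or.inl ha.1
  · rintro (rfl | ⟨a, ha⟩)
    · exact ⟨o, by simp⟩
    · exact ⟨a, by simp [ha]⟩

theorem not_visited_nil (c : Fin N) : ¬ Visited ([] : SensingHistory N) c := by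
  simp [Visited]

theorem visitAge_pos (h : SensingHistory N) (c : Fin N) : 1 ≤ visitAge h c :=
  Nat.le_add_left _ _

theorem visitAge_le (h : SensingHistory N) (c : Fin N) : visitAge h c ≤ h.length + 1 := by
  have := List.findIdx_le_length (xs := h.reverse) (p := fun q => decide (q.1 = c))
  rw [List.length_reverse] at this
  exact Nat.succ_le_succ this

theorem visited_iff_visitAge_le (h : SensingHistory N) (c : Fin N) :
    Visited h c ↔ visitAge h c ≤ h.length := by
  induction h using List.reverseRecOn with
  | nil => simp [not_visited_nil, visitAge]
  | append_singleton h q ih =>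
    obtain ⟨i, o⟩ := q
    rw [visited_append, visitAge_append, ih]
    by_cases hc : c = i
    · simp [hc]
    · simp [hc]

theorem visitAge_ne (h : SensingHistory N) {c d : Fin N} (hcd : c ≠ d) (hc : Visited h c) :
    visitAge h c ≠ visitAge h d := by
  induction h using List.reverseRecOn with
  | nil => exact absurd hc (not_visited_nil c)
  | append_singleton h q ih =>
    obtain ⟨i, o⟩ := q
    have h1 := visitAge_pos h c
    have h2 := visitAge_pos h d
    rw [visited_append] at hc
    rw [visitAge_append, visitAge_append]
    by_cases hci : c = i
    · rw [if_pos hci, if_neg (fun hdi => hcd (hci.trans hdi.symm))]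
      omega
    · rw [if_neg hci]
      have h3 := ih (hc.resolve_left hci)
      split_ifs <;> omega

theorem mem_channelList (σ : Equiv.Perm (Fin N)) (c : Fin N) : c ∈ channelList σ := by
  unfold channelList
  exact List.mem_map.2 ⟨σ.symm c, List.mem_finRange _, by simp⟩

variable [NeZero N] (σ : Equiv.Perm (Fin N))

theorem visitAge_le_longestAgo (h : SensingHistory N) (c : Fin N) :
    visitAge h c ≤ visitAge h (longestAgo σ h) := by
  unfold longestAgo
  rcases hm : (channelList σ).argmax (visitAge h) with _ | m
  · rw [List.argmax_eq_none] at hm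
    have := mem_channelList σ c
    simp [hm] at this
  · exact List.le_of_mem_argmax (mem_channelList σ c) (Option.mem_def.2 hm)

theorem longestAgo_congr {h g : SensingHistory N}
    (H : ∀ c d, visitAge h c < visitAge h d ↔ visitAge g c < visitAge g d) :
    longestAgo σ h = longestAgo σ g := by
  unfold longestAgo List.argmax
  have H' : (fun b c => visitAge h c < visitAge h b) = fun b c => visitAge g c < visitAge g b := by
    funext b c; exact propext (H c b)
  -- The relations are equal, but each comes with its own decision procedure, so both are
  -- generalized before rewriting.
  have key : ∀ (r r' : Fin N → Fin N → Prop) (d : DecidableRel r) (d' : DecidableRel r'),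
      r = r' → List.argAux r = List.argAux r' := fun r r' d d' e => by
    subst e; rw [Subsingleton.elim d d']
  rw [key _ _ _ _ H']

theorem longestAgo_append_congr (h : SensingHistory N) (i : Fin N) (o o' : Fin 2) :
    longestAgo σ (h ++ [(i, o)]) = longestAgo σ (h ++ [(i, o')]) :=
  longestAgo_congr σ fun c d => by simp only [visitAge_append]

theorem longestAgo_append_append (h : SensingHistory N) (i : Fin N) (o o' : Fin 2) :
    longestAgo σ (h ++ [(i, o)] ++ [(i, o')]) = longestAgo σ (h ++ [(i, o)]) :=
  longestAgo_congr σ fun c d => by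
    have h1 := visitAge_pos h c
    have h2 := visitAge_pos h d
    simp only [visitAge_append]
    split_ifs <;> omega

theorem longestAgo_append_ne (h : SensingHistory N) {i j : Fin N} (hij : i ≠ j) (o : Fin 2) :
    longestAgo σ (h ++ [(i, o)]) ≠ i := fun hl => by
  have h1 := visitAge_le_longestAgo σ (h ++ [(i, o)]) j
  have h2 := visitAge_pos h j
  rw [hl, visitAge_append, visitAge_append, if_neg hij.symm, if_pos rfl] at h1
  omega

theorem recentEven_spec (h : SensingHistory N) :
    (Visited h (recentEven σ h) ∧ Even (visitAge h (recentEven σ h)) ∧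
      ∀ c, Visited h c → Even (visitAge h c) → visitAge h (recentEven σ h) ≤ visitAge h c) ∨
    ((∀ c, Visited h c → ¬ Even (visitAge h c)) ∧ recentEven σ h = longestAgo σ h) := by
  classical
  unfold recentEven
  rcases hm : ((channelList σ).filter fun c => decide (Visited h c ∧ Even (visitAge h c))).argmin
    (visitAge h) with _ | m
  · right
    rw [List.argmin_eq_none, List.filter_eq_nil_iff] at hm
    exact ⟨fun c hc hc' => hm c (mem_channelList σ c) (by simp [hc, hc']), rfl⟩
  · left
    have h1 := List.argmin_mem (Option.mem_def.2 hm)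
    rw [List.mem_filter, decide_eq_true_eq] at h1
    refine ⟨h1.2.1, h1.2.2, fun c hc hc' => ?_⟩
    exact List.le_of_mem_argmin (List.mem_filter.2 ⟨mem_channelList σ c, by simp [hc, hc']⟩)
      (Option.mem_def.2 hm)

theorem recentEven_append_ne (h : SensingHistory N) {i j : Fin N} (hij : i ≠ j) (o : Fin 2) :
    recentEven σ (h ++ [(i, o)]) ≠ i := fun hl => by
  rcases recentEven_spec σ (h ++ [(i, o)]) with h1 | h1
  · have h2 := h1.2.1
    rw [hl, visitAge_append, if_pos rfl] at h2
    exact absurd h2 (by decide)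
  · exact longestAgo_append_ne σ h hij o (h1.2 ▸ hl)

theorem recentEven_append_congr (h : SensingHistory N)
    (i : Fin N) (o o' : Fin 2) :
    recentEven σ (h ++ [(i, o)]) = recentEven σ (h ++ [(i, o')]) := by
  have h1 : visitAge (h ++ [(i, o)]) = visitAge (h ++ [(i, o')]) := by
    funext c; simp only [visitAge_append]
  have h2 : Visited (h ++ [(i, o)]) = Visited (h ++ [(i, o')]) := by
    funext c; simp only [visited_append]
  unfold recentEven
  rw [h1, longestAgo_append_congr σ h i o o']
  congr! 5
  rw [h2]

theorem policyOne_append (h : SensingHistory N) (i : Fin N) (o : Fin 2) :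
    policyOne σ (h ++ [(i, o)]) = if o = 1 then i else longestAgo σ (h ++ [(i, o)]) := by
  simp [policyOne]

theorem policyTwo_append (h : SensingHistory N) (i : Fin N) (o : Fin 2) :
    policyTwo σ (h ++ [(i, o)]) = if o = 1 then recentEven σ (h ++ [(i, o)]) else i := by
  simp [policyTwo]

end

/-! Two channels. -/

section
variable {p : Fin 2 → ℝ} {ω : Fin 2 → ℝ}

theorem policyValue_policyOne_two [NeZero 2] (σ : Equiv.Perm (Fin 2)) (n : ℕ)
    (h : SensingHistory 2) {i j : Fin 2} (hij : i ≠ j) (hi : policyOne σ h = i) :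
    policyValue p ω (policyOne σ) n h = pairValPos p n (belief p ω h i) (belief p ω h j) := by
  induction n generalizing h i j with
  | zero => rfl
  | succ n ih =>
    have h1 := ih (h ++ [(i, 1)]) hij (by rw [policyOne_append, if_pos rfl])
    have h0 := ih (h ++ [(i, 0)]) hij.symm (by
      rw [policyOne_append, if_neg (by simp)]
      have := longestAgo_append_ne σ h hij 0
      omega)
    simp only [policyValue, hi, h1, h0, belief_append, pairValPos, updateBelief, hij.symm, if_true,
      if_false]

theorem policyValue_policyTwo_two [NeZero 2] (σ : Equiv.Perm (Fin 2)) (n : ℕ)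
    (h : SensingHistory 2) {i j : Fin 2} (hij : i ≠ j) (hi : policyTwo σ h = i) :
    policyValue p ω (policyTwo σ) n h = pairValNeg p n (belief p ω h i) (belief p ω h j) := by
  induction n generalizing h i j with
  | zero => rfl
  | succ n ih =>
    have h1 := ih (h ++ [(i, 0)]) hij (by rw [policyTwo_append, if_neg (by simp)])
    have h0 := ih (h ++ [(i, 1)]) hij.symm (by
      rw [policyTwo_append, if_pos rfl]
      have := recentEven_append_ne σ h hij 1
      omega)
    simp only [policyValue, hi, h1, h0, belief_append, pairValNeg, updateBelief, hij.symm, if_true,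
      if_false]

end

/-! Three channels. -/

section
variable {p : Fin 2 → ℝ} {ω : Fin 3 → ℝ} [NeZero 3] (σ : Equiv.Perm (Fin 3))

/-- The list is the current channel, the next switch target, and the remaining one. Staying
preserves the relative order of the ages. After a switch from `i` to `j`, the channel visited the
longest ago is `k`, so the list rotates. -/
theorem policyValue_policyOne_three (n : ℕ) (h : SensingHistory 3) {i j k : Fin 3}
    (hd : Distinct i j k) (hi : policyOne σ h = i) (hj : longestAgo σ (h ++ [(i, 0)]) = j) :
    policyValue p ω (policyOne σ) n h =
      tripleValPos p n (belief p ω h i) (belief p ω h j) (belief p ω h k) := by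
  induction n generalizing h i j k with
  | zero => rfl
  | succ n ih =>
    have hj' : longestAgo σ (h ++ [(i, 1)]) = j := by rw [← hj, longestAgo_append_congr]
    have h1 := ih (h ++ [(i, 1)]) hd (by rw [policyOne_append, if_pos rfl])
      (by rw [longestAgo_append_append, hj'])
    have h0 := ih (h ++ [(i, 0)]) (i := j) (j := k) (k := i) ⟨hd.2.1, hd.2.2.symm, hd.1.symm⟩
      (by rw [policyOne_append, if_neg (by simp), hj]) (by
        have h2 := visitAge_le_longestAgo σ (h ++ [(i, 0)] ++ [(j, 0)]) k
        have h3 := visitAge_pos h k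
        rcases eq_of_distinct hd (longestAgo σ (h ++ [(i, 0)] ++ [(j, 0)])) with h4 | h4 | h4
        · rw [h4] at h2
          simp only [visitAge_append, hd.2.1.symm, hd.2.2.symm, hd.1, if_false, if_true] at h2
          omega
        · rw [h4] at h2
          simp only [visitAge_append, hd.2.1.symm, hd.2.2.symm, if_false, if_true] at h2
          omega
        · exact h4)
    simp only [policyValue, hi, h1, h0, belief_append, tripleValPos, updateBelief, hd.1.symm,
      hd.2.2.symm, if_true, if_false]

theorem optVal_le_policyOne_three (hp : ∀ o, p o ∈ Set.Icc (0 : ℝ) 1)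
    (hω : ∀ i, ω i ∈ Set.Icc (0 : ℝ) 1) (hδ : p 0 ≤ p 1) (n : ℕ) (h : SensingHistory 3) :
    optVal p n (belief p ω h) ≤ policyValue p ω (policyOne σ) n h + 3 := by
  obtain ⟨l, hl⟩ := exists_ne (policyOne σ h)
  have h1 := longestAgo_append_ne σ h hl.symm 0
  obtain ⟨k, hk⟩ := exists_third h1.symm
  rw [policyValue_policyOne_three σ n h hk rfl rfl]
  have h0 := hp 0
  have h2 := hp 1
  simp only [Set.mem_Icc] at h0 h2
  refine optVal_le_triple (c := 1 - |p 1 - p 0|) ?_ (tripleValPos_swap hp (sub_nonneg.2 hδ))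
    (tripleValPos_step hp (sub_nonneg.2 hδ)) n (belief_mem hp hω h) hk
  rw [sub_nonneg, abs_le]; constructor <;> linarith

/-- Staying on `i` ages the other two channels by one and flips their parities, so the switch target
alternates between them. `hv` is needed because two channels that were never visited have equal
ages, and the initial order would then choose the same one again. -/
theorem recentEven_append_self (h : SensingHistory 3) {i j k : Fin 3} (hd : Distinct i j k)
    (hv : Visited h j ∨ Visited h k) (hk : recentEven σ (h ++ [(i, 0)]) = k) (o o' : Fin 2) :
    recentEven σ (h ++ [(i, o)] ++ [(i, o')]) = j := by
  have s1 := recentEven_spec σ (h ++ [(i, 0)])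
  have s2 := recentEven_spec σ (h ++ [(i, o)] ++ [(i, o')])
  have hne : recentEven σ (h ++ [(i, o)] ++ [(i, o')]) ≠ i := recentEven_append_ne σ _ hd.1 o'
  rcases eq_of_distinct hd (recentEven σ (h ++ [(i, o)] ++ [(i, o')])) with h4 | h4 | h4
  · exact absurd h4 hne
  · exact h4
  · exfalso
    have m1 := visitAge_le_longestAgo σ (h ++ [(i, 0)]) j
    have m2 := visitAge_le_longestAgo σ (h ++ [(i, o)] ++ [(i, o')]) j
    have vj := visited_iff_visitAge_le h j
    have vk := visited_iff_visitAge_le h k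
    have lj := visitAge_le h j
    have lk := visitAge_le h k
    have hne : visitAge h j ≠ visitAge h k := by
      rcases hv with hv | hv
      · exact visitAge_ne h hd.2.1 hv
      · exact (visitAge_ne h hd.2.1.symm hv).symm
    -- Suppose `k` were the target twice. As an even choice both times, it contradicts its own
    -- parity flip. If it is the fallback at least once, `j` is younger and visited, and `j` has
    -- even age at one of the two times, where it should have been preferred.
    rcases s1 with s1 | s1 <;> rcases s2 with s2 | s2
    · rw [hk] at s1
      rw [h4] at s2
      have e1 := s1.2.1
      have e2 := s2.2.1
      simp only [visitAge_append, hd.2.2.symm, if_false] at e1 e2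
      rw [Nat.even_add_one] at e2
      exact e2 e1
    · rw [hk] at s1
      rw [← s2.2, h4] at m2
      have e1 := s1.2.1
      have a1 := s1.2.2 j
      have v1 := s1.1
      have a2 := s2.1 j
      simp only [visitAge_append, visited_append, hd.1.symm, hd.2.2.symm, if_false, false_or]
        at e1 a1 a2 v1 m2
      rw [Nat.even_add_one] at a2
      have := a2 (vj.2 (by omega))
      rw [not_not] at this
      have := a1 (vj.2 (by omega)) this
      omega
    · rw [h4] at s2
      rw [← s1.2, hk] at m1
      have e2 := s2.2.1
      have a2 := s2.2.2 j
      have v2 := s2.1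
      have a1 := s1.1 j
      simp only [visitAge_append, visited_append, hd.1.symm, hd.2.2.symm, if_false, false_or]
        at e2 a1 a2 v2 m1
      rw [Nat.even_add_one] at a2
      have := a1 (vj.2 (by omega))
      have := a2 (vj.2 (by omega)) this
      omega
    · rw [← s1.2, hk] at m1
      rw [← s2.2, h4] at m2
      have a1 := s1.1 j
      have a2 := s2.1 j
      simp only [visitAge_append, visited_append, hd.1.symm, hd.2.2.symm, if_false, false_or]
        at a1 a2 m1 m2
      rw [Nat.even_add_one] at a2
      have hj : Visited h j := vj.2 (by omega)
      exact a2 hj (a1 hj)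

/-- The channel just left was visited two slots before the next decision, the smallest possible even
age. So a second switch in a row returns to it, as the reversal of the list demands. -/
theorem recentEven_append_swap (h : SensingHistory 3) {i j k : Fin 3} (hd : Distinct i j k)
    (o o' : Fin 2) : recentEven σ (h ++ [(i, o)] ++ [(k, o')]) = i := by
  have s := recentEven_spec σ (h ++ [(i, o)] ++ [(k, o')])
  have hne : recentEven σ (h ++ [(i, o)] ++ [(k, o')]) ≠ k :=
    recentEven_append_ne σ _ hd.2.2.symm o'
  have hi : Visited (h ++ [(i, o)] ++ [(k, o')]) i := by
    simp only [visited_append]; tauto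
  have hai : visitAge (h ++ [(i, o)] ++ [(k, o')]) i = 2 := by
    simp only [visitAge_append, hd.2.2, if_true, if_false]
  have haj : visitAge (h ++ [(i, o)] ++ [(k, o')]) j = visitAge h j + 2 := by
    simp only [visitAge_append, hd.2.1, hd.1.symm, if_false]
  have := visitAge_pos h j
  rcases s with s | s
  · have h1 := s.2.2 i hi (by rw [hai]; decide)
    rcases eq_of_distinct hd (recentEven σ (h ++ [(i, o)] ++ [(k, o')])) with h4 | h4 | h4
    · exact h4
    · rw [h4] at h1
      omega
    · exact absurd h4 hne
  · exact absurd (by rw [hai]; decide) (s.1 i hi)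

theorem policyValue_policyTwo_three (n : ℕ) (h : SensingHistory 3) {i j k : Fin 3}
    (hd : Distinct i j k) (hi : policyTwo σ h = i) (hv : Visited h j ∨ Visited h k)
    (hk : recentEven σ (h ++ [(i, 0)]) = k) :
    policyValue p ω (policyTwo σ) n h =
      tripleValNeg p n (belief p ω h i) (belief p ω h j) (belief p ω h k) := by
  induction n generalizing h i j k with
  | zero => rfl
  | succ n ih =>
    have h0 := ih (h ++ [(i, 0)]) (i := i) (j := k) (k := j) ⟨hd.2.2, hd.2.1.symm, hd.1⟩
      (by rw [policyTwo_append, if_neg (by simp)])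
      (by simp only [visited_append]; tauto)
      (recentEven_append_self σ h hd hv hk 0 0)
    have h1 := ih (h ++ [(i, 1)]) (i := k) (j := j) (k := i)
      ⟨hd.2.1.symm, hd.1.symm, hd.2.2.symm⟩
      (by rw [policyTwo_append, if_pos rfl, recentEven_append_congr σ h i 1 0, hk])
      (by simp only [visited_append]; tauto)
      (recentEven_append_swap σ h hd 1 0)
    simp only [policyValue, hi, h1, h0, belief_append, tripleValNeg, updateBelief, hd.1.symm,
      hd.2.2.symm, if_true, if_false]

/-- Once a channel other than the next one was visited, `π₂` is optimal up to a constant. -/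
theorem optVal_le_policyTwo_three_of_visited (hp : ∀ o, p o ∈ Set.Icc (0 : ℝ) 1)
    (hω : ∀ i, ω i ∈ Set.Icc (0 : ℝ) 1) (hδ : p 1 ≤ p 0) (n : ℕ) (h : SensingHistory 3)
    (hv : ∃ j, j ≠ policyTwo σ h ∧ Visited h j) :
    optVal p n (belief p ω h) ≤ policyValue p ω (policyTwo σ) n h + 3 := by
  obtain ⟨m, hm, hmv⟩ := hv
  have h1 := recentEven_append_ne σ h hm.symm 0
  obtain ⟨j, hj⟩ := exists_third h1.symm
  have hd : Distinct (policyTwo σ h) j (recentEven σ (h ++ [(policyTwo σ h, 0)])) :=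
    ⟨hj.2.2, hj.2.1.symm, hj.1⟩
  rw [policyValue_policyTwo_three σ n h hd rfl ?_ rfl]
  · have h0 := hp 0
    have h2 := hp 1
    simp only [Set.mem_Icc] at h0 h2
    refine optVal_le_triple (c := 1 - |p 1 - p 0|) ?_ (tripleValNeg_swap hp (sub_nonneg.2 hδ))
      (tripleValNeg_step hp (sub_nonneg.2 hδ)) n (belief_mem hp hω h) hd
    rw [sub_nonneg, abs_le]; constructor <;> linarith
  · rcases eq_of_distinct hd m with rfl | rfl | rfl
    · exact absurd rfl hm
    · exact Or.inl hmv
    · exact Or.inr hmv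

end

/-! ### The better policy is optimal up to a constant -/

theorem optVal_le_actionVal_add_two {p : Fin 2 → ℝ} {W : ℕ → ℝ → ℝ → ℝ → ℝ} {c : ℝ} (hc : 0 ≤ c)
    (hs : TripleSwap c W) (hW : TripleStep p W) (n : ℕ)
    {b : Fin 3 → ℝ} (hb : ∀ i, b i ∈ Set.Icc (0 : ℝ) 1) (i : Fin 3) :
    optVal p (n + 1) b ≤ actionVal p (optVal p n) b i + 2 := by
  obtain ⟨j, k, hd, hkj⟩ := exists_sorted_others b i
  rw [hW.2 n _ (optVal_agreesOnSorted hc hs hW n) b hb i j k hd hkj]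
  exact (optVal_three_bounds hc hs hW n hb hd hkj).2

theorem optVal_le_actionVal_of_max {p : Fin 2 → ℝ} {W : ℕ → ℝ → ℝ → ℝ → ℝ} {c : ℝ} (hc : 0 ≤ c)
    (hs : TripleSwap c W) (hW : TripleStep p W) (n : ℕ)
    {b : Fin 3 → ℝ} (hb : ∀ i, b i ∈ Set.Icc (0 : ℝ) 1) {i : Fin 3} (hi : ∀ j, b j ≤ b i) :
    optVal p (n + 1) b ≤ actionVal p (optVal p n) b i := by
  obtain ⟨j, k, hd, hkj⟩ := exists_sorted_others b i
  rw [hW.2 n _ (optVal_agreesOnSorted hc hs hW n) b hb i j k hd hkj,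
    optVal_agreesOnSorted hc hs hW (n + 1) b hb i j k hd (hi j) hkj]

section
variable {p : Fin 2 → ℝ}

theorem one_sub_abs_nonneg (hp : ∀ o, p o ∈ Set.Icc (0 : ℝ) 1) : 0 ≤ 1 - |p 1 - p 0| := by
  have h0 := hp 0
  have h1 := hp 1
  simp only [Set.mem_Icc] at h0 h1
  rw [sub_nonneg, abs_le]; constructor <;> linarith

theorem nextBelief_le_zero (hδ : p 1 ≤ p 0) {x : ℝ} (hx : x ∈ Set.Icc (0 : ℝ) 1) :
    nextBelief p x ≤ p 0 := by
  have := nextBelief_sub_zero (p := p) x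
  nlinarith [hx.1]

theorem optVal_le_policyTwo_three {ω : Fin 3 → ℝ} [NeZero 3] (σ : Equiv.Perm (Fin 3))
    (hp : ∀ o, p o ∈ Set.Icc (0 : ℝ) 1) (hω : ∀ i, ω i ∈ Set.Icc (0 : ℝ) 1) (hδ : p 1 ≤ p 0)
    (n : ℕ) (h : SensingHistory 3) :
    optVal p n (belief p ω h) ≤ policyValue p ω (policyTwo σ) n h + 5 := by
  have hc := one_sub_abs_nonneg hp
  have hs := tripleValNeg_swap hp (sub_nonneg.2 hδ)
  have hW := tripleValNeg_step hp (sub_nonneg.2 hδ)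
  have key : ∀ n, ∀ g i o, optVal p n (belief p ω (g ++ [(i, o)])) ≤
      policyValue p ω (policyTwo σ) n (g ++ [(i, o)]) + 3 := fun n => by
    induction n with
    | zero => intro g i o; simp [optVal, policyValue]
    | succ n ih =>
      intro g i o
      by_cases hv : ∃ j, j ≠ policyTwo σ (g ++ [(i, o)]) ∧ Visited (g ++ [(i, o)]) j
      · exact optVal_le_policyTwo_three_of_visited σ hp hω hδ (n + 1) _ hv
      · push Not at hv
        -- As long as only one channel has been visited and π₂ stays on it, the last observation was
        -- a 0. Its belief is then `p 0`, the largest possible, and sensing it costs nothing. The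
        -- constant 3 is therefore incurred only once.
        have hi : policyTwo σ (g ++ [(i, o)]) = i := by
          by_contra hne
          exact hv i (Ne.symm hne) ((visited_append g i o i).2 (Or.inl rfl))
        have ho : o = 0 := by
          by_contra ho
          have ho' : o = 1 := by omega
          obtain ⟨l, hl⟩ := exists_ne i
          rw [policyTwo_append, if_pos ho'] at hi
          exact recentEven_append_ne σ g hl.symm o hi
        subst ho
        have hmax : ∀ j, belief p ω (g ++ [(i, 0)]) j ≤ belief p ω (g ++ [(i, 0)]) i := fun j => by
          rw [belief_append]
          unfold updateBelief
          rw [if_pos rfl]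
          split_ifs
          · exact le_rfl
          · exact nextBelief_le_zero hδ (belief_mem hp hω g j)
        have h1 := optVal_le_actionVal_of_max hc hs hW n (belief_mem hp hω _) hmax
        have h2 := le_policyValue_succ (π := policyTwo σ) (h := g ++ [(i, 0)]) (n := n)
          (V := optVal p n) (c := 3) hp hω fun o => by
            have := ih (g ++ [(i, 0)]) (policyTwo σ (g ++ [(i, 0)])) o
            linarith
        rw [hi] at h2
        linarith
  cases n with
  | zero => simp [optVal, policyValue]
  | succ n =>
    -- The very first choice may be wrong and costs at most 2, hence 5 = 2 + 3.
    have h1 := optVal_le_actionVal_add_two hc hs hW n (belief_mem hp hω h) (policyTwo σ h)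
    have h2 := le_policyValue_succ (π := policyTwo σ) (h := h) (n := n)
      (V := optVal p n) (c := 3) hp hω fun o => by linarith [key n h (policyTwo σ h) o]
    linarith

theorem optVal_le_policyOne {N : ℕ} [NeZero N] (hN : N = 2 ∨ N = 3) {ω : Fin N → ℝ}
    (σ : Equiv.Perm (Fin N)) (hp : ∀ o, p o ∈ Set.Icc (0 : ℝ) 1)
    (hω : ∀ i, ω i ∈ Set.Icc (0 : ℝ) 1) (hδ : p 0 ≤ p 1) (n : ℕ) (h : SensingHistory N) :
    optVal p n (belief p ω h) ≤ policyValue p ω (policyOne σ) n h + 5 := by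
  rcases hN with rfl | rfl
  · obtain ⟨j, hj⟩ := exists_ne (policyOne σ h)
    rw [policyValue_policyOne_two σ n h hj.symm rfl]
    have := optVal_le_pair (one_sub_abs_nonneg hp) pairValPos_swap
      (pairValPos_step hp (sub_nonneg.2 hδ)) n (belief_mem hp hω h) hj.symm
    linarith
  · linarith [optVal_le_policyOne_three σ hp hω hδ n h]

theorem optVal_le_policyTwo {N : ℕ} [NeZero N] (hN : N = 2 ∨ N = 3) {ω : Fin N → ℝ}
    (σ : Equiv.Perm (Fin N)) (hp : ∀ o, p o ∈ Set.Icc (0 : ℝ) 1)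
    (hω : ∀ i, ω i ∈ Set.Icc (0 : ℝ) 1) (hδ : p 1 ≤ p 0) (n : ℕ) (h : SensingHistory N) :
    optVal p n (belief p ω h) ≤ policyValue p ω (policyTwo σ) n h + 5 := by
  rcases hN with rfl | rfl
  · obtain ⟨j, hj⟩ := exists_ne (policyTwo σ h)
    rw [policyValue_policyTwo_two σ n h hj.symm rfl]
    have := optVal_le_pair (one_sub_abs_nonneg hp) pairValNeg_swap
      (pairValNeg_step hp (sub_nonneg.2 hδ)) n (belief_mem hp hω h) hj.symm
    linarith
  · exact optVal_le_policyTwo_three σ hp hω hδ n h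

end

/-! ### The worse policy loses linearly -/

section
variable {N : ℕ} {p : Fin 2 → ℝ} {ω : Fin N → ℝ} {π : SensingPolicy N}

/-- If the loss of every slot, corrected by a bounded function `ψ` of the last observation, is at
least `Δ`, then the policy falls behind linearly. -/
theorem policyValue_le_of_loss [NeZero N] {c : ℝ} (hg : GreedyOptimal N p c)
    (hp : ∀ o, p o ∈ Set.Icc (0 : ℝ) 1) (hω : ∀ i, ω i ∈ Set.Icc (0 : ℝ) 1) {ψ : Fin 2 → ℝ}
    {Δ κ : ℝ} (hΔ : 0 ≤ Δ) (hψ : ∀ o, 0 ≤ ψ o ∧ ψ o ≤ κ)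
    (hstep : ∀ h i o, 1 ≤ h.length → ∃ j,
      belief p ω (h ++ [(i, o)]) (π (h ++ [(i, o)])) * ψ 1 +
        (1 - belief p ω (h ++ [(i, o)]) (π (h ++ [(i, o)]))) * ψ 0 + Δ ≤
      ψ o + c * (belief p ω (h ++ [(i, o)]) j -
        belief p ω (h ++ [(i, o)]) (π (h ++ [(i, o)])))) (n : ℕ) (h : SensingHistory N) :
    policyValue p ω π n h ≤ optVal p n (belief p ω h) - Δ * n + (κ + 2 * Δ) := by
  have hκ : 0 ≤ κ := (hψ 0).1.trans (hψ 0).2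
  have h2 : ∀ n h i o, 1 ≤ h.length → policyValue p ω π n (h ++ [(i, o)]) ≤
      optVal p n (belief p ω (h ++ [(i, o)])) + (ψ o - Δ * n) := fun n => by
    induction n with
    | zero => intro h i o _; simpa [policyValue, optVal] using (hψ o).1
    | succ n ih =>
      intro h i o hh
      obtain ⟨j, hj⟩ := hstep h i o hh
      have k1 := policyValue_succ_le (V := optVal p n) (c := fun o => ψ o - Δ * n) hp hω (π := π)
        (h := h ++ [(i, o)]) (n := n) fun o' => ih _ _ o' (by simp)
      have k2 := hg n _ (belief_mem hp hω (h ++ [(i, o)])) (π (h ++ [(i, o)])) j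
      push_cast
      linarith
  -- Going back one slot costs at most Δ. Two such steps reach every history, since `hstep` speaks
  -- only of those with at least two observations.
  have extend : ∀ (C : ℝ), 0 ≤ C → ∀ (h : SensingHistory N), (∀ n i o,
      policyValue p ω π n (h ++ [(i, o)]) ≤
        optVal p n (belief p ω (h ++ [(i, o)])) + (C - Δ * n)) →
      ∀ n, policyValue p ω π n h ≤ optVal p n (belief p ω h) + (C + Δ - Δ * n) :=
    fun C hC h hh n => by
      cases n with
      | zero =>
        simp only [policyValue, optVal, Nat.cast_zero, mul_zero]
        linarith
      | succ n =>
        have k1 := policyValue_succ_le (V := optVal p n) (c := fun _ => C - Δ * n) hp hω (π := π)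
          (h := h) (n := n) fun o' => hh n _ o'
        have k2 := actionVal_le_optVal (p := p) n (belief p ω h) (π h)
        push_cast
        linarith
  have h1 : ∀ n h i o, policyValue p ω π n (h ++ [(i, o)]) ≤
      optVal p n (belief p ω (h ++ [(i, o)])) + (κ + Δ - Δ * n) := fun n h i o =>
    extend κ hκ (h ++ [(i, o)]) (fun n i' o' => by
      have := h2 n (h ++ [(i, o)]) i' o' (by simp)
      linarith [(hψ o').2]) n
  have h0 := extend (κ + Δ) (by linarith) h (fun n i o => h1 n h i o) n
  linarith

/-- After one transition every belief is an average of `p 0` and `p 1`, whatever the initial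
probabilities. This makes the loss bounds uniform in `ω`. -/
theorem belief_mem_uIcc (hp : ∀ o, p o ∈ Set.Icc (0 : ℝ) 1) (hω : ∀ i, ω i ∈ Set.Icc (0 : ℝ) 1)
    {h : SensingHistory N} (hh : 1 ≤ h.length) (j : Fin N) :
    belief p ω h j ∈ Set.uIcc (p 0) (p 1) := by
  induction h using List.reverseRecOn with
  | nil => simp at hh
  | append_singleton h q _ =>
    obtain ⟨i, o⟩ := q
    rw [belief_append]
    unfold updateBelief
    split_ifs
    · rcases (show o = 0 ∨ o = 1 by omega) with rfl | rfl
      · exact Set.left_mem_uIcc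
      · exact Set.right_mem_uIcc
    · have h1 := belief_mem hp hω h j
      have h2 := nextBelief_sub_zero (p := p) (belief p ω h j)
      have h3 := nextBelief_sub_one (p := p) (belief p ω h j)
      rw [Set.mem_uIcc]
      rcases le_total (p 0) (p 1) with h4 | h4
      · left; constructor <;> nlinarith [h1.1, h1.2]
      · right; constructor <;> nlinarith [h1.1, h1.2]

theorem belief_append_self (h : SensingHistory N) (i : Fin N) (o : Fin 2) :
    belief p ω (h ++ [(i, o)]) i = p o := by
  simp [belief_append, updateBelief]

theorem belief_append_of_ne (h : SensingHistory N) {i j : Fin N} (hj : j ≠ i) (o : Fin 2) :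
    belief p ω (h ++ [(i, o)]) j = nextBelief p (belief p ω h j) := by
  simp [belief_append, updateBelief, hj]

theorem fin_ne_zero_eq_one {o : Fin 2} (h : o ≠ 1) : o = 0 := by omega

/-- With positive correlation π₂ errs after either observation: it leaves the best channel after a 1
and stays on the worst after a 0. Every slot loses, and no correcting potential is needed. -/
theorem policyTwo_loss {c : ℝ} (hc : 0 < c) (hg : GreedyOptimal N p c) [NeZero N]
    [Nontrivial (Fin N)] (σ : Equiv.Perm (Fin N)) (hp : ∀ o, p o ∈ Set.Icc (0 : ℝ) 1)
    (hω : ∀ i, ω i ∈ Set.Icc (0 : ℝ) 1) (h01 : p 0 < p 1) (h0 : 0 < p 0) (h1 : p 1 < 1)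
    (n : ℕ) (h : SensingHistory N) :
    policyValue p ω (policyTwo σ) n h ≤ optVal p n (belief p ω h) -
      (c * ((p 1 - p 0) * min (p 0) (1 - p 1))) * n +
        (0 + 2 * (c * ((p 1 - p 0) * min (p 0) (1 - p 1)))) := by
  have hδ : 0 < p 1 - p 0 := by linarith
  have hm : 0 < min (p 0) (1 - p 1) := lt_min h0 (by linarith)
  refine policyValue_le_of_loss hg hp hω (ψ := fun _ => 0) (by positivity) (by simp)
    (fun h i o hh => ?_) n h
  by_cases ho : o = 1
  · subst ho
    obtain ⟨l, hl⟩ := exists_ne i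
    refine ⟨i, ?_⟩
    have hne := recentEven_append_ne σ h hl.symm 1
    rw [policyTwo_append, if_pos rfl, belief_append_self, belief_append_of_ne h hne]
    set j := recentEven σ (h ++ [(i, 1)])
    have hb := belief_mem_uIcc hp hω hh j
    rw [Set.uIcc_of_le h01.le] at hb
    have h2 := nextBelief_sub_one (p := p) (belief p ω h j)
    have h3 : (p 1 - p 0) * min (p 0) (1 - p 1) ≤ p 1 - nextBelief p (belief p ω h j) := by
      rw [h2]
      exact mul_le_mul_of_nonneg_left ((min_le_right _ _).trans (by linarith [hb.2])) hδ.le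
    have := mul_le_mul_of_nonneg_left h3 hc.le
    linarith
  · obtain rfl := fin_ne_zero_eq_one ho
    obtain ⟨j, hj⟩ := exists_ne i
    refine ⟨j, ?_⟩
    rw [policyTwo_append, if_neg ho, belief_append_self, belief_append_of_ne h hj]
    have hb := belief_mem_uIcc hp hω hh j
    rw [Set.uIcc_of_le h01.le] at hb
    have h2 := nextBelief_sub_zero (p := p) (belief p ω h j)
    have h3 : (p 1 - p 0) * min (p 0) (1 - p 1) ≤ nextBelief p (belief p ω h j) - p 0 := by
      rw [h2]
      exact mul_le_mul_of_nonneg_left ((min_le_left _ _).trans hb.1) hδ.le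
    have := mul_le_mul_of_nonneg_left h3 hc.le
    linarith

/-- The beliefs between which `π₁` chooses when the channels are negatively correlated. -/
theorem policyOne_step [NeZero N] [Nontrivial (Fin N)] (σ : Equiv.Perm (Fin N))
    (hp : ∀ o, p o ∈ Set.Icc (0 : ℝ) 1) (hω : ∀ i, ω i ∈ Set.Icc (0 : ℝ) 1) (h10 : p 1 < p 0)
    (h : SensingHistory N) (hh : 1 ≤ h.length) (i : Fin N) :
    (∃ j, belief p ω (h ++ [(i, 1)]) (policyOne σ (h ++ [(i, 1)])) = p 1 ∧
      (p 0 - p 1) * (1 - p 0) ≤ belief p ω (h ++ [(i, 1)]) j - p 1) ∧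
    (∃ j, p 1 + (p 0 - p 1) * (1 - p 0) ≤
        belief p ω (h ++ [(i, 0)]) (policyOne σ (h ++ [(i, 0)])) ∧
      (p 0 - p 1) * p 1 ≤ belief p ω (h ++ [(i, 0)]) j -
        belief p ω (h ++ [(i, 0)]) (policyOne σ (h ++ [(i, 0)]))) := by
  have hδ : 0 ≤ p 0 - p 1 := by linarith
  obtain ⟨l, hl⟩ := exists_ne i
  constructor
  · refine ⟨l, ?_⟩
    rw [policyOne_append, if_pos rfl, belief_append_self, belief_append_of_ne h hl]
    have hb := belief_mem_uIcc hp hω hh l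
    rw [Set.uIcc_of_ge h10.le] at hb
    have h2 := nextBelief_sub_one (p := p) (belief p ω h l)
    have h3 := mul_le_mul_of_nonneg_left hb.2 hδ
    exact ⟨rfl, by linarith⟩
  · refine ⟨i, ?_⟩
    have hne := longestAgo_append_ne σ h hl.symm 0
    rw [policyOne_append, if_neg (by simp), belief_append_self, belief_append_of_ne h hne]
    set j := longestAgo σ (h ++ [(i, 0)])
    have hb := belief_mem_uIcc hp hω hh j
    rw [Set.uIcc_of_ge h10.le] at hb
    have h2 := nextBelief_sub_one (p := p) (belief p ω h j)
    have h2' := nextBelief_sub_zero (p := p) (belief p ω h j)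
    have h3 := mul_le_mul_of_nonneg_left hb.2 hδ
    have h4 := mul_le_mul_of_nonneg_left hb.1 hδ
    constructor <;> linarith

/-- When `p 1` > 0, leaving a channel of belief `p 0` after a 0 surely loses 2κ, but a slot after a
1 may lose nothing. A credit κ is held after a 1. It is released with probability 1 - `p 1`, which
pays Δ = κ(1 - `p 1`) there, while the 2κ lost after a 0 cover both a new credit and Δ. -/
theorem policyOne_loss_of_pos {c : ℝ} (hc : 0 < c) (hg : GreedyOptimal N p c) [NeZero N]
    [Nontrivial (Fin N)] (σ : Equiv.Perm (Fin N)) (hp : ∀ o, p o ∈ Set.Icc (0 : ℝ) 1)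
    (hω : ∀ i, ω i ∈ Set.Icc (0 : ℝ) 1) (h10 : p 1 < p 0) (h1 : 0 < p 1)
    (n : ℕ) (h : SensingHistory N) :
    policyValue p ω (policyOne σ) n h ≤ optVal p n (belief p ω h) -
      (c * ((p 0 - p 1) * p 1) / 2 * (1 - p 1)) * n +
        (c * ((p 0 - p 1) * p 1) / 2 + 2 * (c * ((p 0 - p 1) * p 1) / 2 * (1 - p 1))) := by
  have hδ : 0 < p 0 - p 1 := by linarith
  have hp1 : 0 < 1 - p 1 := by linarith [(hp 0).2]
  set κ := c * ((p 0 - p 1) * p 1) / 2 with hκ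
  have hκ0 : 0 < κ := by positivity
  refine policyValue_le_of_loss hg hp hω (ψ := fun o => if o = 1 then κ else 0) (by positivity)
    (fun o => by split_ifs <;> constructor <;> linarith) (fun h i o hh => ?_) n h
  have hs := policyOne_step σ hp hω h10 h hh i
  by_cases ho : o = 1
  · subst ho
    obtain ⟨j, hj1, hj2⟩ := hs.1
    refine ⟨j, ?_⟩
    have h3 : 0 ≤ (p 0 - p 1) * (1 - p 0) := mul_nonneg hδ.le (by linarith [(hp 0).2])
    have h4 := mul_nonneg hc.le (h3.trans hj2)
    simp only [hj1, if_true]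
    simp
    linarith
  · obtain rfl := fin_ne_zero_eq_one ho
    obtain ⟨j, hj1, hj2⟩ := hs.2
    refine ⟨j, ?_⟩
    have h4 := mul_le_mul_of_nonneg_left hj2 hc.le
    have hx := belief_mem hp hω (h ++ [(i, 0)]) (policyOne σ (h ++ [(i, 0)]))
    have h5 := mul_le_mul_of_nonneg_right hx.2 hκ0.le
    simp
    nlinarith

/-- The mirror case: staying on belief `p 1` after a 1 surely loses 2κ, and the credit κ is held
after a 0. From there a 1 follows with at least the probability `p 1` + (`p 0` - `p 1`)(1 - `p 0`),
which releases the credit often enough. -/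
theorem policyOne_loss_of_lt_one {c : ℝ} (hc : 0 < c) (hg : GreedyOptimal N p c) [NeZero N]
    [Nontrivial (Fin N)] (σ : Equiv.Perm (Fin N)) (hp : ∀ o, p o ∈ Set.Icc (0 : ℝ) 1)
    (hω : ∀ i, ω i ∈ Set.Icc (0 : ℝ) 1) (h10 : p 1 < p 0) (h0 : p 0 < 1)
    (n : ℕ) (h : SensingHistory N) :
    policyValue p ω (policyOne σ) n h ≤ optVal p n (belief p ω h) -
      (c * ((p 0 - p 1) * (1 - p 0)) / 2 * (p 1 + (p 0 - p 1) * (1 - p 0))) * n +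
        (c * ((p 0 - p 1) * (1 - p 0)) / 2 +
          2 * (c * ((p 0 - p 1) * (1 - p 0)) / 2 * (p 1 + (p 0 - p 1) * (1 - p 0)))) := by
  have hδ : 0 < p 0 - p 1 := by linarith
  have hp1 : 0 ≤ p 1 := (hp 1).1
  have hp0 : 0 < 1 - p 0 := by linarith
  set κ := c * ((p 0 - p 1) * (1 - p 0)) / 2 with hκ
  have hκ0 : 0 < κ := by positivity
  have hz1 : p 1 + (p 0 - p 1) * (1 - p 0) ≤ 1 := by nlinarith
  refine policyValue_le_of_loss hg hp hω (ψ := fun o => if o = 1 then 0 else κ) (by positivity)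
    (fun o => by split_ifs <;> constructor <;> linarith) (fun h i o hh => ?_) n h
  have hs := policyOne_step σ hp hω h10 h hh i
  have hκz := mul_le_mul_of_nonneg_left hz1 hκ0.le
  by_cases ho : o = 1
  · subst ho
    obtain ⟨j, hj1, hj2⟩ := hs.1
    refine ⟨j, ?_⟩
    have h4 := mul_le_mul_of_nonneg_left hj2 hc.le
    have h5 := mul_nonneg hp1 hκ0.le
    simp only [hj1]
    simp
    linarith
  · obtain rfl := fin_ne_zero_eq_one ho
    obtain ⟨j, hj1, hj2⟩ := hs.2
    refine ⟨j, ?_⟩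
    have h3 : 0 ≤ (p 0 - p 1) * p 1 := mul_nonneg hδ.le hp1
    have h4 := mul_nonneg hc.le (h3.trans hj2)
    have h5 := mul_le_mul_of_nonneg_left hj1 hκ0.le
    simp
    linarith

end

/-- One of the two policies is optimal up to a constant, and the other one loses linearly. -/
def SeparatesArms (p : Fin 2 → ℝ) (g : Fin 2) (Δ C : ℝ) : Prop :=
  ∀ (N : ℕ) [NeZero N], (N = 2 ∨ N = 3) → ∀ ω : Fin N → ℝ, (∀ i, ω i ∈ Set.Icc (0 : ℝ) 1) →
    ∀ (σ : Equiv.Perm (Fin N)) (n : ℕ) (h : SensingHistory N),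
      optVal p n (belief p ω h) ≤ policyValue p ω (myopicPolicy σ g) n h + C ∧
      ∀ j, j ≠ g →
        policyValue p ω (myopicPolicy σ j) n h ≤ optVal p n (belief p ω h) - Δ * n + C

theorem nontrivial_fin_of_two_or_three {N : ℕ} (hN : N = 2 ∨ N = 3) : Nontrivial (Fin N) := by
  rcases hN with rfl | rfl <;> infer_instance

theorem exists_separatesArms {p : Fin 2 → ℝ} (hp : ∀ o, p o ∈ Set.Icc (0 : ℝ) 1)
    (hδ : |p 1 - p 0| < 1) (hne : p 0 ≠ p 1) (h0 : p 0 < p 1 → 0 < p 0)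
    (h1 : p 0 < p 1 → p 1 < 1) : ∃ g Δ C, 0 < Δ ∧ SeparatesArms p g Δ C := by
  have hc : 0 < 1 - |p 1 - p 0| := by linarith
  rcases lt_or_gt_of_ne hne with h01 | h10
  · have hm : 0 < min (p 0) (1 - p 1) := lt_min (h0 h01) (by linarith [h1 h01])
    have hd : 0 < p 1 - p 0 := by linarith
    set Δ := (1 - |p 1 - p 0|) * ((p 1 - p 0) * min (p 0) (1 - p 1)) with hΔ
    have hΔ0 : 0 < Δ := by positivity
    refine ⟨0, Δ, 5 + 2 * Δ, hΔ0, fun N _ hN ω hω σ n h => ⟨?_, fun j hj => ?_⟩⟩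
    · have := optVal_le_policyOne hN σ hp hω h01.le n h
      simp only [myopicPolicy, if_true]
      linarith
    · have := nontrivial_fin_of_two_or_three hN
      have := policyTwo_loss hc (greedyOptimal hp hN) σ hp hω h01 (h0 h01) (h1 h01) n h
      simp only [myopicPolicy, hj, if_false]
      linarith
  · have hd : 0 < p 0 - p 1 := by linarith
    have hd1 : p 0 - p 1 < 1 := by rwa [abs_sub_comm, abs_of_pos hd] at hδ
    have hj : ∀ j : Fin 2, j ≠ 1 → j = 0 := fun j => by omega
    by_cases hp1 : 0 < p 1
    · have hq : 0 < 1 - p 1 := by linarith [(hp 0).2]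
      set κ := (1 - |p 1 - p 0|) * ((p 0 - p 1) * p 1) / 2 with hκ
      have hκ0 : 0 < κ := by positivity
      have hΔ0 : 0 < κ * (1 - p 1) := by positivity
      refine ⟨1, κ * (1 - p 1), 5 + (κ + 2 * (κ * (1 - p 1))), hΔ0,
        fun N _ hN ω hω σ n h => ⟨?_, fun j hj' => ?_⟩⟩
      · have := optVal_le_policyTwo hN σ hp hω h10.le n h
        simp only [myopicPolicy, one_ne_zero, if_false]
        linarith
      · have := nontrivial_fin_of_two_or_three hN
        have := policyOne_loss_of_pos hc (greedyOptimal hp hN) σ hp hω h10 hp1 n h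
        rw [← hκ] at this
        simp only [myopicPolicy, hj j hj', if_true]
        linarith
    -- Now `p 1` = 0, and the chain is not the swap, so `p 0` < 1.
    · have hp0 : p 0 < 1 := by linarith [(hp 1).1]
      have hq : 0 < 1 - p 0 := by linarith
      have hp1' := (hp 1).1
      set κ := (1 - |p 1 - p 0|) * ((p 0 - p 1) * (1 - p 0)) / 2 with hκ
      have hκ0 : 0 < κ := by positivity
      set z := p 1 + (p 0 - p 1) * (1 - p 0) with hz
      have hz0 : 0 < z := by positivity
      have hΔ0 : 0 < κ * z := by positivity
      refine ⟨1, κ * z, 5 + (κ + 2 * (κ * z)), hΔ0,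
        fun N _ hN ω hω σ n h => ⟨?_, fun j hj' => ?_⟩⟩
      · have := optVal_le_policyTwo hN σ hp hω h10.le n h
        simp only [myopicPolicy, one_ne_zero, if_false]
        linarith
      · have := nontrivial_fin_of_two_or_three hN
        have := policyOne_loss_of_lt_one hc (greedyOptimal hp hN) σ hp hω h10 hp0 n h
        rw [← hκ, ← hz] at this
        simp only [myopicPolicy, hj j hj', if_true]
        linarith

/-! ### Chains for which every policy is optimal up to a constant -/

section
variable {N : ℕ} {p : Fin 2 → ℝ} {ω : Fin N → ℝ} {π : SensingPolicy N}

/-- With `r` stationary, the potential Σ |b j - r| / (1 - |δ|) falls in expectation by at least |b i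
- r|, whichever channel is sensed. This pays for the deviation of the slot's reward from `r`, from
above for the optimum and from below for any policy. -/
theorem potential_step (hδ : |p 1 - p 0| < 1) {r : ℝ}
    (hr : nextBelief p r = r) (hpr : ∀ x ∈ Set.Icc (0 : ℝ) 1,
      x * |p 1 - r| + (1 - x) * |p 0 - r| ≤ |p 1 - p 0| * |x - r|) {b : Fin N → ℝ}
    (hb : ∀ i, b i ∈ Set.Icc (0 : ℝ) 1) (i : Fin N) :
    |b i - r| + (b i * ∑ j, 1 / (1 - |p 1 - p 0|) * |updateBelief p b i 1 j - r| +
        (1 - b i) * ∑ j, 1 / (1 - |p 1 - p 0|) * |updateBelief p b i 0 j - r|) ≤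
      ∑ j, 1 / (1 - |p 1 - p 0|) * |b j - r| := by
  set D := 1 / (1 - |p 1 - p 0|) with hD
  have hd : 0 < 1 - |p 1 - p 0| := by linarith
  have hD0 : 0 < D := by positivity
  have hDeq : D * |p 1 - p 0| = D - 1 := by rw [hD]; field_simp; ring
  have h1 : ∀ o, ∑ j, D * |updateBelief p b i o j - r| ≤
      D * |p o - r| + ∑ j ∈ univ.erase i, D * |b j - r| := fun o => by
    rw [← add_sum_erase univ _ (mem_univ i)]
    refine add_le_add (by simp [updateBelief]) (sum_le_sum fun j hj => ?_)
    simp only [updateBelief, ne_of_mem_erase hj, if_false]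
    rw [← hr, nextBelief_sub, hr, abs_mul]
    exact mul_le_mul_of_nonneg_left (mul_le_of_le_one_left (abs_nonneg _) hδ.le) hD0.le
  have h2 := mul_le_mul_of_nonneg_left (h1 1) (hb i).1
  have h3 := mul_le_mul_of_nonneg_left (h1 0) (sub_nonneg.2 (hb i).2)
  have h4 := mul_le_mul_of_nonneg_left (hpr _ (hb i)) hD0.le
  rw [← mul_assoc, hDeq] at h4
  rw [← add_sum_erase univ (fun j => D * |b j - r|) (mem_univ i)]
  linarith

theorem optVal_le_policyValue_of_potential [NeZero N] (hp : ∀ o, p o ∈ Set.Icc (0 : ℝ) 1)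
    (hω : ∀ i, ω i ∈ Set.Icc (0 : ℝ) 1) (hδ : |p 1 - p 0| < 1) {r : ℝ}
    (hr01 : r ∈ Set.Icc (0 : ℝ) 1)
    (hr : nextBelief p r = r) (hpr : ∀ x ∈ Set.Icc (0 : ℝ) 1,
      x * |p 1 - r| + (1 - x) * |p 0 - r| ≤ |p 1 - p 0| * |x - r|) (n : ℕ)
    (h : SensingHistory N) :
    optVal p n (belief p ω h) ≤ policyValue p ω π n h + 2 * (N / (1 - |p 1 - p 0|)) := by
  have hd : 0 < 1 - |p 1 - p 0| := by linarith
  have hΦ : ∀ b : Fin N → ℝ, 0 ≤ ∑ j, 1 / (1 - |p 1 - p 0|) * |b j - r| := fun b =>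
    sum_nonneg fun j _ => mul_nonneg (one_div_nonneg.2 hd.le) (abs_nonneg _)
  have upper : ∀ n, ∀ b : Fin N → ℝ, (∀ i, b i ∈ Set.Icc (0 : ℝ) 1) →
      optVal p n b ≤ n * r + ∑ j, 1 / (1 - |p 1 - p 0|) * |b j - r| := fun n => by
    induction n with
    | zero => intro b _; simpa [optVal] using hΦ b
    | succ n ih =>
      intro b hb
      refine optVal_succ_le fun i => ?_
      have h1 := actionVal_mono (p := p) hb i (V := optVal p n)
        (W := fun b => n * r + ∑ j, 1 / (1 - |p 1 - p 0|) * |b j - r|)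
        fun o => ih _ (updateBelief_mem hp hb i o)
      refine h1.trans ?_
      have h2 := potential_step hδ hr hpr hb i
      have h3 := le_abs_self (b i - r)
      simp only [actionVal]
      push_cast
      linarith
  have lower : ∀ n h, n * r - ∑ j, 1 / (1 - |p 1 - p 0|) * |belief p ω h j - r| ≤
      policyValue p ω π n h := fun n => by
    induction n with
    | zero => intro h; simpa [policyValue] using hΦ (belief p ω h)
    | succ n ih =>
      intro h
      have hb := belief_mem hp hω h
      have h1 := le_policyValue_succ (π := π) (h := h) (n := n) (c := 0)
        (V := fun b => n * r - ∑ j, 1 / (1 - |p 1 - p 0|) * |b j - r|) hp hω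
        fun o => by simpa using ih _
      have h2 := potential_step hδ hr hpr hb (π h)
      have h3 := neg_abs_le (belief p ω h (π h) - r)
      simp only [actionVal] at h1
      push_cast
      linarith
  have h1 := upper n _ (belief_mem hp hω h)
  have h2 := lower n h
  have h3 : ∑ j, 1 / (1 - |p 1 - p 0|) * |belief p ω h j - r| ≤ N / (1 - |p 1 - p 0|) := by
    calc ∑ j, 1 / (1 - |p 1 - p 0|) * |belief p ω h j - r|
        ≤ ∑ _j : Fin N, 1 / (1 - |p 1 - p 0|) := sum_le_sum fun j _ => by
          refine mul_le_of_le_one_right (one_div_nonneg.2 hd.le) ?_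
          have h4 := belief_mem hp hω h j
          simp only [Set.mem_Icc] at h4 hr01
          rw [abs_le]; constructor <;> linarith
      _ = N / (1 - |p 1 - p 0|) := by simp; ring
  linarith

/-- If the channels forget their state at once, or have an absorbing state without being negatively
correlated, then all policies have the same reward up to a constant. -/
theorem optVal_le_policyValue_of_degenerate [NeZero N] (hp : ∀ o, p o ∈ Set.Icc (0 : ℝ) 1)
    (hω : ∀ i, ω i ∈ Set.Icc (0 : ℝ) 1) (hδ : |p 1 - p 0| < 1)
    (hdeg : p 0 = p 1 ∨ p 0 = 0 ∨ p 1 = 1) (n : ℕ) (h : SensingHistory N) :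
    optVal p n (belief p ω h) ≤ policyValue p ω π n h + 2 * (N / (1 - |p 1 - p 0|)) := by
  rcases hdeg with hd | hd | hd
  · refine optVal_le_policyValue_of_potential hp hω hδ (r := p 0) (hp 0) ?_ ?_ n h
    · simp only [nextBelief, ← hd]; ring
    · intro x _; simp [hd]
  · refine optVal_le_policyValue_of_potential hp hω hδ (r := 0) (by simp) ?_ ?_ n h
    · simp [nextBelief, hd]
    · intro x hx
      simp [hd, abs_of_nonneg hx.1]
      linarith
  · refine optVal_le_policyValue_of_potential hp hω hδ (r := 1) (by simp) ?_ ?_ n h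
    · simp [nextBelief, hd]
    · intro x hx
      have h1 : |x - 1| = 1 - x := by rw [abs_sub_comm, abs_of_nonneg (by linarith [hx.2])]
      rw [hd, h1, sub_self, abs_zero, abs_sub_comm (p 0)]
      linarith

end

/-! ### Hoeffding's inequality for conditional expectations along histories -/

/-- Hoeffding's lemma for a Bernoulli variable of mean `q`, realized as a combination of two Dirac
measures. -/
theorem hoeffding_two_point {q : ℝ} (hq : q ∈ Set.Icc (0 : ℝ) 1) (t : ℝ) :
    1 - q + q * Real.exp t ≤ Real.exp (t * q + t ^ 2 / 8) := by
  classical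
  let ν : MeasureTheory.Measure ℝ :=
    ENNReal.ofReal q • MeasureTheory.Measure.dirac 1 +
      ENNReal.ofReal (1 - q) • MeasureTheory.Measure.dirac 0
  have hq' : 0 ≤ 1 - q := by linarith [hq.2]
  have hν : MeasureTheory.IsProbabilityMeasure ν := ⟨by
    simp [ν, ← ENNReal.ofReal_add hq.1 hq']⟩
  have hint : ∀ f : ℝ → ℝ, ∫ x, f x ∂ν = q * f 1 + (1 - q) * f 0 := fun f => by
    have hi : ∀ a : ℝ, MeasureTheory.Integrable f (MeasureTheory.Measure.dirac a) := fun a =>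
      MeasureTheory.integrable_dirac (by simp)
    rw [MeasureTheory.integral_add_measure ((hi 1).smul_measure (by simp))
      ((hi 0).smul_measure (by simp))]
    simp [MeasureTheory.integral_smul_measure, hq.1, hq']
  have hae : ∀ᵐ x ∂ν, id x ∈ Set.Icc (0 : ℝ) 1 := by
    rw [MeasureTheory.ae_iff]
    simp [ν]
  have h := (ProbabilityTheory.hasSubgaussianMGF_of_mem_Icc (μ := ν) (X := id)
    aemeasurable_id hae).mgf_le t
  simp only [ProbabilityTheory.mgf, hint, id] at h
  norm_num at h
  have h2 := mul_le_mul_of_nonneg_left h (Real.exp_pos (t * q)).le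
  rw [mul_add, mul_left_comm, mul_left_comm (Real.exp (t * q)), ← Real.exp_add, ← Real.exp_add,
    ← Real.exp_add] at h2
  ring_nf at h2 ⊢
  simp only [Real.exp_zero, mul_one] at h2
  simp only [one_div] at h2 ⊢
  linarith

theorem exp_mul_le_of_mem_Icc {x : ℝ} (hx : x ∈ Set.Icc (0 : ℝ) 1) (t : ℝ) :
    Real.exp (t * x) ≤ 1 + (Real.exp t - 1) * x := by
  have h := convexOn_exp.2 (Set.mem_univ 0) (Set.mem_univ t) (sub_nonneg.2 hx.2) hx.1
    (by ring)
  simp only [smul_eq_mul, mul_zero, zero_add, Real.exp_zero, mul_one] at h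
  rw [mul_comm t]
  linarith

section
variable {N : ℕ} {p : Fin 2 → ℝ} {ω : Fin N → ℝ} {π : SensingPolicy N}

/-- Convexity puts exp(tF) below its chord on [0,1]. Its expectation is then at most that of a
Bernoulli variable with the same mean. -/
theorem pathExpect_exp_le (hp : ∀ o, p o ∈ Set.Icc (0 : ℝ) 1) (hω : ∀ i, ω i ∈ Set.Icc (0 : ℝ) 1)
    (n : ℕ) (h : SensingHistory N) {F : SensingHistory N → ℝ}
    (hF : ∀ g : SensingHistory N, g.length = n → F (h ++ g) ∈ Set.Icc (0 : ℝ) 1) (t : ℝ) :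
    pathExpect p ω π n (fun h => Real.exp (t * F h)) h ≤
      Real.exp (t * pathExpect p ω π n F h + t ^ 2 / 8) := by
  have h1 := pathExpect_mono (π := π) hp hω n h (F := fun h => Real.exp (t * F h))
    (G := fun h => 1 + (Real.exp t - 1) * F h) fun g hg => exp_mul_le_of_mem_Icc (hF g hg) t
  rw [pathExpect_add, pathExpect_const, pathExpect_const_mul] at h1
  have h2 := pathExpect_mono (π := π) hp hω n h (F := fun _ => 0) (G := F) fun g hg => (hF g hg).1
  have h3 := pathExpect_mono (π := π) hp hω n h (F := F) (G := fun _ => 1) fun g hg => (hF g hg).2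
  rw [pathExpect_const] at h2 h3
  have h4 := hoeffding_two_point ⟨h2, h3⟩ t
  linarith

theorem historyReward_mem (h : SensingHistory N) :
    0 ≤ historyReward h ∧ historyReward h ≤ h.length := by
  induction h using List.reverseRecOn with
  | nil => simp [historyReward]
  | append_singleton h q ih =>
    rw [historyReward_append]
    simp only [historyReward, List.map_cons, List.map_nil, List.sum_cons, List.sum_nil,
      List.length_append, List.length_cons, List.length_nil] at ih ⊢
    push_cast
    split_ifs <;> constructor <;> linarith [ih.1, ih.2]

/-! ### Blocks -/

theorem blockEnd_succ (K : ℕ → ℕ) (I : ℕ) : blockEnd K (I + 1) = blockEnd K I + K (I + 1) := by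
  unfold blockEnd
  rw [Finset.sum_Icc_succ_top (by omega)]

theorem blockEnd_zero (K : ℕ → ℕ) : blockEnd K 0 = 0 := by simp [blockEnd]

theorem blockEnd_mono (K : ℕ → ℕ) : Monotone (blockEnd K) :=
  monotone_nat_of_le_succ fun I => by rw [blockEnd_succ]; omega

theorem IsBlockSequence.le_blockEnd {K : ℕ → ℕ} (hK : IsBlockSequence K) (I : ℕ) :
    I ≤ blockEnd K I := by
  induction I with
  | zero => simp
  | succ I ih =>
    rw [blockEnd_succ]
    have := hK.pos (I + 1) (by omega)
    omega

theorem blockAt_eq {K : ℕ → ℕ} {I t : ℕ} (h1 : blockEnd K I ≤ t) (h2 : t < blockEnd K (I + 1)) :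
    blockAt K t = I + 1 := by
  refine le_antisymm (Nat.sInf_le h2) ?_
  refine le_csInf ⟨I + 1, h2⟩ fun J hJ => ?_
  by_contra hlt
  have := blockEnd_mono K (show J ≤ I by omega)
  have hJ' : t < blockEnd K J := hJ
  omega

theorem sum_range_blockEnd (K : ℕ → ℕ) (f : ℕ → ℝ) (m : ℕ) :
    ∑ t ∈ range (blockEnd K m), f (blockAt K t) = ∑ k ∈ range m, K (k + 1) * f (k + 1) := by
  induction m with
  | zero => simp [blockEnd_zero]
  | succ m ih =>
    rw [blockEnd_succ, sum_range_add, ih, sum_range_succ]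
    congr 1
    rw [sum_congr rfl (g := fun _ => f (m + 1)) fun t ht => ?_]
    · simp
    · have := mem_range.1 ht
      rw [blockAt_eq (I := m) (by omega) (by rw [blockEnd_succ]; omega)]

/-- The first block that ends at time `n` or later. -/
theorem exists_lastBlock {K : ℕ → ℕ} (hK : IsBlockSequence K) {n : ℕ} (hn : 1 ≤ n) :
    ∃ m, n ≤ blockEnd K m ∧ (∀ k < m, blockEnd K k < n) ∧ ∀ k < m, K (k + 1) ≤ blockLength K n := by
  classical
  have hex : ∃ m, n ≤ blockEnd K m := ⟨n, hK.le_blockEnd n⟩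
  have hmin : ∀ k < Nat.find hex, blockEnd K k < n := fun k hk => not_le.1 (Nat.find_min hex hk)
  refine ⟨Nat.find hex, Nat.find_spec hex, hmin, fun k hk => ?_⟩
  refine le_csInf ⟨K n, n, hn, hK.le_blockEnd n, rfl⟩ ?_
  rintro _ ⟨I, hI, hnI, rfl⟩
  exact hK.mono _ _ (by omega) ((Nat.succ_le_of_lt hk).trans (Nat.find_min' hex hnI))

/-! ### The variables of the meta-policy -/

theorem observedReward_append {h g : SensingHistory N} {s : ℕ} (hs : s < h.length) :
    observedReward (h ++ g) s = observedReward h s := by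
  unfold observedReward
  rw [List.getElem?_append_left hs]

theorem sum_observedReward (h : SensingHistory N) :
    ∑ s ∈ range h.length, observedReward h s = historyReward h := by
  induction h using List.reverseRecOn with
  | nil => simp [historyReward]
  | append_singleton h q ih =>
    rw [List.length_append, List.length_singleton, sum_range_succ, historyReward_append, ← ih]
    congr 1
    · exact sum_congr rfl fun s hs => observedReward_append (mem_range.1 hs)
    · obtain ⟨i, o⟩ := q
      simp [observedReward, historyReward]

theorem blockMean_append {K : ℕ → ℕ} {h : SensingHistory N} (g : SensingHistory N) {I : ℕ}
    (hI : blockEnd K I ≤ h.length) : blockMean K (h ++ g) I = blockMean K h I := by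
  unfold blockMean
  rw [sum_congr rfl fun s hs => observedReward_append ((mem_Ico.1 hs).2.trans_le hI)]

theorem blockMean_append_block {K : ℕ → ℕ} {h g : SensingHistory N} {I : ℕ}
    (hh : h.length = blockEnd K I) (hg : g.length = K (I + 1)) :
    blockMean K (h ++ g) (I + 1) = historyReward g / K (I + 1) := by
  unfold blockMean
  congr 1
  have h1 : blockEnd K (I + 1) = (h ++ g).length := by
    rw [blockEnd_succ, List.length_append, hh, hg]
  rw [Nat.add_sub_cancel, h1, ← hh, sum_Ico_eq_sub _ (by simp), sum_observedReward,
    sum_congr rfl fun s hs => observedReward_append (mem_range.1 hs), sum_observedReward,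
    historyReward_append]
  ring

variable {K : ℕ → ℕ} {tie : SensingHistory N → Fin 2}

/-- The choice of a block's arm looks only at completed blocks; the tie-breaking rule too receives a
truncated history. -/
theorem metaState_append {h : SensingHistory N} (g : SensingHistory N) {I : ℕ}
    (hI : blockEnd K I ≤ h.length) :
    metaState K tie (h ++ g) I = metaState K tie h I ∧
      blockArm K tie (h ++ g) (I + 1) = blockArm K tie h (I + 1) := by
  induction I with
  | zero => simp [metaState, blockArm, nextArm]
  | succ I ih =>
    have hI' := (blockEnd_mono K (Nat.le_succ I)).trans hI
    obtain ⟨ih1, ih2⟩ := ih hI'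
    simp only [blockArm, Nat.add_sub_cancel] at ih2
    have h1 : metaState K tie (h ++ g) (I + 1) = metaState K tie h (I + 1) := by
      rw [ih1] at ih2
      simp only [metaState, ih1, blockMean_append g hI, ih2]
    refine ⟨h1, ?_⟩
    simp only [blockArm, Nat.add_sub_cancel, h1]
    unfold nextArm
    rw [List.take_append_of_le_length hI]

theorem blockArm_take {h : SensingHistory N} {I t : ℕ} (hI : blockEnd K I ≤ t)
    (ht : t ≤ h.length) : blockArm K tie (h.take t) (I + 1) = blockArm K tie h (I + 1) := by
  conv_rhs => rw [← List.take_append_drop t h]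
  rw [(metaState_append (h.drop t) (by rw [List.length_take]; omega)).2]

theorem blockMean_take {h : SensingHistory N} {I t : ℕ} (hI : blockEnd K I ≤ t)
    (ht : t ≤ h.length) : blockMean K (h.take t) I = blockMean K h I := by
  conv_rhs => rw [← List.take_append_drop t h]
  rw [blockMean_append (h.drop t) (by rw [List.length_take]; omega)]

/-- A sum over those of the first `I` blocks in which arm `j` is played. -/
noncomputable def armSum (K : ℕ → ℕ) (tie : SensingHistory N → Fin 2) (h : SensingHistory N)
    (j : Fin 2) (f : ℕ → ℝ) (I : ℕ) : ℝ :=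
  ∑ k ∈ range I, if blockArm K tie h (k + 1) = j then f (k + 1) else 0

theorem armSum_succ (h : SensingHistory N) (j : Fin 2) (f : ℕ → ℝ) (I : ℕ) :
    armSum K tie h j f (I + 1) =
      armSum K tie h j f I + if blockArm K tie h (I + 1) = j then f (I + 1) else 0 :=
  sum_range_succ _ _

theorem metaState_count (h : SensingHistory N) (j : Fin 2) (I : ℕ) :
    ((metaState K tie h I).count j : ℝ) = armSum K tie h j (fun _ => 1) I := by
  induction I with
  | zero => simp [metaState, armSum]
  | succ I ih =>
    rw [armSum_succ, ← ih]
    simp only [metaState, blockArm, Nat.add_sub_cancel]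
    by_cases hj : nextArm K tie h I (metaState K tie h I) = j
    · rw [if_pos hj, hj]
      simp
    · rw [if_neg hj, Function.update_of_ne (Ne.symm hj)]
      simp

theorem metaState_total (h : SensingHistory N) (j : Fin 2) (I : ℕ) :
    (metaState K tie h I).total j = armSum K tie h j (blockMean K h) I := by
  induction I with
  | zero => simp [metaState, armSum]
  | succ I ih =>
    rw [armSum_succ, ← ih]
    simp only [metaState, blockArm, Nat.add_sub_cancel]
    by_cases hj : nextArm K tie h I (metaState K tie h I) = j
    · rw [if_pos hj, hj]
      simp
    · rw [if_neg hj, Function.update_of_ne (Ne.symm hj)]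
      simp

/-- The logarithm of the exponential supermartingale of arm `j`. -/
noncomputable def armExponent (K : ℕ → ℕ) (tie : SensingHistory N → Fin 2) (j : Fin 2) (r : ℝ)
    (m : ℕ → ℝ) (I : ℕ) (h : SensingHistory N) : ℝ :=
  armSum K tie h j (fun k => r * (blockMean K h k - m k) - r ^ 2 / 8) I

theorem armExponent_eq (j : Fin 2) (r : ℝ) (m : ℕ → ℝ) (I : ℕ) (h : SensingHistory N) :
    armExponent K tie j r m I h = r * ((metaState K tie h I).total j - armSum K tie h j m I) -
      (metaState K tie h I).count j * (r ^ 2 / 8) := by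
  rw [metaState_total, metaState_count, armExponent]
  unfold armSum
  rw [← sum_sub_distrib, mul_sum, sum_mul, ← sum_sub_distrib]
  refine sum_congr rfl fun k _ => ?_
  split_ifs <;> ring

theorem armExponent_take {j : Fin 2} {r : ℝ} {m : ℕ → ℝ} {I t : ℕ} {h : SensingHistory N}
    (hI : blockEnd K I ≤ t) (ht : t ≤ h.length) :
    armExponent K tie j r m I (h.take t) = armExponent K tie j r m I h := by
  unfold armExponent armSum
  refine sum_congr rfl fun k hk => ?_
  have hk' := mem_range.1 hk
  simp only [blockArm_take ((blockEnd_mono K hk'.le).trans hI) ht,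
    blockMean_take (I := k + 1) ((blockEnd_mono K hk').trans hI) ht]

theorem metaPolicy_append [NeZero N] (σ : Equiv.Perm (Fin N)) {h : SensingHistory N} {I : ℕ}
    (hh : h.length = blockEnd K I) {g : SensingHistory N} (hg : g.length < K (I + 1)) :
    metaPolicy K σ tie (h ++ g) = myopicPolicy σ (blockArm K tie h (I + 1)) (h ++ g) := by
  unfold metaPolicy
  rw [blockAt_eq (I := I) (by rw [List.length_append]; omega)
    (by rw [List.length_append, blockEnd_succ]; omega), (metaState_append g hh.ge).2]

/-- The supermartingale property, block by block: given the past, a block mean lies in [0,1], and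
`hm` puts its conditional expectation on the favourable side of `m` for the sign of `r`. Hoeffding's
term r²/8 is compensated in the exponent. -/
theorem pathExpect_exp_armExponent_le [NeZero N] (hK : IsBlockSequence K)
    (hp : ∀ o, p o ∈ Set.Icc (0 : ℝ) 1) (hω : ∀ i, ω i ∈ Set.Icc (0 : ℝ) 1)
    (σ : Equiv.Perm (Fin N)) (j : Fin 2) (r : ℝ) (m : ℕ → ℝ)
    (hm : ∀ I h, r * (policyValue p ω (myopicPolicy σ j) (K (I + 1)) h / K (I + 1) -
      m (I + 1)) ≤ 0) (I : ℕ) :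
    pathExpect p ω (metaPolicy K σ tie) (blockEnd K I)
      (fun h => Real.exp (armExponent K tie j r m I h)) [] ≤ 1 := by
  induction I with
  | zero => simp [blockEnd_zero, pathExpect, armExponent, armSum]
  | succ I ih =>
    rw [blockEnd_succ, pathExpect_comp]
    refine le_trans (pathExpect_mono hp hω _ [] fun h hh => ?_) ih
    rw [List.nil_append]
    have hK0 : (0 : ℝ) < K (I + 1) := by
      have := hK.pos (I + 1) (by omega)
      exact_mod_cast this
    -- `X` equals the mean of the block at its end, and its conditional expectation is the value of
    -- the arm divided by the length.
    let X : SensingHistory N → ℝ := fun h' =>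
      (historyReward h' - historyReward h) * (1 / K (I + 1))
    have hX : ∀ g : SensingHistory N, X (h ++ g) = historyReward g / K (I + 1) := fun g => by
      simp only [X, historyReward_append]; ring
    have hexp : ∀ g : SensingHistory N, g.length = K (I + 1) →
        armExponent K tie j r m (I + 1) (h ++ g) = armExponent K tie j r m I h +
          if blockArm K tie h (I + 1) = j then r * (X (h ++ g) - m (I + 1)) - r ^ 2 / 8 else 0 :=
      fun g hg => by
        have h1 : armExponent K tie j r m I (h ++ g) = armExponent K tie j r m I h := by
          rw [← armExponent_take (h := h ++ g) hh.ge (by simp), List.take_left']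
          rfl
        rw [← h1, armExponent, armSum_succ, ← armExponent,
          (metaState_append g hh.ge).2, blockMean_append_block hh hg, hX]
    rw [pathExpect_congr (K (I + 1)) h (G := fun h' => Real.exp (armExponent K tie j r m I h +
        if blockArm K tie h (I + 1) = j then r * (X h' - m (I + 1)) - r ^ 2 / 8 else 0)) (π' := myopicPolicy σ (blockArm K tie h (I + 1)))
      (fun g hg => metaPolicy_append σ hh hg)
      (fun g hg => congrArg Real.exp (hexp g hg))]
    by_cases hj : blockArm K tie h (I + 1) = j
    · simp only [hj, if_true]
      have h1 : ∀ h', Real.exp (armExponent K tie j r m I h + (r * (X h' - m (I + 1)) - r ^ 2 / 8))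
          = Real.exp (armExponent K tie j r m I h) * (Real.exp (-(r * m (I + 1)) - r ^ 2 / 8) *
            Real.exp (r * X h')) := fun h' => by
        rw [← Real.exp_add, ← Real.exp_add]; ring_nf
      simp only [h1]
      rw [pathExpect_const_mul, pathExpect_const_mul]
      refine mul_le_of_le_one_right (Real.exp_pos _).le ?_
      have h2 := pathExpect_exp_le (π := myopicPolicy σ j) hp hω (K (I + 1)) h (F := X)
        (fun g hg => by
          rw [hX]
          have := historyReward_mem g
          rw [hg] at this
          exact ⟨div_nonneg this.1 hK0.le, div_le_one_of_le₀ this.2 hK0.le⟩) r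
      have h3 : pathExpect p ω (myopicPolicy σ j) (K (I + 1)) X h =
          policyValue p ω (myopicPolicy σ j) (K (I + 1)) h / K (I + 1) := by
        have : X = fun h' => 1 / (K (I + 1) : ℝ) * (historyReward h' + -historyReward h) := by
          funext h'; simp only [X]; ring
        rw [this, pathExpect_const_mul, pathExpect_add, pathExpect_const,
          pathExpect_historyReward]
        ring
      rw [h3] at h2
      refine (mul_le_mul_of_nonneg_left h2 (Real.exp_pos _).le).trans ?_
      rw [← Real.exp_add]
      refine Real.exp_le_one_iff.2 ?_
      have := hm I h
      linarith
    · simp only [hj, if_false, add_zero]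
      rw [pathExpect_const]

end

/-! ### The number of blocks in which the worse arm is played -/

section
variable {N : ℕ} {p : Fin 2 → ℝ} {ω : Fin N → ℝ} {K : ℕ → ℕ} {tie : SensingHistory N → Fin 2}

theorem armSum_affine (h : SensingHistory N) (j : Fin 2) (a c : ℝ) (f : ℕ → ℝ) (I : ℕ) :
    armSum K tie h j (fun k => a + c * f k) I =
      a * (metaState K tie h I).count j + c * armSum K tie h j f I := by
  rw [metaState_count]
  unfold armSum
  rw [mul_sum, mul_sum, ← sum_add_distrib]
  refine sum_congr rfl fun k _ => ?_
  split_ifs <;> ring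

/-- The bias C/K is at most ε once blocks are long. The early blocks contribute a fixed amount,
called `B` in the deviation bounds. -/
theorem armSum_div_le (h : SensingHistory N) (j : Fin 2) {C ε : ℝ} (hC : 0 ≤ C) (hε : 0 ≤ ε)
    {k₀ : ℕ} (hk₀ : ∀ k, k₀ ≤ k → C / K k ≤ ε) (hK : IsBlockSequence K) (I : ℕ) :
    armSum K tie h j (fun k => C / K k) I ≤
      ε * (metaState K tie h I).count j + k₀ * C := by
  have h1 : ∀ k ∈ range I, (if blockArm K tie h (k + 1) = j then C / K (k + 1) else 0) ≤
      ε * (if blockArm K tie h (k + 1) = j then 1 else 0) + if k < k₀ then C else 0 := fun k _ => by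
    have hK1 : (1 : ℝ) ≤ K (k + 1) := by exact_mod_cast hK.pos (k + 1) (by omega)
    have h2 : C / K (k + 1) ≤ C := div_le_self hC hK1
    by_cases hk : k < k₀
    · split_ifs <;> linarith
    · have := hk₀ (k + 1) (by omega)
      split_ifs <;> linarith
  have h3 : ∑ k ∈ range I, (if k < k₀ then C else 0) ≤ k₀ * C := by
    rw [← sum_filter, sum_const, nsmul_eq_mul]
    refine mul_le_mul_of_nonneg_right ?_ hC
    have : #{k ∈ range I | k < k₀} ≤ #(range k₀) :=
      card_le_card fun k hk => mem_range.2 (mem_filter.1 hk).2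
    rw [card_range] at this
    exact_mod_cast this
  rw [metaState_count]
  have h4 := sum_le_sum h1
  rw [sum_add_distrib, ← mul_sum] at h4
  unfold armSum
  linarith

theorem metaState_count_le (h : SensingHistory N) (j : Fin 2) (I : ℕ) :
    (metaState K tie h I).count j ≤ I := by
  have h1 : ((metaState K tie h I).count j : ℝ) ≤ I := by
    rw [metaState_count]
    calc armSum K tie h j (fun _ => 1) I ≤ ∑ _k ∈ range I, (1 : ℝ) :=
          sum_le_sum fun k _ => by split_ifs <;> norm_num
      _ = I := by simp
  exact_mod_cast h1

theorem one_le_metaState_count (h : SensingHistory N) (j : Fin 2) {I : ℕ} (hI : 2 ≤ I) :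
    1 ≤ (metaState K tie h I).count j := by
  have h1 : (1 : ℝ) ≤ (metaState K tie h I).count j := by
    rw [metaState_count]
    have h2 : ∀ k ∈ range I, (0 : ℝ) ≤ if blockArm K tie h (k + 1) = j then 1 else 0 :=
      fun k _ => by split_ifs <;> norm_num
    rcases (show j = 0 ∨ j = 1 by omega) with rfl | rfl
    · have := single_le_sum h2 (mem_range.2 (show 0 < I by omega))
      simpa [blockArm, nextArm, armSum] using this
    · have := single_le_sum h2 (mem_range.2 (show 1 < I by omega))
      simpa [blockArm, nextArm, armSum] using this
  exact_mod_cast h1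

theorem MetaState.index_le_of_best {m : MetaState} {n : ℕ} {t b : Fin 2} (hb : m.best n t = b)
    (j : Fin 2) : m.index n j ≤ m.index n b := by
  have h2 : ∀ i : Fin 2, i = 0 ∨ i = 1 := fun i => by omega
  unfold MetaState.best at hb
  split_ifs at hb with h0 h1
  · subst hb
    rcases h2 j with rfl | rfl
    · exact le_rfl
    · exact h0.le
  · subst hb
    rcases h2 j with rfl | rfl
    · exact h1.le
    · exact le_rfl
  · rcases h2 j with rfl | rfl <;> rcases h2 b with rfl | rfl <;>
      first | exact le_rfl | exact not_lt.1 h0 | exact not_lt.1 h1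

/-- An upper bound for the indicator of the event that one of the indices is misleading when block
`I + 1` starts. -/
noncomputable def misleading (K : ℕ → ℕ) (tie : SensingHistory N → Fin 2) (g b : Fin 2)
    (mg mb : ℕ → ℝ) (ε B : ℝ) (I : ℕ) (h : SensingHistory N) : ℝ :=
  Real.exp (12 * B ^ 2 - 5 * Real.log (blockEnd K I)) * ∑ s ∈ Icc 1 I, Real.exp
      (armExponent K tie g (-4 * Real.sqrt (3 * Real.log (blockEnd K I) / s)) mg I h) +
    Real.exp (4 * ε * B - 6 * Real.log (blockEnd K I)) *
      Real.exp (armExponent K tie b (4 * ε) mb I h)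

/-- If `b` is chosen after at least 3L/ε² plays, its confidence radius is at most ε. Then either the
index of `g` lies below μ - ε, or the sample mean of `b` is at least μ - 2ε. Biases included, either
event makes one exponent in `misleading` nonnegative. -/
theorem few_or_misleading (hK : IsBlockSequence K) {g b : Fin 2}
    {μ ε C : ℝ} (hε : 0 < ε) (hC : 0 ≤ C) {k₀ : ℕ} (hk₀ : ∀ k, k₀ ≤ k → C / K k ≤ ε)
    {I : ℕ} (hI : 2 ≤ I) {h : SensingHistory N} (hb : blockArm K tie h (I + 1) = b) :
    ((metaState K tie h I).count b : ℝ) < 3 * Real.log (blockEnd K I) / ε ^ 2 ∨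
      1 ≤ misleading K tie g b (fun k => μ + (-1) * (C / K k))
        (fun k => (μ - 4 * ε) + 1 * (C / K k)) ε (k₀ * C) I h := by
  set L := Real.log (blockEnd K I) with hLdef
  have hL : 0 ≤ L := Real.log_natCast_nonneg _
  set B : ℝ := k₀ * C
  rw [or_iff_not_imp_left, not_lt]
  intro hmany
  have hbest : (metaState K tie h I).best (blockEnd K I) (tie (h.take (blockEnd K I))) = b := by
    rw [← hb]
    simp only [blockArm, Nat.add_sub_cancel, nextArm]
    rw [if_neg (by omega), if_neg (by omega)]
  have hidx := MetaState.index_le_of_best hbest g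
  unfold MetaState.index at hidx
  rw [← hLdef] at hidx
  have hEg := armSum_div_le (tie := tie) h g hC hε.le hk₀ hK I
  have hEb := armSum_div_le (tie := tie) h b hC hε.le hk₀ hK I
  have hsg1 := one_le_metaState_count (K := K) (tie := tie) h g hI
  have hsgI := metaState_count_le (K := K) (tie := tie) h g I
  have hsb1 := one_le_metaState_count (K := K) (tie := tie) h b hI
  unfold misleading
  rw [← hLdef]
  by_cases hg : (metaState K tie h I).total g / (metaState K tie h I).count g +
      Real.sqrt (3 * L / (metaState K tie h I).count g) < μ - ε
  · set u := Real.sqrt (3 * L / (metaState K tie h I).count g) with hu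
    have hexpo : 0 ≤ 12 * B ^ 2 - 5 * L + armExponent K tie g (-4 * u)
        (fun k => μ + (-1) * (C / K k)) I h := by
      rw [armExponent_eq, armSum_affine]
      set s : ℝ := ((metaState K tie h I).count g : ℝ) with hs
      have hs1 : (1 : ℝ) ≤ s := by rw [hs]; exact_mod_cast hsg1
      have hs0 : 0 < s := by linarith
      have hu0 : 0 ≤ u := Real.sqrt_nonneg _
      have husq : u ^ 2 * s = 3 * L := by
        rw [hu, Real.sq_sqrt (by positivity)]
        field_simp
      have hu3 : u ^ 2 ≤ 3 * L := by
        rw [← husq]; exact le_mul_of_one_le_right (sq_nonneg u) hs1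
      have h1 : (metaState K tie h I).total g < (μ - ε - u) * s := by
        rw [← div_lt_iff₀ hs0]; linarith
      have h2 : s * u - B ≤ μ * s - armSum K tie h g (fun k => C / K k) I -
          (metaState K tie h I).total g := by
        linarith
      have h3 := mul_le_mul_of_nonneg_left h2 (show (0 : ℝ) ≤ 4 * u by linarith)
      -- The parameter -4u gives an exponent of at least 2su² - 4uB = 6L - 4uB. This square bounds
      -- 4uB by u²/3 + 12B² ≤ L + 12B².
      have h4 : 0 ≤ (u - 6 * B) ^ 2 := sq_nonneg _
      nlinarith
    -- The right parameter depends on the random count, hence the sum over all its possible values.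
    have hmem : (metaState K tie h I).count g ∈ Icc 1 I := mem_Icc.2 ⟨hsg1, hsgI⟩
    have h5 := single_le_sum (f := fun s : ℕ => Real.exp (armExponent K tie g
      (-4 * Real.sqrt (3 * L / s)) (fun k => μ + (-1) * (C / K k)) I h))
      (fun s _ => (Real.exp_pos _).le) hmem
    have h6 := mul_le_mul_of_nonneg_left h5 (Real.exp_pos (12 * B ^ 2 - 5 * L)).le
    simp only [← hu] at h6
    rw [← Real.exp_add] at h6
    have h7 := Real.one_le_exp hexpo
    have h8 : 0 ≤ Real.exp (4 * ε * B - 6 * L) * Real.exp (armExponent K tie b (4 * ε)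
      (fun k => (μ - 4 * ε) + 1 * (C / K k)) I h) := by positivity
    linarith
  · rw [not_lt] at hg
    have hexpo : 0 ≤ 4 * ε * B - 6 * L + armExponent K tie b (4 * ε)
        (fun k => (μ - 4 * ε) + 1 * (C / K k)) I h := by
      rw [armExponent_eq, armSum_affine]
      set s : ℝ := ((metaState K tie h I).count b : ℝ) with hs
      have hs1 : (1 : ℝ) ≤ s := by rw [hs]; exact_mod_cast hsb1
      have hs0 : 0 < s := by linarith
      rw [div_le_iff₀ (by positivity)] at hmany
      have hu : Real.sqrt (3 * L / s) ≤ ε := by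
        rw [Real.sqrt_le_left hε.le, div_le_iff₀ hs0]
        linarith
      have h1 : (μ - 2 * ε) * s ≤ (metaState K tie h I).total b := by
        rw [← le_div_iff₀ hs0]; linarith
      have h2 : s * ε - B ≤ (metaState K tie h I).total b - ((μ - 4 * ε) * s +
          1 * armSum K tie h b (fun k => C / K k) I) := by
        linarith
      have h3 := mul_le_mul_of_nonneg_left h2 (show (0 : ℝ) ≤ 4 * ε by linarith)
      nlinarith
    have h7 := Real.one_le_exp hexpo
    rw [Real.exp_add] at h7
    have h8 : 0 ≤ Real.exp (12 * B ^ 2 - 5 * L) * ∑ s ∈ Icc 1 I, Real.exp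
        (armExponent K tie g (-4 * Real.sqrt (3 * L / s))
          (fun k => μ + (-1) * (C / K k)) I h) :=
      mul_nonneg (Real.exp_pos _).le (sum_nonneg fun s _ => (Real.exp_pos _).le)
    linarith

/-- Each counted block raises the count of `b` by one and starts with that count below `l`. Carrying
the minimum with the count makes the induction close. -/
theorem sum_few_le (h : SensingHistory N) (b : Fin 2) {l : ℝ} (hl : 0 ≤ l) (m : ℕ) :
    ∑ k ∈ range m, (if blockArm K tie h (k + 1) = b ∧
      ((metaState K tie h k).count b : ℝ) < l then (1 : ℝ) else 0) ≤ l + 1 := by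
  suffices H : ∑ k ∈ range m, (if blockArm K tie h (k + 1) = b ∧
      ((metaState K tie h k).count b : ℝ) < l then (1 : ℝ) else 0) ≤
        min ((metaState K tie h m).count b : ℝ) (l + 1) from H.trans (min_le_right _ _)
  induction m with
  | zero => simp; linarith
  | succ m ih =>
    rw [le_min_iff] at ih
    rw [sum_range_succ, metaState_count h b (m + 1), armSum_succ, ← metaState_count, le_min_iff]
    split_ifs with h1 h2 h2
    · exact ⟨by linarith [ih.1], by linarith [ih.1, h1.2]⟩
    · exact absurd h1.1 h2
    · constructor <;> linarith [ih.1, ih.2]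
    · constructor <;> linarith [ih.1, ih.2]

theorem exp_neg_mul_log {k : ℕ} (hk : 0 < k) (n : ℕ) :
    Real.exp (-(n * Real.log k)) = 1 / (k : ℝ) ^ n := by
  rw [Real.exp_neg, Real.exp_nat_mul, Real.exp_log (by exact_mod_cast hk), one_div]

/-- The number of slots of `h` that belong to blocks with arm `b`. -/
noncomputable def armSlots (K : ℕ → ℕ) (tie : SensingHistory N → Fin 2) (b : Fin 2)
    (h : SensingHistory N) : ℝ :=
  ∑ t ∈ range h.length, if blockArm K tie (h.take t) (blockAt K t) = b then 1 else 0

theorem armSlots_append (b : Fin 2) (h : SensingHistory N) (q : Fin N × Fin 2) :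
    armSlots K tie b (h ++ [q]) =
      armSlots K tie b h + if blockArm K tie h (blockAt K h.length) = b then 1 else 0 := by
  unfold armSlots
  rw [List.length_append, List.length_singleton, sum_range_succ]
  congr 1
  · refine sum_congr rfl fun t ht => ?_
    rw [List.take_append_of_le_length (mem_range.1 ht).le]
  · rw [List.take_left']
    rfl

theorem exists_blockEnd_le (hK : IsBlockSequence K) (t : ℕ) :
    ∃ I, blockEnd K I ≤ t ∧ t < blockEnd K (I + 1) := by
  induction t with
  | zero =>
    refine ⟨0, by simp [blockEnd_zero], ?_⟩
    exact hK.le_blockEnd 1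
  | succ t ih =>
    obtain ⟨I, h1, h2⟩ := ih
    rcases Nat.lt_or_ge (t + 1) (blockEnd K (I + 1)) with h | h
    · exact ⟨I, by omega, h⟩
    · refine ⟨I + 1, h, ?_⟩
      have h3 := hK.pos (I + 2) (by omega)
      rw [blockEnd_succ K (I + 1)]
      exact Nat.lt_add_right_iff_pos.2 h3 |>.trans_le' (by omega)

theorem armSlots_le (hK : IsBlockSequence K) (b : Fin 2) (h : SensingHistory N) {m G : ℕ}
    (hm : h.length ≤ blockEnd K m) (hG : ∀ k < m, K (k + 1) ≤ G) :
    armSlots K tie b h ≤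
      G * ∑ k ∈ range m, if blockArm K tie h (k + 1) = b then (1 : ℝ) else 0 := by
  let f : ℕ → ℝ := fun I => if blockArm K tie h I = b then 1 else 0
  have hf : ∀ I, 0 ≤ f I := fun I => by simp only [f]; split_ifs <;> norm_num
  calc armSlots K tie b h = ∑ t ∈ range h.length, f (blockAt K t) := by
        refine sum_congr rfl fun t ht => ?_
        obtain ⟨I, h1, h2⟩ := exists_blockEnd_le hK t
        rw [blockAt_eq h1 h2, blockArm_take h1 (mem_range.1 ht).le]
    _ ≤ ∑ t ∈ range (blockEnd K m), f (blockAt K t) :=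
        sum_le_sum_of_subset_of_nonneg (range_mono hm) fun t _ _ => hf _
    _ = ∑ k ∈ range m, K (k + 1) * f (k + 1) := sum_range_blockEnd K f m
    _ ≤ ∑ k ∈ range m, G * f (k + 1) := sum_le_sum fun k hk =>
        mul_le_mul_of_nonneg_right (by exact_mod_cast hG k (mem_range.1 hk)) (hf _)
    _ = _ := by rw [← mul_sum]

variable [NeZero N]

/-- Each exponential has expectation at most 1. At least `I` slots have passed, so the prefactor
e^(-5L) outweighs the `I` terms of the sum and leaves a summable I^(-2). -/
theorem pathExpect_misleading_le (hK : IsBlockSequence K) (hp : ∀ o, p o ∈ Set.Icc (0 : ℝ) 1)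
    (hω : ∀ i, ω i ∈ Set.Icc (0 : ℝ) 1) (σ : Equiv.Perm (Fin N)) {g b : Fin 2} {mg mb : ℕ → ℝ}
    (hg : ∀ I h, mg (I + 1) ≤
      policyValue p ω (myopicPolicy σ g) (K (I + 1)) h / K (I + 1))
    (hb : ∀ I h, policyValue p ω (myopicPolicy σ b) (K (I + 1)) h / K (I + 1) ≤ mb (I + 1))
    {ε : ℝ} (hε : 0 ≤ ε) (B : ℝ) {I n : ℕ} (hI : 1 ≤ I) (hn : blockEnd K I ≤ n) :
    pathExpect p ω (metaPolicy K σ tie) n (misleading K tie g b mg mb ε B I) [] ≤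
      (Real.exp (12 * B ^ 2) + Real.exp (4 * ε * B)) * (1 / (I : ℝ) ^ 2) := by
  have key : ∀ j r m, (∀ I h, r * (policyValue p ω (myopicPolicy σ j) (K (I + 1)) h / K (I + 1) -
      m (I + 1)) ≤ 0) → pathExpect p ω (metaPolicy K σ tie) n
        (fun h => Real.exp (armExponent K tie j r m I h)) [] ≤ 1 := fun j r m hm => by
    have h1 := pathExpect_exp_armExponent_le (tie := tie) hK hp hω σ j r m hm I
    rw [← pathExpect_take hn] at h1
    refine le_of_eq_of_le (pathExpect_congr n [] (fun _ _ => rfl) fun h hh => ?_) h1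
    rw [List.nil_append, armExponent_take le_rfl (by omega)]
  have hgs : ∀ s : ℕ, pathExpect p ω (metaPolicy K σ tie) n (fun h => Real.exp
      (armExponent K tie g (-4 * Real.sqrt (3 * Real.log (blockEnd K I) / s)) mg I h)) [] ≤ 1 :=
    fun s => key _ _ _ fun I h => by
      have h1 := Real.sqrt_nonneg (3 * Real.log (blockEnd K I) / s)
      have h2 := hg I h
      exact mul_nonpos_of_nonpos_of_nonneg (mul_nonpos_of_nonpos_of_nonneg (by norm_num)
        (Real.sqrt_nonneg _)) (by linarith)
  have hbs := key b (4 * ε) mb fun I h => by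
    have h2 := hb I h
    exact mul_nonpos_of_nonneg_of_nonpos (by linarith) (by linarith)
  unfold misleading
  rw [pathExpect_add, pathExpect_const_mul, pathExpect_const_mul, pathExpect_sum]
  have hI0 : (0 : ℝ) < I := by exact_mod_cast hI
  have hsum : ∑ s ∈ Icc 1 I, pathExpect p ω (metaPolicy K σ tie) n (fun h => Real.exp
      (armExponent K tie g (-4 * Real.sqrt (3 * Real.log (blockEnd K I) / s)) mg I h)) [] ≤ I := by
    refine (sum_le_sum fun s _ => hgs s).trans ?_
    simp
  have hlog : Real.log I ≤ Real.log (blockEnd K I) :=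
    Real.log_le_log hI0 (by exact_mod_cast hK.le_blockEnd I)
  have hlog0 : 0 ≤ Real.log I := Real.log_natCast_nonneg I
  have h5 : Real.exp (12 * B ^ 2 - 5 * Real.log (blockEnd K I)) * I ≤
      Real.exp (12 * B ^ 2) * (1 / (I : ℝ) ^ 2) := by
    have h6 : Real.exp (12 * B ^ 2 - 5 * Real.log (blockEnd K I)) ≤
        Real.exp (12 * B ^ 2) * (1 / (I : ℝ) ^ 3) := by
      rw [← exp_neg_mul_log hI 3, ← Real.exp_add, Real.exp_le_exp]
      push_cast
      linarith
    calc _ ≤ Real.exp (12 * B ^ 2) * (1 / (I : ℝ) ^ 3) * I :=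
          mul_le_mul_of_nonneg_right h6 hI0.le
      _ = Real.exp (12 * B ^ 2) * (1 / (I : ℝ) ^ 2) := by field_simp
  have h7 : Real.exp (4 * ε * B - 6 * Real.log (blockEnd K I)) * 1 ≤
      Real.exp (4 * ε * B) * (1 / (I : ℝ) ^ 2) := by
    rw [← exp_neg_mul_log hI 2, ← Real.exp_add, mul_one, Real.exp_le_exp]
    push_cast
    linarith
  have h8 := mul_le_mul_of_nonneg_left hsum
    (Real.exp_pos (12 * B ^ 2 - 5 * Real.log (blockEnd K I))).le
  have h9 := mul_le_mul_of_nonneg_left hbs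
    (Real.exp_pos (4 * ε * B - 6 * Real.log (blockEnd K I))).le
  rw [add_mul]
  linarith

/-- The expected number of blocks, among those that start before slot `n`, in which the worse arm is
played. -/
theorem pathExpect_badBlocks_le (hK : IsBlockSequence K) (hp : ∀ o, p o ∈ Set.Icc (0 : ℝ) 1)
    (hω : ∀ i, ω i ∈ Set.Icc (0 : ℝ) 1) (σ : Equiv.Perm (Fin N)) {g b : Fin 2}
    {μ ε C : ℝ} (hε : 0 < ε) (hC : 0 ≤ C) {k₀ : ℕ} (hk₀ : ∀ k, k₀ ≤ k → C / K k ≤ ε)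
    (hg : ∀ n h, n * μ - C ≤ policyValue p ω (myopicPolicy σ g) n h)
    (hb : ∀ n h, policyValue p ω (myopicPolicy σ b) n h ≤ n * (μ - 4 * ε) + C)
    {m n : ℕ} (hm : ∀ k < m, blockEnd K k < n) :
    pathExpect p ω (metaPolicy K σ tie) n
      (fun h => ∑ k ∈ range m, if blockArm K tie h (k + 1) = b then (1 : ℝ) else 0) [] ≤
      3 / ε ^ 2 * Real.log n + (3 + (Real.exp (12 * (k₀ * C) ^ 2) + Real.exp (4 * ε * (k₀ * C))) *
        ∑' k : ℕ, 1 / (k : ℝ) ^ 2) := by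
  let mg : ℕ → ℝ := fun k => μ + (-1) * (C / K k)
  let mb : ℕ → ℝ := fun k => (μ - 4 * ε) + 1 * (C / K k)
  have hKpos : ∀ I, (0 : ℝ) < K (I + 1) := fun I => by exact_mod_cast hK.pos (I + 1) (by omega)
  have hg' : ∀ I h, mg (I + 1) ≤
      policyValue p ω (myopicPolicy σ g) (K (I + 1)) h / K (I + 1) := fun I h => by
    rw [le_div_iff₀ (hKpos I)]
    have h1 := hg (K (I + 1)) h
    have h2 : C / K (I + 1) * K (I + 1) = C := div_mul_cancel₀ _ (hKpos I).ne'
    simp only [mg]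
    linarith
  have hb' : ∀ I h, policyValue p ω (myopicPolicy σ b) (K (I + 1)) h / K (I + 1) ≤
      mb (I + 1) := fun I h => by
    rw [div_le_iff₀ (hKpos I)]
    have h1 := hb (K (I + 1)) h
    have h2 : C / K (I + 1) * K (I + 1) = C := div_mul_cancel₀ _ (hKpos I).ne'
    simp only [mb]
    linarith
  set A := Real.exp (12 * (k₀ * C) ^ 2) + Real.exp (4 * ε * (k₀ * C)) with hA
  set l := 3 * Real.log n / ε ^ 2 with hl
  have hl0 : 0 ≤ l := by
    have := Real.log_natCast_nonneg n
    positivity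
  -- The 2 covers the two prescribed blocks; `l` + 1 bounds the blocks with few earlier plays.
  have hpoint : ∀ h : SensingHistory N, ∑ k ∈ range m,
      (if blockArm K tie h (k + 1) = b then (1 : ℝ) else 0) ≤
      (2 + (l + 1)) + ∑ k ∈ (range m).filter (2 ≤ ·),
        misleading K tie g b mg mb ε (k₀ * C) k h := fun h => by
    have h1 : ∀ k ∈ range m, (if blockArm K tie h (k + 1) = b then (1 : ℝ) else 0) ≤
        (if k < 2 then 1 else 0) + (if blockArm K tie h (k + 1) = b ∧
          ((metaState K tie h k).count b : ℝ) < l then (1 : ℝ) else 0) +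
        if 2 ≤ k then misleading K tie g b mg mb ε (k₀ * C) k h else 0 := fun k hk => by
      have hnn : 0 ≤ misleading K tie g b mg mb ε (k₀ * C) k h := by
        unfold misleading; positivity
      by_cases hbk : blockArm K tie h (k + 1) = b
      · by_cases hk2 : 2 ≤ k
        · rw [if_pos hbk, if_neg (not_lt.2 hk2), if_pos hk2]
          rcases few_or_misleading (g := g) (μ := μ) hK hε hC hk₀ hk2 hbk with h2 | h2
          · have hlk : 3 * Real.log (blockEnd K k) / ε ^ 2 ≤ l := by
              have hbe : (0 : ℝ) < blockEnd K k := by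
                have := hK.le_blockEnd k
                have h3 : 0 < blockEnd K k := by omega
                exact_mod_cast h3
              have hlt : (blockEnd K k : ℝ) ≤ n := by exact_mod_cast (hm k (mem_range.1 hk)).le
              rw [hl]
              gcongr
            rw [if_pos ⟨hbk, h2.trans_le hlk⟩]
            linarith
          · have : (0 : ℝ) ≤ if blockArm K tie h (k + 1) = b ∧
              ((metaState K tie h k).count b : ℝ) < l then (1 : ℝ) else 0 := by
              split_ifs <;> norm_num
            simp only [mg, mb] at *
            linarith
        · rw [if_pos hbk, if_pos (by omega), if_neg hk2]
          split_ifs <;> norm_num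
      · rw [if_neg hbk]
        refine add_nonneg (add_nonneg ?_ ?_) ?_ <;> split_ifs <;> first | exact hnn | norm_num
    have h2 := sum_le_sum h1
    rw [sum_add_distrib, sum_add_distrib, ← sum_filter (2 ≤ ·)] at h2
    have h3 := sum_few_le (K := K) (tie := tie) h b hl0 m
    have h4 : ∑ k ∈ range m, (if k < 2 then (1 : ℝ) else 0) ≤ 2 := by
      rw [← sum_filter, sum_const, nsmul_eq_mul, mul_one]
      have : #{k ∈ range m | k < 2} ≤ #(range 2) :=
        card_le_card fun k hk => mem_range.2 (mem_filter.1 hk).2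
      rw [card_range] at this
      exact_mod_cast this
    linarith
  have h1 := pathExpect_mono (π := metaPolicy K σ tie) hp hω n []
    (F := fun h => ∑ k ∈ range m, if blockArm K tie h (k + 1) = b then (1 : ℝ) else 0)
    (G := fun h => (2 + (l + 1)) + ∑ k ∈ (range m).filter (2 ≤ ·),
        misleading K tie g b mg mb ε (k₀ * C) k h) fun h _ => hpoint ([] ++ h)
  rw [pathExpect_add, pathExpect_const, pathExpect_sum (s := (range m).filter (2 ≤ ·))] at h1
  have h2 : ∑ k ∈ (range m).filter (2 ≤ ·), pathExpect p ω (metaPolicy K σ tie) n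
      (misleading K tie g b mg mb ε (k₀ * C) k) [] ≤ A * ∑' k : ℕ, 1 / (k : ℝ) ^ 2 := by
    have h3 : ∀ k ∈ (range m).filter (2 ≤ ·), pathExpect p ω (metaPolicy K σ tie) n
      (misleading K tie g b mg mb ε (k₀ * C) k) [] ≤ A * (1 / (k : ℝ) ^ 2) := fun k hk => by
      rw [mem_filter, mem_range] at hk
      exact pathExpect_misleading_le hK hp hω σ hg' hb' hε.le _ (by omega) (hm k hk.1).le
    refine (sum_le_sum h3).trans ?_
    rw [← mul_sum]
    refine mul_le_mul_of_nonneg_left ?_ (by positivity)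
    exact (Real.summable_one_div_nat_pow.2 (by norm_num)).sum_le_tsum _
      fun k _ => by positivity
  have h3 : l = 3 / ε ^ 2 * Real.log n := by rw [hl]; ring
  refine h1.trans ?_
  rw [← h3]
  linarith

/-! ### The regret -/

/-- A single choice moves the reward by at most 1, and all continuation values lie within N/(1 -
|δ|) of the one at `b`. -/
theorem optVal_succ_le_actionVal_add (hp : ∀ o, p o ∈ Set.Icc (0 : ℝ) 1) (hδ : |p 1 - p 0| < 1)
    (n : ℕ) {b : Fin N → ℝ} (hb : ∀ i, b i ∈ Set.Icc (0 : ℝ) 1) (i : Fin N) :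
    optVal p (n + 1) b ≤ actionVal p (optVal p n) b i + (1 + 2 * (N / (1 - |p 1 - p 0|))) := by
  refine optVal_succ_le fun j => ?_
  have h1 := actionVal_mono (p := p) hb j (V := optVal p n)
    (W := fun _ => optVal p n b + N / (1 - |p 1 - p 0|))
    fun o => optVal_le_add hp hδ n (updateBelief_mem hp hb j o) hb
  have h2 := actionVal_mono (p := p) hb i (W := optVal p n)
    (V := fun _ => optVal p n b - N / (1 - |p 1 - p 0|))
    fun o => by linarith [optVal_le_add hp hδ n hb (updateBelief_mem hp hb i o)]
  have h3 := (hb j).2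
  have h4 := (hb i).1
  simp only [actionVal] at h1 h2 ⊢
  linarith

/-- Every slot in which the better arm is not followed costs at most a constant. -/
theorem policyValue_le_pathExpect_armSlots (hp : ∀ o, p o ∈ Set.Icc (0 : ℝ) 1)
    (hω : ∀ i, ω i ∈ Set.Icc (0 : ℝ) 1) (σ : Equiv.Perm (Fin N)) {g b : Fin 2} (hgb : g ≠ b)
    {κ : ℝ} (hκ : ∀ n h i, policyValue p ω (myopicPolicy σ g) (n + 1) h ≤
      belief p ω h i * (1 + policyValue p ω (myopicPolicy σ g) n (h ++ [(i, 1)])) +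
      (1 - belief p ω h i) * policyValue p ω (myopicPolicy σ g) n (h ++ [(i, 0)]) + κ)
    (n : ℕ) (h : SensingHistory N) :
    historyReward h + κ * armSlots K tie b h + policyValue p ω (myopicPolicy σ g) n h ≤
      pathExpect p ω (metaPolicy K σ tie) n
        (fun h => historyReward h + κ * armSlots K tie b h) h := by
  induction n generalizing h with
  | zero => simp [policyValue, pathExpect]
  | succ n ih =>
    have hb := belief_mem hp hω h (metaPolicy K σ tie h)
    have h1 := mul_le_mul_of_nonneg_left (ih (h ++ [(metaPolicy K σ tie h, 1)])) hb.1
    have h0 := mul_le_mul_of_nonneg_left (ih (h ++ [(metaPolicy K σ tie h, 0)]))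
      (sub_nonneg.2 hb.2)
    have hr1 : historyReward (h ++ [(metaPolicy K σ tie h, 1)]) = historyReward h + 1 := by
      simp [historyReward]
    have hr0 : historyReward (h ++ [(metaPolicy K σ tie h, 0)]) = historyReward h := by
      simp [historyReward]
    rw [hr1, armSlots_append] at h1
    rw [hr0, armSlots_append] at h0
    rw [pathExpect]
    refine le_trans ?_ (add_le_add h1 h0)
    by_cases harm : blockArm K tie h (blockAt K h.length) = b
    · have h2 := hκ n h (metaPolicy K σ tie h)
      simp only [harm, if_true]
      linarith
    · have hg : blockArm K tie h (blockAt K h.length) = g := by omega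
      have hpol : metaPolicy K σ tie h = myopicPolicy σ g h := by
        unfold metaPolicy; rw [hg]
      simp only [harm, if_false, policyValue, hpol]
      linarith

end

theorem regret_le_policyValue {P : Matrix (Fin 2) (Fin 2) ℝ} {N : ℕ} [NeZero N] {ω : Fin N → ℝ}
    (hP : P ∈ Matrix.rowStochastic ℝ (Fin 2)) (hp : ∀ o, P o 1 ∈ Set.Icc (0 : ℝ) 1)
    (hω : ∀ i, ω i ∈ Set.Icc (0 : ℝ) 1) (π : SensingPolicy N) (n : ℕ) :
    regret P ω π n ≤ optVal (fun o => P o 1) n ω - policyValue (fun o => P o 1) ω π n [] := by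
  unfold regret optimalReward
  rw [expectedReward_eq_policyValue hP]
  refine sub_le_sub_right (ciSup_le fun π' => ?_) _
  rw [expectedReward_eq_policyValue hP]
  exact policyValue_le_optVal (p := fun o => P o 1) hp hω n []

/-- The bound for a fixed number of channels when the two policies are separated. -/
theorem exists_regret_bound_of_separatesArms {P : Matrix (Fin 2) (Fin 2) ℝ}
    (hP : P ∈ Matrix.rowStochastic ℝ (Fin 2)) (hp : ∀ o, P o 1 ∈ Set.Icc (0 : ℝ) 1)
    (hmix : |P 1 1 - P 0 1| < 1) {g : Fin 2} {Δ C₁ : ℝ} (hΔ : 0 < Δ)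
    (hsep : SeparatesArms (fun o => P o 1) g Δ C₁) (N : ℕ) [NeZero N] (hN : N = 2 ∨ N = 3) :
    ∃ Z₁ : ℝ, 0 ≤ Z₁ ∧ ∀ K : ℕ → ℕ, IsBlockSequence K → ∃ Z₃ Z₄ : ℝ, 0 ≤ Z₃ ∧ 0 ≤ Z₄ ∧
      ∀ ω : Fin N → ℝ, (∀ i, ω i ∈ Set.Icc (0 : ℝ) 1) →
      ∀ (σ : Equiv.Perm (Fin N)) (tie : SensingHistory N → Fin 2) (n : ℕ), 1 ≤ n →
        regret P ω (metaPolicy K σ tie) n ≤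
          Z₁ * blockLength K n * Real.log n + Z₃ * blockLength K n + Z₄ := by
  set p : Fin 2 → ℝ := fun o => P o 1
  obtain ⟨μ, C₂, hμ⟩ := exists_optimalRate (p := p) N hp hmix
  obtain ⟨b, hgb⟩ : ∃ b, g ≠ b := (exists_ne g).imp fun _ h => h.symm
  have hC₁ : 0 ≤ C₁ := by
    have := (hsep N hN (fun _ => 0) (by simp) 1 0 []).1
    simpa [optVal, policyValue] using this
  have hC₂ : 0 ≤ C₂ := (abs_nonneg _).trans (hμ 0 (fun _ => 0) (by simp))
  set C := C₁ + C₂ with hCdef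
  have hC : 0 ≤ C := add_nonneg hC₁ hC₂
  set E : ℝ := N / (1 - |p 1 - p 0|) with hE
  have hE0 : 0 ≤ E := div_nonneg (Nat.cast_nonneg _) (sub_nonneg.2 hmix.le)
  -- The cost of one foreign choice followed by the good arm: 1 + 2E against the optimum, and C₁ for
  -- the suboptimality of the good arm afterwards.
  set κ := C₁ + (1 + 2 * E) with hκdef
  have hκ0 : 0 ≤ κ := by positivity
  -- The gap is split into four: one ε for the bias of each arm, one for the confidence radius of
  -- the bad arm, and one as a margin.
  set ε := Δ / 4 with hεdef
  have hε : 0 < ε := by positivity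
  refine ⟨κ * (3 / ε ^ 2), by positivity, fun K hK => ?_⟩
  obtain ⟨k₀, hk₀⟩ : ∃ k₀ : ℕ, ∀ k, k₀ ≤ k → C / K k ≤ ε := by
    have h1 : Filter.Tendsto (fun k => C / (K k : ℝ)) Filter.atTop (nhds 0) :=
      (tendsto_const_div_atTop_nhds_zero_nat C).comp hK.diverges
    obtain ⟨k₀, hk₀⟩ := Filter.eventually_atTop.1 (h1.eventually_le_const hε)
    exact ⟨k₀, hk₀⟩
  set A := 3 + (Real.exp (12 * (k₀ * C) ^ 2) + Real.exp (4 * ε * (k₀ * C))) *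
    ∑' k : ℕ, 1 / (k : ℝ) ^ 2 with hA
  have hA0 : 0 ≤ A := by
    have : (0 : ℝ) ≤ ∑' k : ℕ, 1 / (k : ℝ) ^ 2 := tsum_nonneg fun k => by positivity
    positivity
  refine ⟨κ * A, C₁, by positivity, hC₁, fun ω hω σ tie n hn => ?_⟩
  have hb01 := fun h => belief_mem (p := p) hp hω h
  have hg : ∀ n h, n * μ - C ≤ policyValue p ω (myopicPolicy σ g) n h := fun n h => by
    have h1 := (hsep N hN ω hω σ n h).1
    have h2 := (abs_le.1 (hμ n _ (hb01 h))).1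
    linarith
  have hb : ∀ n h, policyValue p ω (myopicPolicy σ b) n h ≤ n * (μ - 4 * ε) + C := fun n h => by
    have h1 := (hsep N hN ω hω σ n h).2 b hgb.symm
    have h2 := (abs_le.1 (hμ n _ (hb01 h))).2
    have h3 : 4 * ε = Δ := by rw [hεdef]; ring
    rw [h3]
    linarith
  have hκ : ∀ n h i, policyValue p ω (myopicPolicy σ g) (n + 1) h ≤
      belief p ω h i * (1 + policyValue p ω (myopicPolicy σ g) n (h ++ [(i, 1)])) +
      (1 - belief p ω h i) * policyValue p ω (myopicPolicy σ g) n (h ++ [(i, 0)]) + κ :=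
    fun n h i => by
      have h1 := policyValue_le_optVal (π := myopicPolicy σ g) (p := p) hp hω (n + 1) h
      have h2 := optVal_succ_le_actionVal_add (p := p) hp hmix n (hb01 h) i
      have h3 := fun o => (hsep N hN ω hω σ n (h ++ [(i, o)])).1
      simp only [belief_append] at h3
      have h4 := mul_le_mul_of_nonneg_left (h3 1) (hb01 h i).1
      have h5 := mul_le_mul_of_nonneg_left (h3 0) (sub_nonneg.2 (hb01 h i).2)
      rw [← hE] at h2
      simp only [actionVal] at h2
      linarith
  obtain ⟨m, hm1, hm2, hm3⟩ := exists_lastBlock hK hn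
  have h1 := policyValue_le_pathExpect_armSlots (K := K) (tie := tie) (p := p) hp hω σ hgb hκ n []
  rw [pathExpect_add, pathExpect_const_mul, pathExpect_historyReward] at h1
  have h2 : pathExpect p ω (metaPolicy K σ tie) n (armSlots K tie b) [] ≤
      blockLength K n * (3 / ε ^ 2 * Real.log n + A) := by
    refine (pathExpect_mono (p := p) hp hω n [] (G := fun h => (blockLength K n : ℝ) *
      ∑ k ∈ range m, if blockArm K tie h (k + 1) = b then (1 : ℝ) else 0)
      fun h hh => ?_).trans ?_
    · rw [List.nil_append]
      exact armSlots_le hK b h (by omega) hm3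
    · rw [pathExpect_const_mul]
      exact mul_le_mul_of_nonneg_left
        (pathExpect_badBlocks_le hK hp hω σ hε hC hk₀ hg hb hm2) (Nat.cast_nonneg _)
  have h3 := mul_le_mul_of_nonneg_left h2 hκ0
  have h4 := (hsep N hN ω hω σ n []).1
  have h5 := regret_le_policyValue hP hp hω (metaPolicy K σ tie) n
  have h6 : armSlots K tie b ([] : SensingHistory N) = 0 := by simp [armSlots]
  rw [h6] at h1
  have h7 : belief p ω [] = ω := rfl
  rw [h7] at h4
  linarith

theorem exists_regret_bound {P : Matrix (Fin 2) (Fin 2) ℝ}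
    (hP : P ∈ Matrix.rowStochastic ℝ (Fin 2))
    (hmix : |P 1 1 - P 0 1| < 1) (N : ℕ) [NeZero N] (hN : N = 2 ∨ N = 3) :
    ∃ Z₁ : ℝ, 0 ≤ Z₁ ∧ ∀ K : ℕ → ℕ, IsBlockSequence K → ∃ Z₃ Z₄ : ℝ, 0 ≤ Z₃ ∧ 0 ≤ Z₄ ∧
      ∀ ω : Fin N → ℝ, (∀ i, ω i ∈ Set.Icc (0 : ℝ) 1) →
      ∀ (σ : Equiv.Perm (Fin N)) (tie : SensingHistory N → Fin 2) (n : ℕ), 1 ≤ n →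
        regret P ω (metaPolicy K σ tie) n ≤
          Z₁ * blockLength K n * Real.log n + Z₃ * blockLength K n + Z₄ := by
  have hp : ∀ o, P o 1 ∈ Set.Icc (0 : ℝ) 1 := fun o =>
    ⟨Matrix.nonneg_of_mem_rowStochastic hP, Matrix.le_one_of_mem_rowStochastic hP⟩
  by_cases hdeg : P 0 1 = P 1 1 ∨ P 0 1 = 0 ∧ P 0 1 < P 1 1 ∨ P 1 1 = 1 ∧ P 0 1 < P 1 1
  · have hE0 : (0 : ℝ) ≤ 2 * (N / (1 - |P 1 1 - P 0 1|)) :=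
      mul_nonneg zero_le_two (div_nonneg (Nat.cast_nonneg _) (sub_nonneg.2 hmix.le))
    refine ⟨0, le_rfl, fun K _ => ⟨0, _, le_rfl, hE0, fun ω hω σ tie n _ => ?_⟩⟩
    have h1 := optVal_le_policyValue_of_degenerate (p := fun o => P o 1) (N := N)
      (π := metaPolicy K σ tie) hp hω hmix (by tauto) n []
    have h2 := regret_le_policyValue hP hp hω (metaPolicy K σ tie) n
    have h7 : belief (fun o => P o 1) ω [] = ω := rfl
    rw [h7] at h1
    linarith
  · push Not at hdeg
    obtain ⟨hne, h0, h1⟩ := hdeg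
    obtain ⟨g, Δ, C, hΔ, hsep⟩ := exists_separatesArms (p := fun o => P o 1) hp hmix hne
      (fun h => (hp 0).1.lt_of_ne fun e => absurd h (not_lt.2 (h0 e.symm)))
      (fun h => (hp 1).2.lt_of_ne fun e => absurd h (not_lt.2 (h1 e)))
    exact exists_regret_bound_of_separatesArms hP hp hmix hΔ hsep N hN

theorem theorem1 (P : Matrix (Fin 2) (Fin 2) ℝ) (hP : P ∈ Matrix.rowStochastic ℝ (Fin 2))
    (hmix : |P 1 1 - P 0 1| < 1) :
    ∃ Z₁ Z₂ : ℝ, ∀ K : ℕ → ℕ, IsBlockSequence K → ∃ Z₃ Z₄ : ℝ,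
      ∀ (N : ℕ) [NeZero N], (N = 2 ∨ N = 3) →
      ∀ ω : Fin N → ℝ, (∀ i, ω i ∈ Set.Icc (0 : ℝ) 1) →
      ∀ (σ : Equiv.Perm (Fin N)) (tie : SensingHistory N → Fin 2) (n : ℕ), 1 ≤ n →
        regret P ω (metaPolicy K σ tie) n ≤
          Z₁ * blockLength K n * Real.log n + Z₂ * Real.log n + Z₃ * blockLength K n + Z₄ := by
  obtain ⟨a, ha, hA⟩ := exists_regret_bound hP hmix 2 (Or.inl rfl)
  obtain ⟨b, hb, hB⟩ := exists_regret_bound hP hmix 3 (Or.inr rfl)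
  -- All constants are nonnegative, so their sums serve both numbers of channels.
  refine ⟨a + b, 0, fun K hK => ?_⟩
  obtain ⟨a₃, a₄, ha₃, ha₄, hA⟩ := hA K hK
  obtain ⟨b₃, b₄, hb₃, hb₄, hB⟩ := hB K hK
  refine ⟨a₃ + b₃, a₄ + b₄, fun N _ hN ω hω σ tie n hn => ?_⟩
  have hG : (0 : ℝ) ≤ blockLength K n := Nat.cast_nonneg _
  have hL : 0 ≤ Real.log n := Real.log_natCast_nonneg n
  have e1 := mul_nonneg (mul_nonneg ha hG) hL
  have e2 := mul_nonneg (mul_nonneg hb hG) hL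
  have e3 := mul_nonneg ha₃ hG
  have e4 := mul_nonneg hb₃ hG
  rcases hN with rfl | rfl
  · have := hA ω hω σ tie n hn
    linarith
  · have := hB ω hω σ tie n hn
    linarith
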